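/- Let $\Gamma$ be a finite simple graph with vertex set $V(\Gamma)=\{s_1,\dots,s_r\}$, and let $A_\Gamma=\langle V(\Gamma)\mid s_is_j=s_js_i \text{ for every edge } \{s_i,s_j\}\text{ of }\Gamma\rangle$ be the associated right-angled Artin group. Put $X=V(\Gamma)\cup V(\Gamma)^{-1}$. For $g\in A_\Gamma$ let $|g|$ denote the least length of a word in $X^*$ representing $g$. For $\phi\in\mathrm{Aut}(A_\Gamma)$, elements $u,v\in A_\Gamma$ are called $\phi$-twisted conjugate if $v=\phi(w)^{-1}uw$ for some $w\in A_\Gamma$. The $\phi$-twisted conjugacy problem $\mathrm{TCP}_\phi(A_\Gamma)$ takes as input two words $u,v\in X^*$ and asks whether the elements they represent are $\phi$-twisted conjugate. 1. If $\phi$ is length-preserving, that is, $|\phi(g)|=|g|$ for all $g\in A_\Gamma$, then $\mathrm{TCP}_\phi(A_\Gamma)$ is solvable, i.e. there is an algorithm that decides it. 2. If $\phi$ is a composition of inversions (an inversion is an automorphism that sends some vertex $s_i$ to $s_i^{-1}$ and fixes all the other vertices), then $\mathrm{TCP}_\phi(A_\Gamma)$ is decidable in linear time on a RAM machine: there are a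 program for a random access machine (with integer registers, indirect addressing, and basic arithmetical operations on integers at unit cost) and a constant $C$, both depending only on $\Gamma$ and $\phi$, such that on every pair of words $u,v\in X^*$ the program halts after at most $C\,(l(u)+l(v)+1)$ steps and correctly outputs whether $u$ and $v$ represent $\phi$-twisted conjugate elements; here $l$ denotes word length. -/

import Mathlib

/-! ### Right-angled Artin groups, words, length -/

/-- The defining relators of the right-angled Artin group of `Γ`: the commutators `[a, b]`,
one for each edge `{a, b}`. -/
def raagRels {V : Type*} (Γ : SimpleGraph V) : Set (FreeGroup V) :=
  {x | ∃ a b : V, Γ.Adj a b ∧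
    x = FreeGroup.of a * FreeGroup.of b * (FreeGroup.of a)⁻¹ * (FreeGroup.of b)⁻¹}

/-- The right-angled Artin group `A_Γ = ⟨V(Γ) ∣ ab = ba for every edge {a, b}⟩`. -/
abbrev RAAG {V : Type*} (Γ : SimpleGraph V) : Type _ := PresentedGroup (raagRels Γ)

/-- The generator of `A_Γ` given by a vertex. -/
def RAAG.gen {V : Type*} (Γ : SimpleGraph V) (a : V) : RAAG Γ := PresentedGroup.of a

/-- Words over `X = V(Γ)^±`: the letter `(a, true)` stands for `a`, and `(a, false)` for `a⁻¹`. -/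
abbrev RAAG.Word (V : Type*) : Type _ := List (V × Bool)

/-- The natural projection `X* → A_Γ`. -/
def RAAG.eval {V : Type*} (Γ : SimpleGraph V) (w : RAAG.Word V) : RAAG Γ :=
  (w.map fun x => if x.2 then RAAG.gen Γ x.1 else (RAAG.gen Γ x.1)⁻¹).prod

/-- The length `|g|`: the least length of a word over `X = V(Γ)^±` that represents `g`. -/
noncomputable def RAAG.length {V : Type*} (Γ : SimpleGraph V) (g : RAAG Γ) : ℕ :=
  sInf {n | ∃ w : RAAG.Word V, RAAG.eval Γ w = g ∧ List.length w = n}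

/-! ### Automorphisms -/

/-- `φ` is length-preserving: `|π(w)| = |φ(π(w))|` for every word `w`, where `π` is the
projection `X* → A_Γ`. -/
def IsLengthPreserving {V : Type*} {Γ : SimpleGraph V} (φ : MulAut (RAAG Γ)) : Prop :=
  ∀ w : RAAG.Word V, RAAG.length Γ (RAAG.eval Γ w) = RAAG.length Γ (φ (RAAG.eval Γ w))

/-- `φ` is an inversion: for some vertex `x` it sends `x` to `x⁻¹` and fixes all other vertices. -/
def IsInversion {V : Type*} {Γ : SimpleGraph V} (φ : MulAut (RAAG Γ)) : Prop :=
  ∃ x : V, φ (RAAG.gen Γ x) = (RAAG.gen Γ x)⁻¹ ∧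
    ∀ y : V, y ≠ x → φ (RAAG.gen Γ y) = RAAG.gen Γ y

/-- `φ` is a (finite) composition of inversions. The product in `MulAut` is composition. -/
def IsCompositionOfInversions {V : Type*} {Γ : SimpleGraph V} (φ : MulAut (RAAG Γ)) : Prop :=
  ∃ l : List (MulAut (RAAG Γ)), (∀ ψ ∈ l, IsInversion ψ) ∧ φ = l.prod

/-! ### Twisted conjugacy -/

/-- `u` and `v` are `φ`-twisted conjugate: `v = φ(w)⁻¹ u w` for some `w`. -/
def TwistedConj {G : Type*} [Group G] (φ : MulAut G) (u v : G) : Prop :=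
  ∃ w : G, v = (φ w)⁻¹ * u * w

/-- The problem `TCP_φ(A_Γ)`, as a set of pairs of words `(u, v)` over `X`. -/
def TCP {V : Type*} {Γ : SimpleGraph V} (φ : MulAut (RAAG Γ))
    (p : RAAG.Word V × RAAG.Word V) : Prop :=
  TwistedConj φ (RAAG.eval Γ p.1) (RAAG.eval Γ p.2)

/-! ### Random access machines with the uniform cost criterion

Memory is a sequence of registers `0, 1, 2, …`, each holding an arbitrary integer; register `0`
is the accumulator. There is a read-only input tape and a write-only output tape of integers.
The program is a fixed list of instructions, and every executed instruction costs one unit of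
time. -/

/-- Operands `=n`, `i` and `*i`: a literal, a register, and indirect addressing. -/
inductive RAM.Operand : Type
  | lit (n : ℤ)
  | reg (i : ℕ)
  | ind (i : ℕ)

/-- The instruction set. Labels of jumps are positions in the program. -/
inductive RAM.Instr : Type
  | load (a : RAM.Operand)
  | store (a : RAM.Operand)
  | add (a : RAM.Operand)
  | sub (a : RAM.Operand)
  | mult (a : RAM.Operand)
  | div (a : RAM.Operand)
  | read (a : RAM.Operand)
  | write (a : RAM.Operand)
  | jump (b : ℕ)
  | jgtz (b : ℕ)
  | jzero (b : ℕ)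
  | halt

/-- A program. -/
abbrev RAM.Program : Type := List RAM.Instr

/-- A configuration: program counter, registers, unread input, output written so far. -/
structure RAM.Config : Type where
  pc : ℕ
  mem : ℕ → ℤ
  input : List ℤ
  output : List ℤ

/-- The value of an operand; undefined for an indirect reference to a negative address. -/
def RAM.Operand.value (m : ℕ → ℤ) : RAM.Operand → Option ℤ
  | .lit n => some n
  | .reg i => some (m i)
  | .ind i => if 0 ≤ m i then some (m (m i).toNat) else none

/-- The register named by an operand; undefined for a literal, and for an indirect reference to
a negative address. -/
def RAM.Operand.address (m : ℕ → ℤ) : RAM.Operand → Option ℕ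
  | .lit _ => none
  | .reg i => some i
  | .ind i => if 0 ≤ m i then some (m i).toNat else none

/-- Write `z` into register `i` and pass to the next instruction. -/
def RAM.Config.put (c : RAM.Config) (i : ℕ) (z : ℤ) : RAM.Config :=
  { c with pc := c.pc + 1, mem := Function.update c.mem i z }

/-- Jump to `b` if `cond` holds, otherwise pass to the next instruction. -/
def RAM.Config.branch (c : RAM.Config) (cond : Bool) (b : ℕ) : RAM.Config :=
  { c with pc := if cond then b else c.pc + 1 }

/-- Execution of one instruction. The value `none` means that the machine has halted: at `halt`,
past the end of the program, at an undefined operand, or at a division by zero. Division is the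
floor of the quotient. Reading past the end of the input yields `0`. -/
def RAM.exec (c : RAM.Config) : RAM.Instr → Option RAM.Config
  | .load a => (a.value c.mem).map fun v => c.put 0 v
  | .store a => (a.address c.mem).map fun i => c.put i (c.mem 0)
  | .add a => (a.value c.mem).map fun v => c.put 0 (c.mem 0 + v)
  | .sub a => (a.value c.mem).map fun v => c.put 0 (c.mem 0 - v)
  | .mult a => (a.value c.mem).map fun v => c.put 0 (c.mem 0 * v)
  | .div a => (a.value c.mem).bind fun v =>
      if v = 0 then none else some (c.put 0 (Int.fdiv (c.mem 0) v))
  | .read a => (a.address c.mem).map fun i =>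
      { c.put i (c.input.headD 0) with input := c.input.tail }
  | .write a => (a.value c.mem).map fun v =>
      { c with pc := c.pc + 1, output := c.output ++ [v] }
  | .jump b => some (c.branch true b)
  | .jgtz b => some (c.branch (decide (0 < c.mem 0)) b)
  | .jzero b => some (c.branch (decide (c.mem 0 = 0)) b)
  | .halt => none

/-- One step of the program `P`. -/
def RAM.step (P : RAM.Program) (c : RAM.Config) : Option RAM.Config :=
  (P[c.pc]?).bind (RAM.exec c)

/-- `RAM.Steps P t c d`: the program leads from `c` to `d` in exactly `t` steps. -/
inductive RAM.Steps (P : RAM.Program) : ℕ → RAM.Config → RAM.Config → Prop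
  | refl (c : RAM.Config) : RAM.Steps P 0 c c
  | cons {t : ℕ} {c d e : RAM.Config} (h : RAM.step P c = some d) (hs : RAM.Steps P t d e) :
      RAM.Steps P (t + 1) c e

/-- The initial configuration: all registers are zero. -/
def RAM.init (input : List ℤ) : RAM.Config where
  pc := 0
  mem := fun _ => 0
  input := input
  output := []

/-- On the given input, `P` halts after at most `T` steps, with the given output. -/
def RAM.HaltsWithin (P : RAM.Program) (input : List ℤ) (T : ℕ) (output : List ℤ) : Prop :=
  ∃ t ≤ T, ∃ c : RAM.Config,
    RAM.Steps P t (RAM.init input) c ∧ RAM.step P c = none ∧ c.output = output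

/-- Letters as integers: the `i`-th generator (`i = 1, …, r`) is `i`, and its inverse is `-i`. -/
def encodeLetter {r : ℕ} (x : Fin r × Bool) : ℤ :=
  if x.2 then (x.1 : ℤ) + 1 else -((x.1 : ℤ) + 1)

/-- The input tape for a pair of words: the letters of `u`, the mark `0`, the letters of `v`,
the mark `0`. -/
def encodePair {r : ℕ} (p : RAAG.Word (Fin r) × RAAG.Word (Fin r)) : List ℤ :=
  p.1.map encodeLetter ++ [0] ++ p.2.map encodeLetter ++ [0]

/-- A problem about pairs of words is decidable in linear time on a RAM: some program halts on
every pair `(u, v)` within `C (l(u) + l(v) + 1)` steps, with output `1` if the answer is yes, and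
`0` if it is no. -/
def DecidableInLinearTimeRAM {r : ℕ} (S : RAAG.Word (Fin r) × RAAG.Word (Fin r) → Prop) : Prop :=
  ∃ (P : RAM.Program) (C : ℕ), ∀ p : RAAG.Word (Fin r) × RAAG.Word (Fin r),
    (S p → RAM.HaltsWithin P (encodePair p) (C * (List.length p.1 + List.length p.2 + 1)) [1]) ∧
    (¬ S p → RAM.HaltsWithin P (encodePair p) (C * (List.length p.1 + List.length p.2 + 1)) [0])

set_option linter.unusedSectionVars false


/-! A word is represented by its piling: every vertex `c` has a string of beads, with a signed bead
for a letter of `c`, a bead `0` for a letter that does not commute with `c`, and nothing for a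
letter that does. Words with equal pilings differ by commutations. The group acts on the pilings of
reduced words, so an element has only one reduced piling (`Red.traceEq`), and the reduced words are
the geodesics (`red_iff_length`).

A length-preserving `φ` permutes the letters. A rotation moves a letter from one end of a geodesic
to the other and applies `φ` or its inverse to it. The central fact is `exists_rotSteps`: if `u w =
φ(w) v`, then `u` and `v` can be rotated to a common element. The proof is by induction on the
length of `w`: a letter of `w` is absorbed by a rotation of `u` or `v`, or else the first letters of
`w` form a set that `φ` permutes and that commutes with `u`, and they can be dropped.

Decidability: rotations do not increase length, so twisted conjugate elements are joined by
one-letter conjugations inside a finite ball. This bounds the length of a conjugator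
(`exists_short_conjugator`), and a search with a primitive recursive solution of the word problem
decides.

Linear time: a composition of inversions flips the signs of some vertices and is an involution.
Twisted cyclically reduced words represent twisted conjugate elements exactly when rotations and
commutations connect them (`eqvGen_rotWord`). This can be tested on each component `C` of the
non-commutation graph on the support. Rotations of pilings commute with each other. For a fixed `a`
in `C`, rotating all vertices of `C` except `a` as long as possible takes at most `|C| n` moves and
ends in a unique stuck state. By a confluence argument (`System.exists_iterate_eq`) the stuck state
of one word is met within `|C| n + 2 n` steps on the orbit of the other under a fixed scheduler; the
`2 n` comes from the fact that rotating a whole word twice is the identity. Finally, a string of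
beads is stored as one integer in balanced ternary, so rotations, cancellations and comparisons each
cost boundedly many RAM instructions. -/

/-! ### Letters, words and piles -/

namespace RAAG

section Piles

variable {V : Type*} (Γ : SimpleGraph V)

/-- The inverse of a letter. -/
def invLetter (x : V × Bool) : V × Bool := (x.1, !x.2)

/-- The sign of a letter. -/
def sgn (x : V × Bool) : ℤ := if x.2 then 1 else -1

/-- The formal inverse of a word. -/
def invWord (w : Word V) : Word V := (w.map invLetter).reverse

@[simp] theorem invLetter_fst (x : V × Bool) : (invLetter x).1 = x.1 := rfl

@[simp] theorem invLetter_invLetter (x : V × Bool) : invLetter (invLetter x) = x := by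
  simp [invLetter]

@[simp] theorem sgn_invLetter (x : V × Bool) : sgn (invLetter x) = -sgn x := by
  rcases x with ⟨a, _ | _⟩ <;> simp [sgn, invLetter]

theorem sgn_eq (x : V × Bool) : sgn x = 1 ∨ sgn x = -1 := by
  rcases x with ⟨a, _ | _⟩ <;> simp [sgn]

theorem sgn_ne_zero (x : V × Bool) : sgn x ≠ 0 := by
  rcases sgn_eq x with h | h <;> simp [h]

theorem letter_ext {x y : V × Bool} (h₁ : x.1 = y.1) (h₂ : sgn x = sgn y) : x = y := by
  rcases x with ⟨a, _ | _⟩ <;> rcases y with ⟨b, _ | _⟩ <;> simp_all [sgn]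

@[simp] theorem eval_nil : eval Γ [] = 1 := rfl

theorem eval_cons (x : V × Bool) (w : Word V) : eval Γ (x :: w) = eval Γ [x] * eval Γ w := by
  simp [eval]

@[simp] theorem eval_append (v w : Word V) : eval Γ (v ++ w) = eval Γ v * eval Γ w := by
  simp [eval]

@[simp] theorem eval_invLetter (x : V × Bool) : eval Γ [invLetter x] = (eval Γ [x])⁻¹ := by
  rcases x with ⟨a, _ | _⟩ <;> simp [eval, invLetter]

theorem eval_invWord (w : Word V) : eval Γ (invWord w) = (eval Γ w)⁻¹ := by
  induction w with
  | nil => simp [invWord]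
  | cons x w ih =>
    rw [eval_cons Γ x w, mul_inv_rev, ← ih]
    simp [invWord]

theorem gen_commute {a b : V} (h : Γ.Adj a b) : Commute (gen Γ a) (gen Γ b) := by
  have hr : FreeGroup.of a * FreeGroup.of b * (FreeGroup.of a)⁻¹ * (FreeGroup.of b)⁻¹ ∈
      raagRels Γ := ⟨a, b, h, rfl⟩
  have h1 := PresentedGroup.one_of_mem hr
  simp only [map_mul, map_inv] at h1
  change gen Γ a * gen Γ b * (gen Γ a)⁻¹ * (gen Γ b)⁻¹ = 1 at h1
  rw [mul_inv_eq_one, mul_inv_eq_iff_eq_mul] at h1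
  exact h1

theorem eval_commute {x y : V × Bool} (h : Γ.Adj x.1 y.1) :
    Commute (eval Γ [x]) (eval Γ [y]) := by
  have := gen_commute Γ h
  rcases x with ⟨a, _ | _⟩ <;> rcases y with ⟨b, _ | _⟩ <;> simpa [eval] using this

theorem exists_eval_eq (g : RAAG Γ) : ∃ w : Word V, eval Γ w = g := by
  induction g using PresentedGroup.induction_on with
  | _ z =>
    induction z using FreeGroup.induction_on with
    | C1 => exact ⟨[], by simp⟩
    | of a => exact ⟨[(a, true)], by simp [eval]; rfl⟩
    | inv_of a _ => exact ⟨[(a, false)], by simp [eval]; rfl⟩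
    | mul x y hx hy =>
      obtain ⟨v, hv⟩ := hx
      obtain ⟨w, hw⟩ := hy
      exact ⟨v ++ w, by rw [eval_append, hv, hw, map_mul]⟩

variable {Γ} in
theorem eval_middle {x : V × Bool} {p : Word V} (hp : ∀ y ∈ p, Γ.Adj y.1 x.1) (q : Word V) :
    eval Γ (p ++ x :: q) = eval Γ (x :: (p ++ q)) := by
  induction p with
  | nil => rfl
  | cons y p ih =>
    have := ih fun z hz => hp z (by simp [hz])
    rw [List.cons_append, eval_cons, this, eval_cons Γ x, ← mul_assoc,
      (eval_commute Γ (hp y (by simp))).eq, mul_assoc, ← eval_cons, ← eval_cons]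
    rfl

variable {Γ} in
theorem length_le (w : Word V) : length Γ (eval Γ w) ≤ w.length :=
  Nat.sInf_le ⟨w, rfl, rfl⟩

variable {Γ} in
theorem exists_length_eq (g : RAAG Γ) :
    ∃ w : Word V, eval Γ w = g ∧ w.length = length Γ g := by
  obtain ⟨w, hw⟩ := exists_eval_eq Γ g
  exact Nat.sInf_mem (s := {n | ∃ w : Word V, eval Γ w = g ∧ w.length = n}) ⟨_, w, hw, rfl⟩

variable {Γ} in
theorem length_mul_le (g h : RAAG Γ) : length Γ (g * h) ≤ length Γ g + length Γ h := by
  obtain ⟨v, rfl, hv⟩ := exists_length_eq g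
  obtain ⟨w, rfl, hw⟩ := exists_length_eq h
  rw [← eval_append, ← hv, ← hw]
  simpa using length_le (Γ := Γ) (v ++ w)

/-! ### Pilings and equality up to commutations. -/

variable [DecidableEq V] [DecidableRel Γ.Adj]

/-- The bead that a letter puts on the string of the vertex `c`: its sign if it is a letter of `c`,
nothing if it commutes with `c`, and `0` otherwise. -/
def bead (c : V) (x : V × Bool) : Option ℤ :=
  if x.1 = c then some (sgn x) else if Γ.Adj x.1 c then none else some 0

/-- The string of beads of the vertex `c` in the piling of a word. -/
def pile (c : V) (w : Word V) : List ℤ := w.filterMap (bead Γ c)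

/-- Words with the same piling, that is, words that are equal up to commutations. -/
def TraceEq (v w : Word V) : Prop := ∀ c, pile Γ c v = pile Γ c w

/-- Words without cancellation, up to commutations. -/
def Red : Word V → Prop
  | [] => True
  | x :: w => Red w ∧ (pile Γ x.1 w).head? ≠ some (-sgn x)

variable {Γ}

@[simp] theorem pile_nil (c : V) : pile Γ c [] = [] := rfl

@[simp] theorem pile_append (c : V) (v w : Word V) :
    pile Γ c (v ++ w) = pile Γ c v ++ pile Γ c w := by simp [pile]

theorem pile_reverse (c : V) (w : Word V) : pile Γ c w.reverse = (pile Γ c w).reverse := by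
  simp [pile, List.filterMap_reverse]

theorem bead_eq_none {c : V} {x : V × Bool} : bead Γ c x = none ↔ Γ.Adj x.1 c := by
  unfold bead
  split_ifs with h h' <;> simp_all

theorem bead_self (x : V × Bool) : bead Γ x.1 x = some (sgn x) := by simp [bead]

theorem bead_of_adj {c : V} {x : V × Bool} (h : Γ.Adj x.1 c) : bead Γ c x = none :=
  bead_eq_none.2 h

theorem bead_of_ne {c : V} {x : V × Bool} (h : x.1 ≠ c) (h' : ¬ Γ.Adj x.1 c) :
    bead Γ c x = some 0 := by simp [bead, h, h']

theorem pile_cons_self (x : V × Bool) (w : Word V) :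
    pile Γ x.1 (x :: w) = sgn x :: pile Γ x.1 w := by
  simp [pile, bead_self]

theorem pile_cons_of_adj {c : V} {x : V × Bool} (h : Γ.Adj x.1 c) (w : Word V) :
    pile Γ c (x :: w) = pile Γ c w := by
  simp [pile, bead_of_adj h]

theorem pile_cons_of_ne {c : V} {x : V × Bool} (h : x.1 ≠ c) (h' : ¬ Γ.Adj x.1 c) (w : Word V) :
    pile Γ c (x :: w) = 0 :: pile Γ c w := by
  simp [pile, bead_of_ne h h']

theorem pile_cons (c : V) (x : V × Bool) (w : Word V) :
    pile Γ c (x :: w) = pile Γ c [x] ++ pile Γ c w :=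
  pile_append c [x] w

theorem pile_eq_nil_of_adj {c : V} {w : Word V} (h : ∀ y ∈ w, Γ.Adj y.1 c) :
    pile Γ c w = [] := by
  simpa [pile, List.filterMap_eq_nil_iff] using fun a b hab => bead_of_adj (Γ := Γ) (h (a, b) hab)

theorem pile_eq_nil_iff {c : V} {w : Word V} : pile Γ c w = [] ↔ ∀ y ∈ w, Γ.Adj y.1 c := by
  simp only [pile, List.filterMap_eq_nil_iff, bead_eq_none]

theorem pile_pair_comm {x y : V × Bool} (h : Γ.Adj x.1 y.1) (c : V) :
    pile Γ c [x, y] = pile Γ c [y, x] := by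
  by_cases hx : Γ.Adj x.1 c
  · simp [pile, bead_of_adj hx, List.filterMap_cons]
  by_cases hy : Γ.Adj y.1 c
  · simp [pile, bead_of_adj hy, List.filterMap_cons]
  have hxc : x.1 ≠ c := by rintro rfl; exact hy h.symm
  have hyc : y.1 ≠ c := by rintro rfl; exact hx h
  rw [pile_cons_of_ne hxc hx, pile_cons_of_ne hyc hy, pile_cons_of_ne hyc hy,
    pile_cons_of_ne hxc hx]

theorem TraceEq.refl (w : Word V) : TraceEq Γ w w := fun _ => rfl

theorem TraceEq.symm {v w : Word V} (h : TraceEq Γ v w) : TraceEq Γ w v := fun c => (h c).symm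

theorem TraceEq.trans {u v w : Word V} (h : TraceEq Γ u v) (h' : TraceEq Γ v w) :
    TraceEq Γ u w := fun c => (h c).trans (h' c)

theorem TraceEq.append {u u' v v' : Word V} (h : TraceEq Γ u u') (h' : TraceEq Γ v v') :
    TraceEq Γ (u ++ v) (u' ++ v') := fun c => by rw [pile_append, pile_append, h c, h' c]

theorem TraceEq.cons {v v' : Word V} (x : V × Bool) (h' : TraceEq Γ v v') :
    TraceEq Γ (x :: v) (x :: v') := TraceEq.append (TraceEq.refl [x]) h'

theorem TraceEq.of_cons {v v' : Word V} {x : V × Bool} (h : TraceEq Γ (x :: v) (x :: v')) :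
    TraceEq Γ v v' := fun c => by
  have := h c
  rwa [pile_cons, pile_cons c x v', List.append_cancel_left_eq] at this

theorem TraceEq.reverse {v w : Word V} (h : TraceEq Γ v w) : TraceEq Γ v.reverse w.reverse :=
  fun c => by rw [pile_reverse, pile_reverse, h c]

theorem traceEq_swap {x y : V × Bool} (h : Γ.Adj x.1 y.1) (w : Word V) :
    TraceEq Γ (x :: y :: w) (y :: x :: w) :=
  TraceEq.append (u := [x, y]) (u' := [y, x]) (pile_pair_comm h) (TraceEq.refl w)

theorem traceEq_middle {x : V × Bool} {p : Word V} (hp : ∀ y ∈ p, Γ.Adj y.1 x.1) (q : Word V) :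
    TraceEq Γ (p ++ x :: q) (x :: (p ++ q)) := by
  induction p with
  | nil => exact TraceEq.refl _
  | cons y p ih =>
    refine (TraceEq.cons y (ih fun z hz => hp z (by simp [hz]))).trans ?_
    exact traceEq_swap (hp y (by simp)) _

/-- A letter that is on top of its string can be brought to the front. -/
theorem exists_middle_of_head {c : V} {t : ℤ} {w : Word V} (ht : t ≠ 0)
    (h : (pile Γ c w).head? = some t) :
    ∃ p x q, w = p ++ x :: q ∧ x.1 = c ∧ sgn x = t ∧ ∀ y ∈ p, Γ.Adj y.1 x.1 := by
  obtain ⟨s, hs⟩ := List.head?_eq_some_iff.1 h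
  obtain ⟨p, x, q, rfl, hp, hx, -⟩ := List.filterMap_eq_cons_iff.1 hs
  have hxc : x.1 = c := by
    by_contra hne
    unfold bead at hx
    split_ifs at hx
    simp at hx
    exact ht hx.symm
  refine ⟨p, x, q, rfl, hxc, ?_, fun y hy => ?_⟩
  · subst hxc
    simpa [bead_self] using hx
  · subst hxc
    exact bead_eq_none.1 (hp y hy)

theorem exists_cons_of_head {x : V × Bool} {w : Word V}
    (h : (pile Γ x.1 w).head? = some (sgn x)) : ∃ p q, w = p ++ x :: q ∧
      ∀ y ∈ p, Γ.Adj y.1 x.1 := by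
  obtain ⟨p, y, q, rfl, h1, h2, hp⟩ := exists_middle_of_head (sgn_ne_zero x) h
  obtain rfl := letter_ext h1 h2
  exact ⟨p, q, rfl, hp⟩

/-- This peels off one letter. It is the induction step by which equal pilings yield equal group
elements, equal lengths and permuted letters. -/
theorem TraceEq.exists_middle {x : V × Bool} {v w : Word V} (h : TraceEq Γ (x :: v) w) :
    ∃ p q, w = p ++ x :: q ∧ (∀ y ∈ p, Γ.Adj y.1 x.1) ∧ TraceEq Γ v (p ++ q) := by
  have h1 := h x.1
  rw [pile_cons_self] at h1
  obtain ⟨p, q, rfl, hp⟩ := exists_cons_of_head (x := x) (w := w) (by rw [← h1]; rfl)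
  exact ⟨p, q, rfl, hp, (h.trans (traceEq_middle hp q)).of_cons⟩

theorem TraceEq.eq_nil {w : Word V} (h : TraceEq Γ [] w) : w = [] := by
  cases w with
  | nil => rfl
  | cons x w => simpa [pile_cons_self] using h x.1

theorem TraceEq.eval_eq {v w : Word V} (h : TraceEq Γ v w) : eval Γ v = eval Γ w := by
  induction v generalizing w with
  | nil => rw [h.eq_nil]
  | cons x v ih =>
    obtain ⟨p, q, rfl, hp, h'⟩ := h.exists_middle
    rw [eval_middle hp, eval_cons, ih h', ← eval_cons]

theorem TraceEq.length_eq {v w : Word V} (h : TraceEq Γ v w) : v.length = w.length := by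
  induction v generalizing w with
  | nil => rw [h.eq_nil]
  | cons x v ih =>
    obtain ⟨p, q, rfl, hp, h'⟩ := h.exists_middle
    have := ih h'
    simp at this ⊢
    omega

theorem TraceEq.perm {v w : Word V} (h : TraceEq Γ v w) : v.Perm w := by
  induction v generalizing w with
  | nil => rw [h.eq_nil]
  | cons x v ih =>
    obtain ⟨p, q, rfl, hp, h'⟩ := h.exists_middle
    exact ((ih h').cons x).trans List.perm_middle.symm

/-! ### Invariance of reducedness under commutations. -/

theorem Red.of_append {v w : Word V} (h : Red Γ (v ++ w)) : Red Γ w := by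
  induction v with
  | nil => exact h
  | cons x v ih => exact ih h.1

theorem Red.middle {x : V × Bool} {p q : Word V} (hp : ∀ y ∈ p, Γ.Adj y.1 x.1)
    (h : Red Γ (p ++ x :: q)) : Red Γ (x :: (p ++ q)) := by
  have h2 : (pile Γ x.1 (p ++ q)).head? ≠ some (-sgn x) := by
    rw [pile_append, pile_eq_nil_of_adj hp]
    exact (h.of_append).2
  refine ⟨?_, h2⟩
  clear h2
  induction p with
  | nil => exact h.1
  | cons y p ih =>
    refine ⟨ih (fun z hz => hp z (by simp [hz])) h.1, ?_⟩
    have := h.2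
    simp only [List.append_eq] at this ⊢
    rwa [pile_append, pile_cons_of_adj (hp y (by simp)).symm, ← pile_append] at this

theorem TraceEq.red {v w : Word V} (h : TraceEq Γ v w) (hw : Red Γ w) : Red Γ v := by
  induction v generalizing w with
  | nil => trivial
  | cons x v ih =>
    obtain ⟨p, q, rfl, hp, h'⟩ := h.exists_middle
    have := hw.middle hp
    exact ⟨ih h' this.1, by rw [h' x.1]; exact this.2⟩

theorem TraceEq.red_iff {v w : Word V} (h : TraceEq Γ v w) : Red Γ v ↔ Red Γ w :=
  ⟨h.symm.red, h.red⟩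

/-! ### The action on pilings, and uniqueness of reduced words -/

/-- The action of a letter on pilings. -/
def pushPile (Γ : SimpleGraph V) [DecidableRel Γ.Adj] (x : V × Bool) (P : V → List ℤ) :
    V → List ℤ := fun c =>
  if (P x.1).head? = some (-sgn x) then (if Γ.Adj x.1 c then P c else (P c).tail)
  else pile Γ c [x] ++ P c

theorem pushPile_inv (x : V × Bool) (w : Word V) :
    pushPile Γ x (fun c => pile Γ c (invLetter x :: w)) = fun c => pile Γ c w := by
  funext c
  have h1 := pile_cons_self (Γ := Γ) (invLetter x) w
  simp only [invLetter_fst] at h1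
  simp only [pushPile, h1]
  rw [if_pos (by simp)]
  split_ifs with h
  · exact pile_cons_of_adj (x := invLetter x) h w
  · by_cases hc : x.1 = c
    · subst hc; rw [h1]; rfl
    · rw [pile_cons_of_ne (x := invLetter x) hc h]; rfl

theorem pushPile_of_ne {x : V × Bool} {w : Word V}
    (h : (pile Γ x.1 w).head? ≠ some (-sgn x)) :
    pushPile Γ x (fun c => pile Γ c w) = fun c => pile Γ c (x :: w) := by
  funext c
  rw [pushPile, if_neg h, ← pile_cons]

theorem exists_traceEq_inv_cons {x : V × Bool} {w : Word V}
    (h : (pile Γ x.1 w).head? = some (-sgn x)) :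
    ∃ w', TraceEq Γ w (invLetter x :: w') := by
  obtain ⟨p, q, rfl, hp⟩ := exists_cons_of_head (x := invLetter x) (w := w) (by simpa using h)
  exact ⟨p ++ q, traceEq_middle hp q⟩

variable (Γ) in
/-- Pilings of reduced words. -/
def RedPile : Type _ := {P : V → List ℤ // ∃ w, Red Γ w ∧ P = fun c => pile Γ c w}

/-- The letter either cancels against an inverse that can be brought to the front, or is put in
front without cancellation. In both cases the action stays within pilings of reduced words. -/
theorem pushPile_word {x : V × Bool} {w : Word V} (hw : Red Γ w) :
    ∃ w', Red Γ w' ∧ pushPile Γ x (fun c => pile Γ c w) = (fun c => pile Γ c w') ∧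
      eval Γ w' = eval Γ [x] * eval Γ w ∧ w'.length ≤ w.length + 1 := by
  by_cases h : (pile Γ x.1 w).head? = some (-sgn x)
  · obtain ⟨w', h'⟩ := exists_traceEq_inv_cons h
    refine ⟨w', (h'.symm.red hw).1, ?_, ?_, ?_⟩
    · rw [← pushPile_inv x w', show (fun c => pile Γ c w) = _ from funext h']
    · rw [h'.eval_eq, eval_cons Γ (invLetter x), eval_invLetter, mul_inv_cancel_left]
    · have := h'.length_eq; simp at this; omega
  · exact ⟨x :: w, ⟨hw, h⟩, pushPile_of_ne h, eval_cons Γ x w, by simp⟩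

/-- Reducedness is essential here: if `x` has cancelled against `x⁻¹ w'`, then `w'` cannot cancel
the returning `x⁻¹`. -/
theorem pushPile_invLetter_pushPile {x : V × Bool} {w : Word V} (hw : Red Γ w) :
    pushPile Γ (invLetter x) (pushPile Γ x (fun c => pile Γ c w)) = fun c => pile Γ c w := by
  by_cases h : (pile Γ x.1 w).head? = some (-sgn x)
  · obtain ⟨w', h'⟩ := exists_traceEq_inv_cons h
    rw [show (fun c => pile Γ c w) = _ from funext h', pushPile_inv, pushPile_of_ne]
    exact (h'.symm.red hw).2
  · rw [pushPile_of_ne h]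
    simpa using pushPile_inv (Γ := Γ) (invLetter x) w

theorem pushPile_comm {x y : V × Bool} (hxy : Γ.Adj x.1 y.1) (w : Word V) :
    pushPile Γ x (pushPile Γ y (fun c => pile Γ c w)) =
      pushPile Γ y (pushPile Γ x (fun c => pile Γ c w)) := by
  -- The case in which `x` cancels. If `y` cancels, the roles are exchanged; if neither does, both
  -- letters are put on top and can be swapped.
  have key : ∀ {x y : V × Bool}, Γ.Adj x.1 y.1 → ∀ w : Word V,
      (pile Γ x.1 w).head? = some (-sgn x) →
      pushPile Γ x (pushPile Γ y (fun c => pile Γ c w)) =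
      pushPile Γ y (pushPile Γ x (fun c => pile Γ c w)) := by
    intro x y hxy w h
    obtain ⟨w', h'⟩ := exists_traceEq_inv_cons h
    rw [show (fun c => pile Γ c w) = _ from funext h', pushPile_inv]
    by_cases hy : (pile Γ y.1 w').head? = some (-sgn y)
    · obtain ⟨w'', h''⟩ := exists_traceEq_inv_cons hy
      have e : TraceEq Γ (invLetter x :: w') (invLetter y :: invLetter x :: w'') :=
        (h''.cons _).trans (traceEq_swap (x := invLetter x) (y := invLetter y) hxy _)
      rw [show (fun c => pile Γ c (invLetter x :: w')) = _ from funext e, pushPile_inv,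
        pushPile_inv, show (fun c => pile Γ c w') = _ from funext h'', pushPile_inv]
    · rw [pushPile_of_ne hy, pushPile_of_ne (by rwa [pile_cons_of_adj (x := invLetter x) hxy]),
        show (fun c => pile Γ c (y :: invLetter x :: w')) = _ from
          funext (traceEq_swap (x := y) (y := invLetter x) hxy.symm w'), pushPile_inv]
  by_cases h : (pile Γ x.1 w).head? = some (-sgn x)
  · exact key hxy w h
  by_cases h' : (pile Γ y.1 w).head? = some (-sgn y)
  · exact (key hxy.symm w h').symm
  rw [pushPile_of_ne h, pushPile_of_ne h',
    pushPile_of_ne (by rwa [pile_cons_of_adj hxy.symm]), pushPile_of_ne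
      (by rwa [pile_cons_of_adj hxy])]
  exact funext (traceEq_swap hxy w)

/-- The action of a letter on pilings of reduced words. -/
def RedPile.push (x : V × Bool) (P : RedPile Γ) : RedPile Γ :=
  ⟨pushPile Γ x P.1, by
    obtain ⟨P, w, hw, rfl⟩ := P
    obtain ⟨w', h1, h2, -⟩ := pushPile_word (x := x) hw
    exact ⟨w', h1, h2⟩⟩

theorem RedPile.push_inv (x : V × Bool) (P : RedPile Γ) :
    RedPile.push (invLetter x) (RedPile.push x P) = P := by
  obtain ⟨P, w, hw, rfl⟩ := P
  exact Subtype.ext (pushPile_invLetter_pushPile hw)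

/-- The action of a letter on pilings of reduced words, as a permutation. -/
def RedPile.perm (x : V × Bool) : Equiv.Perm (RedPile Γ) where
  toFun := RedPile.push x
  invFun := RedPile.push (invLetter x)
  left_inv := RedPile.push_inv x
  right_inv P := by simpa using RedPile.push_inv (invLetter x) P

variable (Γ) in
/-- The action of the group on pilings of reduced words. -/
def RedPile.action : RAAG Γ →* Equiv.Perm (RedPile Γ) :=
  PresentedGroup.toGroup (f := fun a => RedPile.perm (a, true)) (by
    rintro _ ⟨a, b, hab, rfl⟩
    have h : RedPile.perm (Γ := Γ) (a, true) * RedPile.perm (b, true) =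
        RedPile.perm (b, true) * RedPile.perm (a, true) := by
      ext P
      obtain ⟨P, w, hw, rfl⟩ := P
      exact Subtype.ext (pushPile_comm (x := (a, true)) (y := (b, true)) hab w)
    simp [h])

theorem RedPile.action_letter (x : V × Bool) :
    RedPile.action Γ (eval Γ [x]) = RedPile.perm x := by
  have h : ∀ a, RedPile.action Γ (gen Γ a) = RedPile.perm (a, true) :=
    fun a => PresentedGroup.toGroup.of _
  rcases x with ⟨a, _ | _⟩
  · simp only [eval, List.map_cons, List.map_nil, List.prod_singleton, Bool.false_eq_true,
      if_false, map_inv, h]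
    ext P
    rfl
  · simp [eval, h]

/-- The letters of a reduced word never cancel while they act, from right to left, on the empty
piling, so they simply build the piling of the word. -/
theorem RedPile.action_word {w : Word V} (hw : Red Γ w) :
    (RedPile.action Γ (eval Γ w) ⟨fun _ => [], [], trivial, rfl⟩).1 = fun c => pile Γ c w := by
  induction w with
  | nil => simp; rfl
  | cons x w ih =>
    rw [eval_cons, map_mul, action_letter]
    change pushPile Γ x (Subtype.val _) = _
    rw [ih hw.1, pushPile_of_ne hw.2]

/-- The piling of a reduced word is recovered from the group element alone, by letting it act on the
empty piling. -/
theorem Red.traceEq {v w : Word V} (hv : Red Γ v) (hw : Red Γ w)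
    (h : eval Γ v = eval Γ w) : TraceEq Γ v w := by
  have h1 := RedPile.action_word hv
  rw [h, RedPile.action_word hw] at h1
  exact fun c => (congrFun h1 c).symm

/-! ### Existence of reduced words, and geodesics. -/

variable (Γ) in
theorem exists_red_of_word (w : Word V) :
    ∃ w', Red Γ w' ∧ eval Γ w' = eval Γ w ∧ w'.length ≤ w.length := by
  induction w with
  | nil => exact ⟨[], trivial, rfl, le_rfl⟩
  | cons x w ih =>
    obtain ⟨w', h1, h2, h3⟩ := ih
    obtain ⟨w'', h4, -, h5, h6⟩ := pushPile_word (x := x) h1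
    exact ⟨w'', h4, by rw [h5, h2, ← eval_cons], by simp; omega⟩

theorem exists_red (g : RAAG Γ) : ∃ w, Red Γ w ∧ eval Γ w = g := by
  obtain ⟨w, rfl⟩ := exists_eval_eq Γ g
  obtain ⟨w', h1, h2, -⟩ := exists_red_of_word Γ w
  exact ⟨w', h1, h2⟩

theorem Red.length_eq {w : Word V} (hw : Red Γ w) : length Γ (eval Γ w) = w.length := by
  refine le_antisymm (length_le w) ?_
  obtain ⟨v, h1, h2⟩ := exists_length_eq (eval Γ w)
  obtain ⟨v', h3, h4, h5⟩ := exists_red_of_word Γ v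
  rw [(hw.traceEq h3 (by rw [h4, h1])).length_eq]
  omega

/-- Through this criterion reducedness passes to subwords and to images under length-preserving
letter maps. -/
theorem red_iff_length {w : Word V} : Red Γ w ↔ length Γ (eval Γ w) = w.length := by
  refine ⟨Red.length_eq, fun h => ?_⟩
  induction w with
  | nil => trivial
  | cons x w ih =>
    have h1 : length Γ (eval Γ w) = w.length := by
      refine le_antisymm (length_le w) ?_
      by_contra hlt
      obtain ⟨v, h1, h2⟩ := exists_length_eq (eval Γ w)
      have := length_le (Γ := Γ) (x :: v)
      rw [eval_cons, h1, ← eval_cons, h] at this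
      simp at this; omega
    refine ⟨ih h1, fun hx => ?_⟩
    obtain ⟨w', h'⟩ := exists_traceEq_inv_cons hx
    have h2 := length_le (Γ := Γ) w'
    rw [eval_cons, h'.eval_eq, eval_cons Γ (invLetter x)] at h
    simp at h
    have := h'.length_eq
    simp at this; omega

theorem red_singleton (x : V × Bool) : Red Γ [x] := ⟨trivial, by simp⟩

theorem length_letter (x : V × Bool) : length Γ (eval Γ [x]) = 1 := (red_singleton x).length_eq

theorem eval_letter_injective : Function.Injective fun x : V × Bool => eval Γ [x] := by
  intro x y h
  have := ((red_singleton x).traceEq (red_singleton y) h).perm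
  simpa using this

end Piles

end RAAG

/-! ### Twisted conjugacy and rotations -/

namespace RAAG

section Rotations

variable {V : Type*} {Γ : SimpleGraph V}

/-- One end of a geodesic for `g` is moved to the other end, where `φ` or its inverse is applied. -/
def RotStep (φ : MulAut (RAAG Γ)) (g g' : RAAG Γ) : Prop :=
  ∃ (x : V × Bool) (h : RAAG Γ),
    (length Γ (eval Γ [x] * h) = length Γ h + 1 ∧ g = eval Γ [x] * h ∧
      g' = h * φ⁻¹ (eval Γ [x])) ∨
    (length Γ (h * eval Γ [x]) = length Γ h + 1 ∧ g = h * eval Γ [x] ∧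
      g' = φ (eval Γ [x]) * h)

theorem eval_map {φ : MulAut (RAAG Γ)} {f : V × Bool → V × Bool}
    (hf : ∀ x, φ (eval Γ [x]) = eval Γ [f x]) (w : Word V) :
    eval Γ (w.map f) = φ (eval Γ w) := by
  induction w with
  | nil => simp
  | cons x w ih => rw [List.map_cons, eval_cons, ih, eval_cons Γ x, map_mul, hf]

/-- This serves to show that `φ` fixes the product of a set of commuting letters that it permutes.
-/
theorem eval_eq_of_perm {l l' : Word V} (h : l.Perm l')
    (hc : l.Pairwise fun x y => Γ.Adj x.1 y.1) : eval Γ l = eval Γ l' := by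
  have key : ∀ w : Word V, eval Γ w = (w.map fun x => eval Γ [x]).prod := fun w => by
    simp [eval]
  rw [key, key]
  refine (h.map _).prod_eq' (List.pairwise_map.2 (hc.imp fun h => eval_commute Γ h))

theorem commute_eval_of_forall_adj {x : V × Bool} {u : Word V} (h : ∀ z ∈ u, Γ.Adj z.1 x.1) :
    Commute (eval Γ [x]) (eval Γ u) := by
  induction u with
  | nil => simp
  | cons z u ih =>
    rw [eval_cons Γ z]
    exact (eval_commute Γ (h z (by simp)).symm).mul_right (ih fun y hy => h y (by simp [hy]))

theorem commute_eval_eval {l u : Word V} (h : ∀ x ∈ l, ∀ z ∈ u, Γ.Adj z.1 x.1) :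
    Commute (eval Γ l) (eval Γ u) := by
  induction l with
  | nil => simp
  | cons z l ih =>
    rw [eval_cons Γ z]
    exact (commute_eval_of_forall_adj (h z (by simp))).mul_left (ih fun y hy => h y (by simp [hy]))

/-! ### Cancellation between reduced words, and sets of first letters. -/

variable [DecidableEq V] [DecidableRel Γ.Adj]

/-- Consider the last letter of `u` at which reducedness of the product fails. As `u` is reduced,
its partner lies in `w`, and the letter commutes with all that follows in `u`; so it can be brought
to the end of `u`. -/
theorem exists_cancel {u w : Word V} (hu : Red Γ u) (hw : Red Γ w) (h : ¬ Red Γ (u ++ w)) :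
    ∃ x u' w', TraceEq Γ u (u' ++ [invLetter x]) ∧ TraceEq Γ w (x :: w') := by
  induction u with
  | nil => exact absurd hw h
  | cons y u ih =>
    by_cases h1 : Red Γ (u ++ w)
    · have h2 : (pile Γ y.1 (u ++ w)).head? = some (-sgn y) := by
        by_contra h3
        exact h ⟨h1, h3⟩
      rw [pile_append] at h2
      by_cases h3 : pile Γ y.1 u = []
      · rw [h3, List.nil_append] at h2
        obtain ⟨w', hw'⟩ := exists_traceEq_inv_cons h2
        refine ⟨invLetter y, u, w', ?_, hw'⟩
        have := traceEq_middle (Γ := Γ) (x := y) (pile_eq_nil_iff.1 h3) []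
        simpa using this.symm
      · rw [List.head?_append_of_ne_nil _ h3] at h2
        exact absurd h2 hu.2
    · obtain ⟨x, u', w', h2, h3⟩ := ih hu.1 h1
      exact ⟨x, y :: u', w', h2.cons y, h3⟩

theorem head_pile_append {y : V × Bool} {u w : Word V} {t : ℤ}
    (h : (pile Γ y.1 (u ++ w)).head? = some t) :
    (pile Γ y.1 u).head? = some t ∨
      ((∀ z ∈ u, Γ.Adj z.1 y.1) ∧ (pile Γ y.1 w).head? = some t) := by
  rw [pile_append] at h
  by_cases h3 : pile Γ y.1 u = []
  · rw [h3, List.nil_append] at h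
    exact Or.inr ⟨pile_eq_nil_iff.1 h3, h⟩
  · rw [List.head?_append_of_ne_nil _ h3] at h
    exact Or.inl h

theorem head_of_traceEq_cons {x : V × Bool} {w w' : Word V} (h : TraceEq Γ w (x :: w')) :
    (pile Γ x.1 w).head? = some (sgn x) := by
  rw [h, pile_cons_self]; rfl

theorem exists_traceEq_cons {x : V × Bool} {w : Word V}
    (h : (pile Γ x.1 w).head? = some (sgn x)) : ∃ w', TraceEq Γ w (x :: w') := by
  obtain ⟨p, q, rfl, hp⟩ := exists_cons_of_head h
  exact ⟨p ++ q, traceEq_middle hp q⟩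

/-- Two different letters that can be brought to the front commute. -/
theorem adj_of_heads {x y : V × Bool} {w : Word V} (hne : x ≠ y)
    (hy : (pile Γ y.1 (x :: w)).head? = some (sgn y)) :
    Γ.Adj x.1 y.1 ∧ (pile Γ y.1 w).head? = some (sgn y) := by
  by_cases h1 : x.1 = y.1
  · rw [← h1, pile_cons_self] at hy
    simp at hy
    exact absurd (letter_ext h1 hy) hne
  by_cases h2 : Γ.Adj x.1 y.1
  · exact ⟨h2, by rwa [pile_cons_of_adj h2] at hy⟩
  · rw [pile_cons_of_ne h1 h2] at hy
    simp at hy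
    exact absurd hy.symm (sgn_ne_zero y)

/-- Letters that can each be brought to the front commute pairwise, so removing one leaves the
others available. -/
theorem exists_traceEq_append {l w : Word V} (hl : l.Nodup)
    (h : ∀ x ∈ l, (pile Γ x.1 w).head? = some (sgn x)) :
    l.Pairwise (fun x y => Γ.Adj x.1 y.1) ∧ ∃ w', TraceEq Γ w (l ++ w') := by
  induction l generalizing w with
  | nil => exact ⟨List.Pairwise.nil, w, TraceEq.refl _⟩
  | cons y l ih =>
    obtain ⟨w', h'⟩ := exists_traceEq_cons (h y (by simp))
    obtain ⟨hyl, hl⟩ := List.nodup_cons.1 hl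
    have key : ∀ x ∈ l, Γ.Adj y.1 x.1 ∧ (pile Γ x.1 w').head? = some (sgn x) := fun x hx => by
      refine adj_of_heads (fun e => hyl (e ▸ hx)) ?_
      rw [← h']
      exact h x (by simp [hx])
    obtain ⟨h1, w'', h2⟩ := ih hl fun x hx => (key x hx).2
    exact ⟨List.pairwise_cons.2 ⟨fun x hx => (key x hx).1, h1⟩, w'', h'.trans (h2.cons y)⟩

theorem length_of_red_cons {x : V × Bool} {w : Word V} (h : Red Γ (x :: w)) :
    length Γ (eval Γ [x] * eval Γ w) = length Γ (eval Γ w) + 1 := by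
  rw [← eval_cons, h.length_eq, h.1.length_eq, List.length_cons]

theorem length_of_red_concat {x : V × Bool} {w : Word V} (h : Red Γ (w ++ [x])) :
    length Γ (eval Γ w * eval Γ [x]) = length Γ (eval Γ w) + 1 := by
  have h1 := h.length_eq
  rw [eval_append] at h1
  have h2 := length_le (Γ := Γ) w
  have h3 := length_mul_le (eval Γ w) (eval Γ [x])
  rw [length_letter] at h3
  simp at h1
  omega

/-- Twisted conjugate elements become equal after finitely many rotations of each. -/
theorem exists_rotSteps [Finite V] {φ : MulAut (RAAG Γ)} {f : V × Bool → V × Bool}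
    (hf : ∀ x, φ (eval Γ [x]) = eval Γ [f x]) (hφ : ∀ g, length Γ (φ g) = length Γ g)
    {u v w : RAAG Γ} (h : u * w = φ w * v) :
    ∃ t, Relation.ReflTransGen (RotStep φ) u t ∧ Relation.ReflTransGen (RotStep φ) v t := by
  have finj : Function.Injective f := fun x y hxy => by
    apply eval_letter_injective (Γ := Γ)
    apply φ.injective
    simp only [hf, hxy]
  have fsurj : Function.Surjective f := Finite.surjective_of_injective finj
  -- Induction on the length of the twisting element: every case passes to a strictly shorter one.
  induction hn : length Γ w using Nat.strong_induction_on generalizing u v w with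
  | _ n ih =>
  subst hn
  obtain ⟨u, hu, rfl⟩ := exists_red u
  obtain ⟨v, hv, rfl⟩ := exists_red v
  obtain ⟨w, hw, rfl⟩ := exists_red w
  have hmap : ∀ {w : Word V}, Red Γ w → Red Γ (w.map f) := fun {w} hw => by
    rw [red_iff_length, eval_map hf, hφ, hw.length_eq, List.length_map]
  -- If `u w` is not reduced, a last letter of `u` cancels against a first letter `x` of `w`.
  -- Rotating that letter to the front of `u` removes `x` from `w` on both sides of the equation.
  by_cases h1 : Red Γ (u ++ w)
  swap
  · obtain ⟨x, u', w', h2, h3⟩ := exists_cancel hu hw h1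
    have hstep : RotStep φ (eval Γ u) (φ (eval Γ [invLetter x]) * eval Γ u') :=
      ⟨invLetter x, eval Γ u', Or.inr ⟨length_of_red_concat (h2.symm.red hu),
        by rw [h2.eval_eq, eval_append], rfl⟩⟩
    have hw' := (h3.symm.red hw)
    obtain ⟨t, ht1, ht2⟩ := ih (length Γ (eval Γ w'))
      (by rw [hw.length_eq, hw'.1.length_eq, h3.length_eq]; simp)
      (u := φ (eval Γ [invLetter x]) * eval Γ u') (v := eval Γ v) (w := eval Γ w')
      (by
        rw [h2.eval_eq, h3.eval_eq, eval_append, eval_cons Γ x, eval_invLetter, map_mul] at h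
        rw [eval_invLetter, map_inv, mul_assoc, inv_mul_eq_iff_eq_mul, ← mul_assoc, ← h]
        group) rfl
    exact ⟨t, .head hstep ht1, ht2⟩
  -- If `φ(w) v` is not reduced, a last letter of `φ(w)` cancels against a first letter of `v`. Its
  -- preimage `z` is a last letter of `w`, and rotating `v` removes it.
  by_cases h1' : Red Γ (w.map f ++ v)
  swap
  · obtain ⟨x, p, v', h2, h3⟩ := exists_cancel (hmap hw) hv h1'
    obtain ⟨z, hz⟩ := fsurj (invLetter x)
    have hx : eval Γ [x] = φ (eval Γ [z])⁻¹ := by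
      rw [map_inv, hf, hz, eval_invLetter, inv_inv]
    have hp : φ (eval Γ w * (eval Γ [z])⁻¹) = eval Γ p := by
      rw [map_mul, ← hx, ← eval_map hf, h2.eval_eq, eval_append, eval_invLetter,
        inv_mul_cancel_right]
    have hstep : RotStep φ (eval Γ v) (eval Γ v' * (eval Γ [z])⁻¹) := by
      refine ⟨x, eval Γ v', Or.inl ⟨length_of_red_cons (h3.symm.red hv), ?_, ?_⟩⟩
      · rw [h3.eval_eq, eval_cons]
      · rw [hx]; simp
    have hlt : length Γ (eval Γ w * (eval Γ [z])⁻¹) < length Γ (eval Γ w) := by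
      rw [← hφ, hp, hw.length_eq]
      have := length_le (Γ := Γ) p
      have := h2.length_eq
      simp at this; omega
    obtain ⟨t, ht1, ht2⟩ := ih _ hlt
      (u := eval Γ u) (v := eval Γ v' * (eval Γ [z])⁻¹) (w := eval Γ w * (eval Γ [z])⁻¹)
      (by
        rw [h3.eval_eq, eval_cons, hx] at h
        rw [← mul_assoc, h, map_mul]
        group) rfl
    exact ⟨t, ht1, .head hstep ht2⟩
  -- Both sides are now reduced, hence have the same piling, so the images of first letters of `w`
  -- are first letters of `u w`.
  have htr : TraceEq Γ (u ++ w) (w.map f ++ v) := h1.traceEq h1' (by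
    rw [eval_append, eval_append, eval_map hf, h])
  by_cases hw0 : w = []
  · subst hw0
    exact ⟨eval Γ u, .refl, by simp at h; rw [h]⟩
  have hfy : ∀ y, (pile Γ y.1 w).head? = some (sgn y) →
      (pile Γ (f y).1 (u ++ w)).head? = some (sgn (f y)) := fun y hy => by
    obtain ⟨w', h'⟩ := exists_traceEq_cons hy
    have hr := h'.symm.red hw
    have : TraceEq Γ (w.map f) (f y :: w'.map f) :=
      (hmap hw).traceEq (hmap hr) (by
        rw [eval_map hf, h'.eval_eq, ← eval_map hf]; rfl)
    rw [htr]
    exact head_of_traceEq_cons (this.append (TraceEq.refl v))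
  -- If `φ(y)` is a first letter of `u`, for a first letter `y` of `w`, it cancels on the left of
  -- the equation, and the effect on `u` is the rotation that turns it into `y` at the end.
  by_cases hex : ∃ y, (pile Γ y.1 w).head? = some (sgn y) ∧
      (pile Γ (f y).1 u).head? = some (sgn (f y))
  · obtain ⟨y, hy1, hy2⟩ := hex
    obtain ⟨w', hw'⟩ := exists_traceEq_cons hy1
    obtain ⟨u', hu'⟩ := exists_traceEq_cons hy2
    have hr := hw'.symm.red hw
    have hstep : RotStep φ (eval Γ u) (eval Γ u' * eval Γ [y]) := by
      refine ⟨f y, eval Γ u', Or.inl ⟨length_of_red_cons (hu'.symm.red hu), ?_, ?_⟩⟩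
      · rw [hu'.eval_eq, eval_cons]
      · rw [← hf]; simp
    obtain ⟨t, ht1, ht2⟩ := ih (length Γ (eval Γ w'))
      (by rw [hw.length_eq, hr.1.length_eq, hw'.length_eq]; simp)
      (u := eval Γ u' * eval Γ [y]) (v := eval Γ v) (w := eval Γ w')
      (by
        rw [hu'.eval_eq, hw'.eval_eq, eval_cons, eval_cons Γ y, map_mul, hf, mul_assoc, mul_assoc,
          mul_right_inj] at h
        rw [← h, mul_assoc]) rfl
    exact ⟨t, .head hstep ht1, ht2⟩
  -- Otherwise the image of every first letter of `w` commutes with `u` and is again a first letter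
  -- of `w`. So `f` permutes the finite set `I` of first letters; their product is fixed by `φ`,
  -- commutes with `u`, and can be dropped from `w` while `u` and `v` stay as they are.
  · push Not at hex
    set I : Finset (V × Bool) := w.toFinset.filter
      fun y => (pile Γ y.1 w).head? = some (sgn y) with hI
    have hmem : ∀ y, y ∈ I ↔ (pile Γ y.1 w).head? = some (sgn y) := fun y => by
      simp only [hI, Finset.mem_filter, List.mem_toFinset, and_iff_right_iff_imp]
      intro hy
      obtain ⟨p, q, rfl, -⟩ := exists_cons_of_head hy
      simp
    have hfI : ∀ y ∈ I, f y ∈ I ∧ ∀ z ∈ u, Γ.Adj z.1 (f y).1 := fun y hy => by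
      rw [hmem] at hy ⊢
      rcases head_pile_append (hfy y hy) with h2 | h2
      · exact absurd h2 (hex y hy)
      · exact ⟨h2.2, h2.1⟩
    have himg : I.image f = I :=
      Finset.eq_of_subset_of_card_le (Finset.image_subset_iff.2 fun y hy => (hfI y hy).1)
        (Finset.card_image_of_injective I finj).ge
    have hcomm : ∀ x ∈ I, ∀ z ∈ u, Γ.Adj z.1 x.1 := fun x hx => by
      rw [← himg, Finset.mem_image] at hx
      obtain ⟨y, hy, rfl⟩ := hx
      exact (hfI y hy).2
    obtain ⟨hpw, w', hw'⟩ := exists_traceEq_append (Γ := Γ) (w := w) I.nodup_toList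
      fun x hx => (hmem x).1 (Finset.mem_toList.1 hx)
    have hperm : I.toList.Perm (I.toList.map f) := by
      refine (List.perm_ext_iff_of_nodup I.nodup_toList (I.nodup_toList.map finj)).2 fun x => ?_
      rw [Finset.mem_toList, List.mem_map]
      conv_lhs => rw [← himg, Finset.mem_image]
      simp only [Finset.mem_toList]
    have hfix : φ (eval Γ I.toList) = eval Γ I.toList := by
      rw [← eval_map hf, ← eval_eq_of_perm hperm hpw]
    have hcu : Commute (eval Γ I.toList) (eval Γ u) :=
      commute_eval_eval fun x hx => hcomm x (Finset.mem_toList.1 hx)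
    have hne : I.toList ≠ [] := by
      obtain ⟨y, w1, rfl⟩ := List.exists_cons_of_ne_nil hw0
      have : y ∈ I := (hmem y).2 (by rw [pile_cons_self]; rfl)
      intro h0
      rw [← Finset.mem_toList, h0] at this
      simp at this
    have hlt : length Γ (eval Γ w') < length Γ (eval Γ w) := by
      have := length_le (Γ := Γ) w'
      have := List.length_pos_iff.2 hne
      have h3 := hw'.length_eq
      rw [List.length_append] at h3
      rw [hw.length_eq]
      omega
    refine ih _ hlt (w := eval Γ w') ?_ rfl
    rw [hw'.eval_eq, eval_append, map_mul, hfix, ← mul_assoc, ← hcu.eq, mul_assoc, mul_assoc,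
      mul_right_inj] at h
    exact h

end Rotations

end RAAG

/-! ### Decidability for length-preserving automorphisms -/

namespace RAAG

section Search

variable {V : Type*} {Γ : SimpleGraph V}

theorem exists_letterMap {φ : MulAut (RAAG Γ)} (hφ : ∀ g, length Γ (φ g) = length Γ g) :
    ∃ f : V × Bool → V × Bool, ∀ x, φ (eval Γ [x]) = eval Γ [f x] := by
  classical
  have : ∀ x : V × Bool, ∃ y, φ (eval Γ [x]) = eval Γ [y] := fun x => by
    obtain ⟨w, h1, h2⟩ := exists_length_eq (φ (eval Γ [x]))
    rw [hφ, length_letter, List.length_eq_one_iff] at h2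
    obtain ⟨y, rfl⟩ := h2
    exact ⟨y, h1.symm⟩
  choose f hf using this
  exact ⟨f, hf⟩

/-- Rotations are twisted conjugations by single letters, and they never leave a ball around the
identity. This is what bounds the search for a conjugator. -/
theorem RotStep.exists_letter {φ : MulAut (RAAG Γ)} (hφ : ∀ g, length Γ (φ g) = length Γ g)
    {g g' : RAAG Γ} (h : RotStep φ g g') :
    length Γ g' ≤ length Γ g ∧
      ∃ x, g' = (φ (eval Γ [x]))⁻¹ * g * eval Γ [x] := by
  classical
  obtain ⟨x, k, ⟨h1, rfl, rfl⟩ | ⟨h1, rfl, rfl⟩⟩ := h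
  · have hinv : ∀ g, length Γ (φ⁻¹ g) = length Γ g := fun g => by
      rw [← hφ]; simp
    obtain ⟨f, hf⟩ := exists_letterMap hinv
    constructor
    · rw [h1]
      refine (length_mul_le _ _).trans ?_
      rw [hinv, length_letter]
    · exact ⟨f x, by rw [← hf]; simp⟩
  · constructor
    · rw [h1, add_comm]
      refine (length_mul_le _ _).trans ?_
      rw [hφ, length_letter]
    · exact ⟨invLetter x, by rw [eval_invLetter]; simp [mul_assoc]⟩

/-! ### Bounded search for a conjugator. -/

/-- All words of length at most `n` over the given letters. -/
def allWords {X : Type*} (L : List X) (n : ℕ) : List (List X) :=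
  Nat.rec [[]] (fun _ A => [] :: A.flatMap fun w => L.map fun x => x :: w) n

theorem mem_allWords {X : Type*} {L : List X} (hL : ∀ x, x ∈ L) (w : List X) {n : ℕ}
    (h : w.length ≤ n) : w ∈ allWords L n := by
  induction n generalizing w with
  | zero =>
    rw [Nat.le_zero, List.length_eq_zero_iff] at h
    simp [allWords, h]
  | succ n ih =>
    cases w with
    | nil => simp [allWords]
    | cons x w =>
      simp only [allWords, List.mem_cons, List.mem_flatMap, List.mem_map]
      exact Or.inr ⟨w, ih w (by simpa using h), x, hL x, rfl⟩

theorem primrec_allWords {X : Type*} [Primcodable X] (L : List X) :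
    Primrec (allWords L) := by
  refine Primrec.nat_rec₁ _ ?_
  refine Primrec.list_cons.comp (Primrec.const []) ?_
  refine Primrec.list_flatMap Primrec.snd ?_
  refine Primrec.list_map (Primrec.const L) ?_
  exact Primrec.list_cons.comp Primrec.snd (Primrec.snd.comp Primrec.fst)

/-- Twisted conjugate elements are conjugate by a word of bounded length. -/
theorem exists_short_conjugator [Finite V] {φ : MulAut (RAAG Γ)}
    (hφ : ∀ g, length Γ (φ g) = length Γ g) {L : List (V × Bool)} (hL : ∀ x, x ∈ L)
    {u v : RAAG Γ} (h : TwistedConj φ u v) {N : ℕ} (hu : length Γ u ≤ N) (hv : length Γ v ≤ N) :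
    ∃ w : Word V, w.length ≤ (allWords L N).length ∧ v = (φ (eval Γ w))⁻¹ * u * eval Γ w := by
  classical
  -- The ball has at most as many elements as there are words of length at most `N`; a path in it
  -- without repetitions is shorter than that.
  let T := {g : RAAG Γ // length Γ g ≤ N}
  have hsurj : Function.Surjective (fun i : {i : Fin (allWords L N).length //
      length Γ (eval Γ ((allWords L N).get i)) ≤ N} =>
        (⟨eval Γ ((allWords L N).get i.1), i.2⟩ : T)) := by
    rintro ⟨g, hg⟩
    obtain ⟨w, rfl, hw⟩ := exists_length_eq g
    obtain ⟨i, hi⟩ := List.get_of_mem (mem_allWords hL w (hw.le.trans hg))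
    exact ⟨⟨i, by rwa [hi]⟩, Subtype.ext (by simp only [hi])⟩
  have : Finite T := Finite.of_surjective _ hsurj
  have : Fintype T := Fintype.ofFinite T
  have hcard : Fintype.card T ≤ (allWords L N).length := by
    refine (Fintype.card_le_of_surjective _ hsurj).trans ?_
    refine (Fintype.card_subtype_le _).trans ?_
    simp
  -- Edges are twisted conjugations by one letter. Reversing an edge replaces the letter by its
  -- inverse, so the letters along a walk spell a conjugator.
  let G : SimpleGraph T := SimpleGraph.fromRel fun g g' =>
    ∃ x, g'.1 = (φ (eval Γ [x]))⁻¹ * g.1 * eval Γ [x]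
  have hadj : ∀ g g' : T, G.Adj g g' → ∃ x, g'.1 = (φ (eval Γ [x]))⁻¹ * g.1 * eval Γ [x] := by
    rintro g g' ⟨-, h | ⟨x, hx⟩⟩
    · exact h
    · refine ⟨invLetter x, ?_⟩
      rw [hx, eval_invLetter, map_inv]
      group
  have hwalk : ∀ {g g' : T} (p : G.Walk g g'), ∃ w : Word V, w.length = p.length ∧
      g'.1 = (φ (eval Γ w))⁻¹ * g.1 * eval Γ w := by
    intro g g' p
    induction p with
    | nil => exact ⟨[], by simp⟩
    | cons hgg p ih =>
      obtain ⟨x, hx⟩ := hadj _ _ hgg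
      obtain ⟨w, h1, h2⟩ := ih
      refine ⟨x :: w, by simp [h1], ?_⟩
      rw [h2, hx, eval_cons Γ x w, map_mul]
      group
  have hreach : ∀ {g t : RAAG Γ} (hg : length Γ g ≤ N),
      Relation.ReflTransGen (RotStep φ) g t →
      ∃ ht : length Γ t ≤ N, G.Reachable ⟨g, hg⟩ ⟨t, ht⟩ := by
    intro g t hg hst
    induction hst with
    | refl => exact ⟨hg, SimpleGraph.Reachable.refl _⟩
    | tail _ hst ih =>
      obtain ⟨ht, hr⟩ := ih
      obtain ⟨h1, x, hx⟩ := hst.exists_letter hφ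
      refine ⟨h1.trans ht, hr.trans ?_⟩
      by_cases heq : (⟨_, ht⟩ : T) = ⟨_, h1.trans ht⟩
      · rw [← heq]
      · exact SimpleGraph.Adj.reachable ⟨heq, Or.inl ⟨x, hx⟩⟩
  obtain ⟨f, hf⟩ := exists_letterMap hφ
  obtain ⟨w, hw⟩ := h
  obtain ⟨t, h1, h2⟩ := exists_rotSteps hf hφ (u := u) (v := v) (w := w) (by rw [hw]; group)
  obtain ⟨ht, h3⟩ := hreach hu h1
  obtain ⟨ht', h4⟩ := hreach hv h2
  obtain ⟨p, hp⟩ := (h3.trans h4.symm).exists_isPath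
  obtain ⟨w', h5, h6⟩ := hwalk p
  exact ⟨w', by have := hp.length_lt; omega, h6⟩

/-! ### The word problem, by primitive recursive reduction. -/

variable [DecidableEq V] [DecidableRel Γ.Adj]

variable (Γ) in
/-- Cancel the inverse of the letter `x` against a word, if possible. -/
def cancelLetter (x : V × Bool) (w : Word V) : Option (Word V) :=
  -- A single structural recursion, which makes the function visibly primitive recursive.
  List.recOn w none fun y w' r =>
    if y = invLetter x then some w'
    else if Γ.Adj y.1 x.1 then r.map fun z => y :: z else none

variable (Γ) in
/-- Reduction of a word. -/
def reduceWord (w : Word V) : Word V :=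
  w.foldr (fun x w => (cancelLetter Γ x w).getD (x :: w)) []

theorem cancelLetter_cons (x y : V × Bool) (w : Word V) :
    cancelLetter Γ x (y :: w) = if y = invLetter x then some w
      else if Γ.Adj y.1 x.1 then (cancelLetter Γ x w).map fun z => y :: z else none := rfl

theorem traceEq_of_cancelLetter {x : V × Bool} {w w' : Word V}
    (h : cancelLetter Γ x w = some w') : TraceEq Γ w (invLetter x :: w') := by
  induction w generalizing w' with
  | nil => simp [cancelLetter] at h
  | cons y w ih =>
    rw [cancelLetter_cons] at h
    split_ifs at h with h1 h2
    · simp at h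
      rw [h1, h]
      exact TraceEq.refl _
    · simp only [Option.map_eq_some_iff] at h
      obtain ⟨z, hz, rfl⟩ := h
      exact ((ih hz).cons y).trans (traceEq_swap (y := invLetter x) h2 z)

theorem head_ne_of_cancelLetter {x : V × Bool} {w : Word V} (h : cancelLetter Γ x w = none) :
    (pile Γ x.1 w).head? ≠ some (-sgn x) := by
  induction w with
  | nil => simp
  | cons y w ih =>
    rw [cancelLetter_cons] at h
    split_ifs at h with h1 h2
    · rw [pile_cons_of_adj h2]
      exact ih (by simpa using h)
    · by_cases h3 : y.1 = x.1
      · rw [← h3, pile_cons_self]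
        intro h4
        exact h1 (letter_ext h3 (by simpa using h4))
      · rw [pile_cons_of_ne h3 h2]
        have := sgn_ne_zero x
        simp
        omega

theorem reduceWord_spec (w : Word V) :
    Red Γ (reduceWord Γ w) ∧ eval Γ (reduceWord Γ w) = eval Γ w := by
  induction w with
  | nil => exact ⟨trivial, rfl⟩
  | cons x w ih =>
    change Red Γ ((cancelLetter Γ x (reduceWord Γ w)).getD (x :: reduceWord Γ w)) ∧
      eval Γ ((cancelLetter Γ x (reduceWord Γ w)).getD (x :: reduceWord Γ w)) = _
    rw [eval_cons, ← ih.2]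
    cases h : cancelLetter Γ x (reduceWord Γ w) with
    | none => exact ⟨⟨ih.1, head_ne_of_cancelLetter h⟩, eval_cons _ _ _⟩
    | some w' =>
      have h1 := traceEq_of_cancelLetter h
      refine ⟨(h1.symm.red ih.1).1, ?_⟩
      rw [h1.eval_eq, eval_cons Γ (invLetter x), eval_invLetter, mul_inv_cancel_left]
      rfl

theorem reduceWord_eq_nil_iff {w : Word V} : reduceWord Γ w = [] ↔ eval Γ w = 1 := by
  obtain ⟨h1, h2⟩ := reduceWord_spec (Γ := Γ) w
  constructor
  · intro h
    rw [← h2, h]; rfl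
  · intro h
    refine TraceEq.eq_nil ((show Red Γ [] from trivial).traceEq h1 ?_)
    rw [h2, h]; rfl

end Search

theorem primrec_reduceWord {r : ℕ} (Γ : SimpleGraph (Fin r)) [DecidableRel Γ.Adj] :
    Primrec (reduceWord Γ) := by
  have hc : Primrec₂ (cancelLetter Γ) := by
    refine Primrec.list_rec Primrec.snd (Primrec.const none) (h := fun a b =>
      if b.1 = invLetter a.1 then some b.2.1
      else if Γ.Adj b.1.1 a.1.1 then b.2.2.map fun z => b.1 :: z else none) ?_
    have h1 : Primrec fun p : (((Fin r × Bool) × Word (Fin r)) ×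
        ((Fin r × Bool) × Word (Fin r) × Option (Word (Fin r)))) => (p.1.1, p.2.1) :=
      Primrec.pair (Primrec.fst.comp Primrec.fst) (Primrec.fst.comp Primrec.snd)
    refine Primrec.ite ?_ ?_ (Primrec.ite ?_ ?_ (Primrec.const none))
    · exact Primrec.primrecPred ((Primrec.dom_finite fun q : (Fin r × Bool) × (Fin r × Bool) =>
        decide (q.2 = invLetter q.1)).comp h1)
    · exact Primrec.option_some.comp (Primrec.fst.comp (Primrec.snd.comp Primrec.snd))
    · exact Primrec.primrecPred ((Primrec.dom_finite fun q : (Fin r × Bool) × (Fin r × Bool) =>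
        decide (Γ.Adj q.2.1 q.1.1)).comp h1)
    · refine Primrec.option_map (Primrec.snd.comp (Primrec.snd.comp Primrec.snd)) ?_
      exact Primrec.list_cons.comp (Primrec.fst.comp (Primrec.snd.comp Primrec.fst)) Primrec.snd
  refine Primrec.list_foldr Primrec.id (Primrec.const []) (h := fun _ b =>
    (cancelLetter Γ b.1 b.2).getD (b.1 :: b.2)) ?_
  refine Primrec.option_getD.comp (hc.comp (Primrec.fst.comp Primrec.snd)
    (Primrec.snd.comp Primrec.snd)) ?_
  exact Primrec.list_cons.comp (Primrec.fst.comp Primrec.snd) (Primrec.snd.comp Primrec.snd)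

/-- The twisted conjugacy problem is solvable for length-preserving automorphisms. -/
theorem computablePred_TCP {r : ℕ} {Γ : SimpleGraph (Fin r)} {φ : MulAut (RAAG Γ)}
    (hφ : ∀ g, length Γ (φ g) = length Γ g) : ComputablePred (TCP φ) := by
  classical
  obtain ⟨f, hf⟩ := exists_letterMap hφ
  let L : List (Fin r × Bool) := Finset.univ.toList
  have hL : ∀ x, x ∈ L := by simp [L]
  have hinv : Primrec (invWord (V := Fin r)) :=
    Primrec.list_reverse.comp (Primrec.list_map Primrec.id
      ((Primrec.dom_finite invLetter).comp Primrec.snd))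
  -- The test whether `φ(w)⁻¹ u w v⁻¹` is trivial.
  have hcheck : PrimrecRel fun (w : Word (Fin r)) (p : Word (Fin r) × Word (Fin r)) =>
      reduceWord Γ (invWord (w.map f) ++ p.1 ++ w ++ invWord p.2) = [] := by
    refine Primrec.eq.comp ?_ (Primrec.const [])
    refine (primrec_reduceWord Γ).comp ?_
    refine Primrec.list_append.comp (Primrec.list_append.comp (Primrec.list_append.comp
      (hinv.comp ?_) ?_) Primrec.fst) (hinv.comp ?_)
    · exact Primrec.list_map Primrec.fst ((Primrec.dom_finite f).comp Primrec.snd)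
    · exact Primrec.fst.comp Primrec.snd
    · exact Primrec.snd.comp Primrec.snd
  -- The inner list has at least as many entries as the ball of radius `l(u) + l(v)` has elements,
  -- so its length bounds that of a shortest conjugator; the outer list contains all candidates.
  have hbound : Primrec fun p : Word (Fin r) × Word (Fin r) =>
      allWords L (allWords L (List.length p.1 + List.length p.2)).length := by
    refine (primrec_allWords L).comp (Primrec.list_length.comp ((primrec_allWords L).comp ?_))
    exact Primrec.nat_add.comp (Primrec.list_length.comp Primrec.fst)
      (Primrec.list_length.comp Primrec.snd)
  have hdec : PrimrecPred fun p : Word (Fin r) × Word (Fin r) =>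
      ∃ w ∈ allWords L (allWords L (List.length p.1 + List.length p.2)).length,
        reduceWord Γ (invWord (w.map f) ++ p.1 ++ w ++ invWord p.2) = [] :=
    (PrimrecRel.exists_mem_list hcheck).comp hbound Primrec.id
  have heq : ∀ p : Word (Fin r) × Word (Fin r), TCP φ p ↔
      ∃ w ∈ allWords L (allWords L (List.length p.1 + List.length p.2)).length,
        reduceWord Γ (invWord (w.map f) ++ p.1 ++ w ++ invWord p.2) = [] := by
    intro p
    simp only [reduceWord_eq_nil_iff, eval_append, eval_invWord, eval_map hf, mul_inv_eq_one]
    constructor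
    · intro h
      obtain ⟨w, h1, h2⟩ := exists_short_conjugator hφ hL h
        (N := List.length p.1 + List.length p.2)
        ((length_le _).trans (Nat.le_add_right _ _)) ((length_le _).trans (Nat.le_add_left _ _))
      exact ⟨w, mem_allWords hL w h1, h2.symm⟩
    · rintro ⟨w, -, hw⟩
      exact ⟨eval Γ w, hw.symm⟩
  refine ComputablePred.of_eq (p := fun p : Word (Fin r) × Word (Fin r) =>
      ∃ w ∈ allWords L (allWords L (List.length p.1 + List.length p.2)).length,
        reduceWord Γ (invWord (w.map f) ++ p.1 ++ w ++ invWord p.2) = [])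
    ?_ fun p => (heq p).symm
  obtain ⟨inst, h⟩ := hdec
  exact ⟨inst, h.to_comp⟩

end RAAG

/-! ### Confluence of commuting moves -/

namespace Popping

variable {S B : Type*}

/-- A path of `n` admissible moves, all different from `a`. -/
inductive NPath (pop : B → S → S) (ok : B → S → Prop) (a : B) : ℕ → S → S → Prop
  | refl (s : S) : NPath pop ok a 0 s s
  | cons {n : ℕ} {s t : S} (b : B) (hb : b ≠ a) (h : ok b s) (hp : NPath pop ok a n (pop b s) t) :
      NPath pop ok a (n + 1) s t

/-- A path of `n` admissible moves. -/
inductive Path (pop : B → S → S) (ok : B → S → Prop) : ℕ → S → S → Prop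
  | refl (s : S) : Path pop ok 0 s s
  | cons {n : ℕ} {s t : S} (b : B) (h : ok b s) (hp : Path pop ok n (pop b s) t) :
      Path pop ok (n + 1) s t

/-- No admissible moves are left but `a`. -/
def Stuck (ok : B → S → Prop) (a : B) (s : S) : Prop := ∀ b, b ≠ a → ¬ ok b s

/-- A system of moves that commute with each other, where moves other than `a` cannot be repeated
more than `T` times in a row. -/
structure System (pop : B → S → S) (ok : B → S → Prop) (valid : S → Prop) (a : B) (T : ℕ) :
    Prop where
  valid_pop : ∀ {s b}, valid s → ok b s → valid (pop b s)
  ok_pop : ∀ {s b c}, valid s → ok b s → ok c s → b ≠ c → ok c (pop b s)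
  comm : ∀ s b c, pop b (pop c s) = pop c (pop b s)
  term : ∀ {s}, valid s → ∃ n ≤ T, ∃ t, NPath pop ok a n s t ∧ Stuck ok a t

/-- `f` makes an admissible move, and resorts to `a` only if there is no other. -/
structure Scheduler (pop : B → S → S) (ok : B → S → Prop) (a : B) (f : S → S) : Prop where
  step : ∀ {s}, ¬ Stuck ok a s → ∃ b, b ≠ a ∧ ok b s ∧ f s = pop b s
  stuck : ∀ {s}, Stuck ok a s → ok a s → f s = pop a s

variable {pop : B → S → S} {ok : B → S → Prop} {valid : S → Prop} {a : B} {T : ℕ} {f : S → S}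

theorem NPath.trans {n m : ℕ} {s t u : S} (h : NPath pop ok a n s t) (h' : NPath pop ok a m t u) :
    NPath pop ok a (n + m) s u := by
  induction h with
  | refl s => simpa using h'
  | cons b hb h _ ih => rw [Nat.succ_add]; exact .cons b hb h (ih h')

theorem Path.trans {n m : ℕ} {s t u : S} (h : Path pop ok n s t) (h' : Path pop ok m t u) :
    Path pop ok (n + m) s u := by
  induction h with
  | refl s => simpa using h'
  | cons b h _ ih => rw [Nat.succ_add]; exact .cons b h (ih h')

namespace System

theorem valid_npath (H : System pop ok valid a T) {n : ℕ} {s t : S} (h : NPath pop ok a n s t)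
    (hs : valid s) : valid t := by
  induction h with
  | refl => exact hs
  | cons b hb h _ ih => exact ih (H.valid_pop hs h)

/-- The move `b` stays admissible until it is made, and it must be made because the end is stuck. As
moves commute, it can be made first. -/
theorem diamond (H : System pop ok valid a T) {n : ℕ} {s t : S} {b : B}
    (h : NPath pop ok a n s t) (ht : Stuck ok a t) (hs : valid s) (hb : b ≠ a) (hok : ok b s) :
    ∃ m, n = m + 1 ∧ NPath pop ok a m (pop b s) t := by
  induction h with
  | refl s => exact absurd hok (ht b hb)
  | @cons n s t c hc h hp ih =>
    by_cases hbc : c = b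
    · exact ⟨n, rfl, hbc ▸ hp⟩
    · obtain ⟨m, rfl, h2⟩ := ih ht (H.valid_pop hs h) (H.ok_pop hs h hok hbc)
      refine ⟨m + 1, rfl, .cons c hc (H.ok_pop hs hok h (Ne.symm hbc)) ?_⟩
      rwa [H.comm]

/-- By `diamond`, the first move of one path can be put in front of the other path as well. -/
theorem unique (H : System pop ok valid a T) {n m : ℕ} {s t u : S}
    (h : NPath pop ok a n s t) (ht : Stuck ok a t) (h' : NPath pop ok a m s u)
    (hu : Stuck ok a u) (hs : valid s) : n = m ∧ t = u := by
  induction h generalizing m with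
  | refl s =>
    cases h' with
    | refl => exact ⟨rfl, rfl⟩
    | cons b hb h _ => exact absurd h (ht b hb)
  | cons b hb h _ ih =>
    obtain ⟨m, rfl, h2⟩ := H.diamond h' hu hs hb h
    obtain ⟨rfl, rfl⟩ := ih ht h2 (H.valid_pop hs h)
    exact ⟨rfl, rfl⟩

/-- The move `a` does not interfere with the others: it remains admissible along the path, and the
path can be replayed after it. -/
theorem npath_pop (H : System pop ok valid a T) {n : ℕ} {s t : S}
    (h : NPath pop ok a n s t) (hs : valid s) (ha : ok a s) :
    ok a t ∧ NPath pop ok a n (pop a s) (pop a t) := by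
  induction h with
  | refl s => exact ⟨ha, .refl _⟩
  | cons b hb h _ ih =>
    obtain ⟨h1, h2⟩ := ih (H.valid_pop hs h) (H.ok_pop hs h ha hb)
    refine ⟨h1, .cons b hb (H.ok_pop hs ha h (Ne.symm hb)) ?_⟩
    rwa [H.comm]

/-- Nothing is required in stuck states, so this also covers a scheduler that never makes the move
`a`. -/
theorem iterate_eq_of_step (H : System pop ok valid a T)
    (hf : ∀ {s}, ¬ Stuck ok a s → ∃ b, b ≠ a ∧ ok b s ∧ f s = pop b s) {n : ℕ} {s t : S}
    (h : NPath pop ok a n s t) (ht : Stuck ok a t) (hs : valid s) : f^[n] s = t := by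
  induction n generalizing s with
  | zero => cases h; rfl
  | succ n ih =>
    have hst : ¬ Stuck ok a s := by
      cases h with
      | cons b hb h _ => exact fun h' => h' b hb h
    obtain ⟨b, hb, hok, hfs⟩ := hf hst
    obtain ⟨m, hm, h2⟩ := H.diamond h ht hs hb hok
    obtain rfl : n = m := by omega
    rw [Function.iterate_succ_apply, hfs]
    exact ih h2 (H.valid_pop hs hok)

theorem iterate_eq (H : System pop ok valid a T) (hf : Scheduler pop ok a f) {n : ℕ} {s t : S}
    (h : NPath pop ok a n s t) (ht : Stuck ok a t) (hs : valid s) : f^[n] s = t :=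
  H.iterate_eq_of_step hf.step h ht hs

/-- If `b` is `a`, the orbit of `s` runs to its stuck state, makes the move `a` there and runs on to
a stuck state, which by uniqueness is that of `pop a s`. Any other `b` is one of the moves on the
way to the stuck state of `s`. -/
theorem iterate_pop (H : System pop ok valid a T) (hf : Scheduler pop ok a f) {n n₁ : ℕ}
    {s t t₁ : S} {b : B} (h : NPath pop ok a n s t) (ht : Stuck ok a t)
    (h₁ : NPath pop ok a n₁ (pop b s) t₁) (ht₁ : Stuck ok a t₁) (hs : valid s) (hb : ok b s) :
    f^[n₁ + 1] s = t₁ ∧ n ≤ n₁ + 1 := by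
  by_cases hba : b = a
  · subst hba
    obtain ⟨h2, h3⟩ := H.npath_pop h hs hb
    obtain ⟨m, -, t', h4, h5⟩ := H.term (H.valid_pop (H.valid_npath h hs) h2)
    obtain ⟨rfl, rfl⟩ := H.unique (h3.trans h4) h5 h₁ ht₁ (H.valid_pop hs hb)
    refine ⟨?_, by omega⟩
    rw [show n + m + 1 = m + 1 + n by omega, Function.iterate_add_apply,
      H.iterate_eq hf h ht hs, Function.iterate_succ_apply, hf.stuck ht h2]
    exact H.iterate_eq hf h4 h5 (H.valid_pop (H.valid_npath h hs) h2)
  · obtain ⟨m, rfl, h2⟩ := H.diamond h ht hs hba hb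
    obtain ⟨rfl, rfl⟩ := H.unique h2 ht h₁ ht₁ (H.valid_pop hs hb)
    exact ⟨H.iterate_eq hf h ht hs, le_rfl⟩

/-- Arbitrary admissible moves are thus imitated by the scheduler, up to the passage to stuck
states. The inequality makes the subtraction in the induction step legitimate. -/
theorem iterate_path (H : System pop ok valid a T) (hf : Scheduler pop ok a f) {l n n' : ℕ}
    {s s' t t' : S} (hp : Path pop ok l s s') (h : NPath pop ok a n s t) (ht : Stuck ok a t)
    (h' : NPath pop ok a n' s' t') (ht' : Stuck ok a t') (hs : valid s) :
    f^[l + n'] s = t' ∧ n ≤ l + n' := by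
  induction hp generalizing n t with
  | refl s =>
    obtain ⟨rfl, rfl⟩ := H.unique h ht h' ht' hs
    rw [Nat.zero_add]
    exact ⟨H.iterate_eq hf h ht hs, le_rfl⟩
  | @cons l s s' b hb hp ih =>
    have hs1 := H.valid_pop hs hb
    obtain ⟨n₁, -, t₁, h1, h2⟩ := H.term hs1
    obtain ⟨h3, h4⟩ := ih h1 h2 h' hs1
    obtain ⟨h5, h6⟩ := H.iterate_pop hf h ht h1 h2 hs hb
    refine ⟨?_, by omega⟩
    rw [show l + 1 + n' = (l + n' - n₁) + (n₁ + 1) by omega, Function.iterate_add_apply, h5,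
      ← H.iterate_eq hf h1 h2 hs1, ← Function.iterate_add_apply,
      show l + n' - n₁ + n₁ = l + n' by omega, h3]

/-- The orbits of `s` and `t` meet. -/
def Merge (f : S → S) (s t : S) : Prop := ∃ i j, f^[i] s = f^[j] t

theorem Merge.refl (s : S) : Merge f s s := ⟨0, 0, rfl⟩

theorem Merge.symm {s t : S} (h : Merge f s t) : Merge f t s := by
  obtain ⟨i, j, h⟩ := h
  exact ⟨j, i, h.symm⟩

theorem Merge.trans {s t u : S} (h : Merge f s t) (h' : Merge f t u) : Merge f s u := by
  obtain ⟨i, j, h⟩ := h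
  obtain ⟨k, l, h'⟩ := h'
  refine ⟨k + i, j + l, ?_⟩
  rw [Function.iterate_add_apply, h, ← Function.iterate_add_apply, add_comm,
    Function.iterate_add_apply, h', ← Function.iterate_add_apply]

theorem merge_pop (H : System pop ok valid a T) (hf : Scheduler pop ok a f) {s : S} {b : B}
    (hs : valid s) (hb : ok b s) : Merge f s (pop b s) := by
  obtain ⟨n, -, t, h1, h2⟩ := H.term hs
  obtain ⟨m, -, u, h3, h4⟩ := H.term (H.valid_pop hs hb)
  refine ⟨m + 1, m, ?_⟩
  rw [(H.iterate_pop hf h1 h2 h3 h4 hs hb).1, H.iterate_eq hf h3 h4 (H.valid_pop hs hb)]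

/-- If two orbits meet, then the stuck state of the one occurs early in the other. -/
theorem exists_iterate_eq (H : System pop ok valid a T) (hf : Scheduler pop ok a f) {l n : ℕ}
    (hl : 0 < l) (hper : ∀ {s}, valid s → Path pop ok l s s) {u v t : S} (hu : valid u)
    (hv : valid v) (hm : Merge f u v) (hn : NPath pop ok a n v t) (ht : Stuck ok a t) :
    ∃ i ≤ T + l, f^[i] u = t := by
  -- A stuck state is its own stuck state, so the closed path of `l` moves through it is a closed
  -- orbit of the scheduler.
  have hfix : ∀ {t}, valid t → Stuck ok a t → ∀ k, f^[l * k] t = t := fun {t} ht hst k => by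
    rw [Function.iterate_mul]
    exact Function.iterate_fixed
      (H.iterate_path hf (hper ht) (.refl _) hst (.refl _) hst ht).1 k
  obtain ⟨i, j, hij⟩ := hm
  have htv := H.valid_npath hn hv
  have hj : j ≤ l * j := Nat.le_mul_of_pos_left j hl
  -- The `j` steps from `v` are completed to a multiple of the period, so that the orbit of `u`
  -- reaches `t` itself.
  have h1 : f^[n + l * j - j + i] u = t := by
    rw [Function.iterate_add_apply, hij, ← Function.iterate_add_apply,
      show n + l * j - j + j = l * j + n by omega, Function.iterate_add_apply,
      H.iterate_eq hf hn ht hv, hfix htv ht]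
  generalize n + l * j - j + i = k at h1
  obtain ⟨m, hm, σ, h2, h3⟩ := H.term hu
  by_cases hk : k ≤ m
  · exact ⟨k, by omega, h1⟩
  -- After `m ≤ T` steps the orbit of `u` is in its stuck state and from then on repeats every `l`
  -- steps.
  · refine ⟨(k - m) % l + m, by have := Nat.mod_lt (k - m) hl; omega, ?_⟩
    have hσ := H.valid_npath h2 hu
    have h4 : f^[k - m] σ = t := by
      rw [← H.iterate_eq hf h2 h3 hu, ← Function.iterate_add_apply,
        show k - m + m = k by omega, h1]
    rw [Function.iterate_add_apply, H.iterate_eq hf h2 h3 hu, ← h4]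
    conv_rhs => rw [← Nat.mod_add_div (k - m) l, Function.iterate_add_apply, hfix hσ h3]

end System

end Popping

/-! ### Compositions of inversions -/

namespace RAAG

section Inversions

variable {V : Type*} {Γ : SimpleGraph V}

/-- The letter map that inverts the letters of the vertices marked by `s`. -/
def flipLetter (s : V → Bool) (x : V × Bool) : V × Bool := (x.1, xor x.2 (s x.1))

/-- The sign by which a marked vertex is multiplied. -/
def flipSign (s : V → Bool) (a : V) : ℤ := if s a then -1 else 1

@[simp] theorem flipLetter_fst (s : V → Bool) (x : V × Bool) : (flipLetter s x).1 = x.1 := rfl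

@[simp] theorem flipLetter_flipLetter (s : V → Bool) (x : V × Bool) :
    flipLetter s (flipLetter s x) = x := by simp [flipLetter]

@[simp] theorem sgn_flipLetter (s : V → Bool) (x : V × Bool) :
    sgn (flipLetter s x) = flipSign s x.1 * sgn x := by
  rcases x with ⟨a, _ | _⟩ <;> cases h : s a <;> simp [sgn, flipLetter, flipSign, h]

theorem flipSign_mul_self (s : V → Bool) (a : V) : flipSign s a * flipSign s a = 1 := by
  cases h : s a <;> simp [flipSign, h]

/-- An inversion changes the sign of one vertex; along a composition the sign changes of each vertex
add up modulo 2. -/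
theorem exists_flipLetter {φ : MulAut (RAAG Γ)} (h : IsCompositionOfInversions φ) :
    ∃ s : V → Bool, ∀ x, φ (eval Γ [x]) = eval Γ [flipLetter s x] := by
  obtain ⟨l, hl, rfl⟩ := h
  have key : ∀ a, ∃ e : Bool, ∀ b, l.prod (eval Γ [(a, b)]) = eval Γ [(a, xor b e)] := by
    intro a
    induction l with
    | nil => exact ⟨false, by simp⟩
    | cons ψ l ih =>
      obtain ⟨e, he⟩ := ih fun ψ hψ => hl ψ (by simp [hψ])
      obtain ⟨x, hx, hy⟩ := hl ψ (by simp)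
      by_cases hax : a = x
      · subst hax
        refine ⟨!e, fun b => ?_⟩
        rw [List.prod_cons, MulAut.mul_apply, he]
        cases b <;> cases e <;> simp [eval, hx]
      · refine ⟨e, fun b => ?_⟩
        rw [List.prod_cons, MulAut.mul_apply, he]
        cases b <;> cases e <;> simp [eval, hy a hax]
  choose s hs using key
  exact ⟨s, fun x => hs x.1 x.2⟩

theorem apply_apply_of_flip {φ : MulAut (RAAG Γ)} {s : V → Bool}
    (hs : ∀ x, φ (eval Γ [x]) = eval Γ [flipLetter s x]) (g : RAAG Γ) : φ (φ g) = g := by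
  obtain ⟨w, rfl⟩ := exists_eval_eq Γ g
  rw [← eval_map hs, ← eval_map hs, List.map_map,
    show flipLetter s ∘ flipLetter s = id from funext fun x => flipLetter_flipLetter s x,
    List.map_id]

theorem inv_apply_of_flip {φ : MulAut (RAAG Γ)} {s : V → Bool}
    (hs : ∀ x, φ (eval Γ [x]) = eval Γ [flipLetter s x]) (g : RAAG Γ) : φ⁻¹ g = φ g := by
  rw [MulAut.inv_apply, MulEquiv.symm_apply_eq, apply_apply_of_flip hs]

theorem length_apply_of_flip {φ : MulAut (RAAG Γ)} {s : V → Bool}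
    (hs : ∀ x, φ (eval Γ [x]) = eval Γ [flipLetter s x]) (g : RAAG Γ) : length Γ (φ g) = length Γ g := by
  have key : ∀ g, length Γ (φ g) ≤ length Γ g := fun g => by
    obtain ⟨w, rfl, hw⟩ := exists_length_eq g
    rw [← eval_map hs, ← hw]
    simpa using length_le (Γ := Γ) (w.map (flipLetter s))
  refine le_antisymm (key g) ?_
  simpa [apply_apply_of_flip hs] using key (φ g)

/-- If `w` conjugates `u` to `v`, then `φ(w)` conjugates `u⁻¹` to `v⁻¹`, because `φ` is an
involution. The machine may therefore work with the inverses of its inputs. -/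
theorem twistedConj_inv_iff {φ : MulAut (RAAG Γ)} {s : V → Bool}
    (hs : ∀ x, φ (eval Γ [x]) = eval Γ [flipLetter s x]) (u v : RAAG Γ) :
    TwistedConj φ u⁻¹ v⁻¹ ↔ TwistedConj φ u v := by
  have key : ∀ u v : RAAG Γ, TwistedConj φ u v → TwistedConj φ u⁻¹ v⁻¹ := by
    rintro u v ⟨w, rfl⟩
    exact ⟨φ w, by rw [apply_apply_of_flip hs]; group⟩
  exact ⟨fun h => by simpa using key _ _ h, key u v⟩

/-! ### Twisted cyclic reduction and rotations of words. -/

variable [DecidableEq V] [DecidableRel Γ.Adj] (s : V → Bool)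

variable (Γ) in
/-- The first letter of a word is moved to the end and flipped, up to commutations. -/
def RotWord (u v : Word V) : Prop :=
  ∃ x h, TraceEq Γ u (x :: h) ∧ TraceEq Γ v (h ++ [flipLetter s x])

variable (Γ) in
/-- No pair of letters cancels, neither in the word nor across its ends. -/
def CycRed (u : Word V) : Prop :=
  -- A string with a single bead is exempt: its first and last bead are the same letter, so if `b`
  -- is flipped the equation holds although nothing cancels.
  Red Γ u ∧ ∀ b t, t ≠ 0 → (pile Γ b u).head? = some t →
    (pile Γ b u).getLast? = some (-(flipSign s b * t)) → (pile Γ b u).length = 1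

variable {s}

theorem CycRed.of_traceEq {u v : Word V} (hu : CycRed Γ s u) (h : TraceEq Γ u v) :
    CycRed Γ s v :=
  ⟨h.red_iff.1 hu.1, fun b t => by simpa only [h b] using hu.2 b t⟩

theorem Red.concat {u : Word V} {x : V × Bool} (hu : Red Γ u)
    (h : (pile Γ x.1 u).getLast? ≠ some (-sgn x)) : Red Γ (u ++ [x]) := by
  by_contra hn
  obtain ⟨y, u', w', h1, h2⟩ := exists_cancel hu (red_singleton x) hn
  have h3 := h2.perm
  have h4 := h2.length_eq
  obtain rfl : w' = [] := by simpa using h4.symm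
  obtain rfl : x = y := by simpa using h3
  apply h
  rw [h1, pile_append, ← invLetter_fst x, pile_cons_self]
  simp

/-- A cancellation at the new end would be one across the ends of the old word, and one across the
new ends would be one inside the old word. Other strings are unchanged or end in a bead `0`. -/
theorem CycRed.rot {x : V × Bool} {h : Word V} (hu : CycRed Γ s (x :: h)) :
    CycRed Γ s (h ++ [flipLetter s x]) := by
  have hx := sgn_ne_zero x
  refine ⟨hu.1.1.concat ?_, fun b t ht h1 h2 => ?_⟩
  · intro hl
    have h1 := hu.2 x.1 (sgn x) hx (by rw [pile_cons_self]; rfl)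
    rw [pile_cons_self, List.getLast?_cons] at h1
    simp only [flipLetter_fst, sgn_flipLetter] at hl
    have := h1 (by rw [hl]; rfl)
    simp at this
    rw [this] at hl
    simp at hl
  · by_cases hb : x.1 = b
    · subst hb
      have e := pile_cons_self (Γ := Γ) (flipLetter s x) []
      rw [flipLetter_fst] at e
      rw [pile_append, e] at h1 h2 ⊢
      simp only [pile_nil, List.getLast?_append, List.getLast?_singleton, sgn_flipLetter] at h2
      have ht' : t = -sgn x := by
        have h3 := flipSign_mul_self s x.1
        simp at h2
        have h4 : flipSign s x.1 * (sgn x + t) = 0 := by linarith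
        rcases mul_eq_zero.1 h4 with h5 | h5
        · simp [h5] at h3
        · linarith
      by_cases hn : pile Γ x.1 h = []
      · simp [hn]
      · rw [List.head?_append_of_ne_nil _ hn, ht'] at h1
        exact absurd h1 hu.1.2
    · by_cases ha : Γ.Adj x.1 b
      · have e : pile Γ b (h ++ [flipLetter s x]) = pile Γ b (x :: h) := by
          rw [pile_append, pile_cons_of_adj (x := flipLetter s x) ha, pile_cons_of_adj ha]
          simp
        rw [e] at h1 h2 ⊢
        exact hu.2 b t ht h1 h2
      · rw [pile_append, pile_cons_of_ne (x := flipLetter s x) hb ha] at h2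
        simp at h2
        rcases h2 with h2 | h2
        · cases hc : s b <;> simp [flipSign, hc] at h2
        · exact absurd h2 ht

/-- The inverse rotation: a cancellation at the new front was one across the old ends, and one
across the new ends would mean that `h` ends in the inverse of `x`. -/
theorem CycRed.unrot {x : V × Bool} {h : Word V} (hu : CycRed Γ s (h ++ [x])) :
    CycRed Γ s (flipLetter s x :: h) := by
  have hx := sgn_ne_zero x
  have hred : Red Γ h := by
    rw [red_iff_length]
    have h1 := hu.1.length_eq
    have h2 := length_mul_le (eval Γ h) (eval Γ [x])
    have h3 := length_le (Γ := Γ) h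
    rw [length_letter, ← eval_append, h1] at h2
    simp at h2
    omega
  have hneg : ∀ t, flipSign s x.1 * (flipSign s x.1 * t) = t := fun t => by
    rw [← mul_assoc, flipSign_mul_self, one_mul]
  refine ⟨⟨hred, ?_⟩, fun b t ht h1 h2 => ?_⟩
  · intro hl
    simp only [flipLetter_fst, sgn_flipLetter] at hl
    have hn : pile Γ x.1 h ≠ [] := by
      intro hn; simp [hn] at hl
    have h1 := hu.2 x.1 (-(flipSign s x.1 * sgn x)) (by
      intro h0
      have := hneg (sgn x)
      rw [neg_eq_zero] at h0
      rw [h0] at this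
      simp at this
      exact hx this.symm) (by rw [pile_append, List.head?_append_of_ne_nil _ hn, hl])
      (by rw [pile_append, pile_cons_self]; simp [hneg])
    rw [pile_append, pile_cons_self] at h1
    simp at h1
    exact hn h1
  · by_cases hb : x.1 = b
    · subst hb
      have e := pile_cons_self (Γ := Γ) (flipLetter s x) h
      rw [flipLetter_fst] at e
      rw [e] at h1 h2 ⊢
      simp only [List.head?_cons, Option.some.injEq, sgn_flipLetter] at h1
      subst h1
      rw [hneg] at h2
      by_cases hn : pile Γ x.1 h = []
      · simp [hn]
      · rw [List.getLast?_cons, List.getLast?_eq_some_getLast hn] at h2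
        simp only [Option.getD_some, Option.some.injEq] at h2
        exfalso
        obtain ⟨h', hh'⟩ : ∃ h', TraceEq Γ h (h' ++ [invLetter x]) := by
          have e1 : (pile Γ (invLetter x).1 h.reverse).head? = some (sgn (invLetter x)) := by
            rw [pile_reverse, List.head?_reverse, invLetter_fst,
              List.getLast?_eq_some_getLast hn, h2, sgn_invLetter]
          obtain ⟨h', hh'⟩ := exists_traceEq_cons e1
          exact ⟨h'.reverse, by simpa using hh'.reverse⟩
        have e2 : eval Γ (h ++ [x]) = eval Γ h' := by
          rw [eval_append, hh'.eval_eq, eval_append, eval_invLetter, inv_mul_cancel_right]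
        have e3 := hu.1.length_eq
        rw [e2] at e3
        have e4 := length_le (Γ := Γ) h'
        have e5 := hh'.length_eq
        simp at e3 e5
        omega
    · by_cases ha : Γ.Adj x.1 b
      · have e : pile Γ b (flipLetter s x :: h) = pile Γ b (h ++ [x]) := by
          rw [pile_append, pile_cons_of_adj (x := flipLetter s x) ha, pile_cons_of_adj ha]
          simp
        rw [e] at h1 h2 ⊢
        exact hu.2 b t ht h1 h2
      · rw [pile_cons_of_ne (x := flipLetter s x) hb ha] at h1
        simp at h1
        exact absurd h1.symm ht

/-- Cyclically reduced words that represent twisted conjugate elements are connected by rotations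
and commutations. -/
theorem eqvGen_rotWord [Finite V] {φ : MulAut (RAAG Γ)}
    (hs : ∀ x, φ (eval Γ [x]) = eval Γ [flipLetter s x]) {u v : Word V}
    (hu : CycRed Γ s u) (hv : CycRed Γ s v) (h : TwistedConj φ (eval Γ u) (eval Γ v)) :
    Relation.EqvGen (fun u v => TraceEq Γ u v ∨ RotWord Γ s u v) u v := by
  have hlen := length_apply_of_flip hs
  have hstep : ∀ {u : Word V} {g}, CycRed Γ s u → RotStep φ (eval Γ u) g →
      ∃ v, CycRed Γ s v ∧ eval Γ v = g ∧ (RotWord Γ s u v ∨ RotWord Γ s v u) := by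
    rintro u g hu ⟨x, k, ⟨h1, h2, rfl⟩ | ⟨h1, h2, rfl⟩⟩
    · obtain ⟨k, hk, rfl⟩ := exists_red k
      have hr : Red Γ (x :: k) := by
        rw [red_iff_length, eval_cons, h1, hk.length_eq, List.length_cons]
      have ht : TraceEq Γ u (x :: k) := hu.1.traceEq hr (by rw [h2, ← eval_cons])
      refine ⟨k ++ [flipLetter s x], (hu.of_traceEq ht).rot, ?_,
        Or.inl ⟨x, k, ht, TraceEq.refl _⟩⟩
      rw [eval_append, inv_apply_of_flip hs, hs]
    -- Moving the last letter to the front undoes a rotation, since flipping twice is the identity.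
    · obtain ⟨k, hk, rfl⟩ := exists_red k
      have hr : Red Γ (k ++ [x]) := by
        rw [red_iff_length, eval_append, h1, hk.length_eq]; simp
      have ht : TraceEq Γ u (k ++ [x]) := hu.1.traceEq hr (by rw [h2, eval_append])
      refine ⟨flipLetter s x :: k, (hu.of_traceEq ht).unrot, ?_,
        Or.inr ⟨flipLetter s x, k, TraceEq.refl _, by simpa using ht⟩⟩
      rw [eval_cons, hs]
  have hsteps : ∀ {u : Word V} {g}, CycRed Γ s u →
      Relation.ReflTransGen (RotStep φ) (eval Γ u) g →
      ∃ v, CycRed Γ s v ∧ eval Γ v = g ∧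
        Relation.EqvGen (fun u v => TraceEq Γ u v ∨ RotWord Γ s u v) u v := by
    intro u g hu hg
    induction hg with
    | refl => exact ⟨u, hu, rfl, .refl _⟩
    | tail _ hst ih =>
      obtain ⟨w, h1, rfl, h2⟩ := ih
      obtain ⟨v, h3, h4, h5⟩ := hstep h1 hst
      refine ⟨v, h3, h4, h2.trans _ _ _ ?_⟩
      rcases h5 with h5 | h5
      · exact .rel _ _ (Or.inr h5)
      · exact .symm _ _ (.rel _ _ (Or.inr h5))
  obtain ⟨w, hw⟩ := h
  obtain ⟨t, h1, h2⟩ := exists_rotSteps hs hlen (u := eval Γ u) (v := eval Γ v) (w := w)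
    (by rw [hw]; group)
  obtain ⟨u', h3, h4, h5⟩ := hsteps hu h1
  obtain ⟨v', h6, h7, h8⟩ := hsteps hv h2
  -- Both words end at reduced words for the same element, and these agree up to commutations.
  have h9 : TraceEq Γ u' v' := h3.1.traceEq h6.1 (h4.trans h7.symm)
  exact (h5.trans _ _ _ (.rel _ _ (Or.inl h9))).trans _ _ _ (.symm _ _ h8)

theorem RotWord.twistedConj {φ : MulAut (RAAG Γ)}
    (hs : ∀ x, φ (eval Γ [x]) = eval Γ [flipLetter s x]) {u v : Word V}
    (h : RotWord Γ s u v) : TwistedConj φ (eval Γ u) (eval Γ v) := by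
  obtain ⟨x, k, h1, h2⟩ := h
  refine ⟨eval Γ [flipLetter s x], ?_⟩
  rw [h1.eval_eq, h2.eval_eq, hs, flipLetter_flipLetter, eval_append, eval_cons Γ x k]
  group

end Inversions

end RAAG

/-! ### Rotating pilings -/

namespace RAAG

open Popping

/-- The first entry of a list is moved to the end and multiplied by `e`. -/
def rotList (e : ℤ) : List ℤ → List ℤ
  | [] => []
  | d :: l => l ++ [e * d]

section Pilings

variable {V : Type*} (Γ : SimpleGraph V) [DecidableEq V] [DecidableRel Γ.Adj] (s : V → Bool)

/-- The rotation of the top letter of the vertex `b`, on pilings. -/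
def rotPile (b : V) (P : V → List ℤ) : V → List ℤ := fun c =>
  if Γ.Adj b c then P c else rotList (flipSign s c) (P c)

/-- The restriction of a piling to a set of vertices. -/
def mask (C : Finset V) (P : V → List ℤ) : V → List ℤ := fun c => if c ∈ C then P c else []

/-- The vertex `b` lies in `C` and has a letter on top. -/
def OkPile (C : Finset V) (b : V) (P : V → List ℤ) : Prop := b ∈ C ∧ (P b).headD 0 ≠ 0

/-- Words of length `n` with support `C`. -/
def FullWord (C : Finset V) (n : ℕ) (w : Word V) : Prop :=
  (∀ x ∈ w, x.1 ∈ C) ∧ (∀ c ∈ C, ∃ x ∈ w, x.1 = c) ∧ List.length w = n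

/-- The restricted pilings of words of length `n` with support `C`. -/
def ValidPile (C : Finset V) (n : ℕ) (P : V → List ℤ) : Prop :=
  ∃ w, FullWord C n w ∧ P = mask C fun c => pile Γ c w

/-- Every letter that is not a letter of `a` is blocked by an earlier one. -/
inductive Blocked (a : V) : Word V → Prop
  | nil : Blocked a []
  | concat (w : Word V) (y : V × Bool) (hw : Blocked a w)
      (h : y.1 = a ∨ ∃ z ∈ w, ¬ Γ.Adj z.1 y.1) : Blocked a (w ++ [y])

/-- Every vertex of `C` is joined to `a` by a chain in `C` of non-commuting vertices. -/
def ConnectedFrom (C : Finset V) (a : V) : Prop :=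
  a ∈ C ∧ ∀ c ∈ C, Relation.ReflTransGen (fun b c => c ∈ C ∧ ¬ Γ.Adj b c) a c

/-- `C` lies in the support of `w`, and all letters outside `C` commute with `C`. -/
def IsClosedIn (C : Finset V) (w : Word V) : Prop :=
  (∀ b ∈ w.map Prod.fst, b ∈ C ∨ ∀ c ∈ C, Γ.Adj b c) ∧ ∀ c ∈ C, c ∈ w.map Prod.fst

/-- The rotation of the first vertex in the list that has a letter on top. -/
def sched (L : List V) (P : V → List ℤ) : V → List ℤ :=
  (L.find? fun b => decide ((P b).headD 0 ≠ 0)).elim P fun b => rotPile Γ s b P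

variable {Γ s}

theorem rotPile_word (x : V × Bool) (h : Word V) :
    rotPile Γ s x.1 (fun c => pile Γ c (x :: h)) =
      fun c => pile Γ c (h ++ [flipLetter s x]) := by
  funext c
  unfold rotPile
  rw [pile_append]
  beta_reduce
  split_ifs with ha
  · rw [pile_cons_of_adj ha, pile_cons_of_adj (x := flipLetter s x) ha]
    simp
  · by_cases hc : x.1 = c
    · subst hc
      have := pile_cons_self (Γ := Γ) (flipLetter s x) []
      rw [flipLetter_fst] at this
      rw [pile_cons_self, this, sgn_flipLetter]
      rfl
    · rw [pile_cons_of_ne hc ha, pile_cons_of_ne (x := flipLetter s x) hc ha]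
      simp [rotList]

theorem mask_rotPile (C : Finset V) (b : V) (P : V → List ℤ) :
    mask C (rotPile Γ s b P) = rotPile Γ s b (mask C P) := by
  funext c
  simp only [mask, rotPile]
  split_ifs <;> rfl

/-- On the string of `d`, every rotation is either the identity or the same map `rotList (flipSign s
d)`. This is why the factor belongs to the string and not to the rotated vertex; on strings other
than that of a genuinely rotated letter the moved bead is `0`. -/
theorem rotPile_comm (b c : V) (P : V → List ℤ) :
    rotPile Γ s b (rotPile Γ s c P) = rotPile Γ s c (rotPile Γ s b P) := by
  funext d
  unfold rotPile
  split_ifs <;> rfl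

theorem mask_traceEq {C : Finset V} {v w : Word V} (h : TraceEq Γ v w) :
    (mask C fun c => pile Γ c v) = mask C fun c => pile Γ c w := by
  rw [show (fun c => pile Γ c v) = fun c => pile Γ c w from funext h]

theorem head?_of_headD {l : List ℤ} (h : l.headD 0 ≠ 0) : l.head? = some (l.headD 0) := by
  cases l with
  | nil => simp at h
  | cons d l => rfl

theorem exists_cons_of_headD {b : V} {w : Word V} (h : (pile Γ b w).headD 0 ≠ 0) :
    ∃ x h, x.1 = b ∧ sgn x = (pile Γ b w).headD 0 ∧ TraceEq Γ w (x :: h) := by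
  obtain ⟨p, x, q, rfl, h1, h2, h3⟩ := exists_middle_of_head h (head?_of_headD h)
  exact ⟨x, p ++ q, h1, h2, traceEq_middle h3 q⟩

theorem OkPile.exists_cons {C : Finset V} {b : V} {w : Word V}
    (h : OkPile C b (mask C fun c => pile Γ c w)) :
    ∃ x h, x.1 = b ∧ TraceEq Γ w (x :: h) := by
  obtain ⟨hb, h⟩ := h
  simp only [mask, hb, if_true] at h
  obtain ⟨x, k, h1, -, h2⟩ := exists_cons_of_headD h
  exact ⟨x, k, h1, h2⟩

theorem okPile_cons {C : Finset V} {x : V × Bool} (hx : x.1 ∈ C) (h : Word V) :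
    OkPile C x.1 (mask C fun c => pile Γ c (x :: h)) := by
  refine ⟨hx, ?_⟩
  simp only [mask, hx, if_true, pile_cons_self, List.headD_cons]
  exact sgn_ne_zero x

theorem FullWord.of_perm {C : Finset V} {n : ℕ} {v w : Word V} (hv : FullWord C n v)
    (h : (v.map Prod.fst).Perm (w.map Prod.fst)) : FullWord C n w := by
  obtain ⟨h1, h2, h3⟩ := hv
  have key : ∀ c, (∃ x ∈ v, x.1 = c) ↔ ∃ x ∈ w, x.1 = c := fun c => by
    have := h.mem_iff (a := c)
    simpa only [List.mem_map] using this
  refine ⟨fun x hx => ?_, fun c hc => (key c).1 (h2 c hc), ?_⟩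
  · obtain ⟨y, hy, e⟩ := (key x.1).2 ⟨x, hx, rfl⟩
    exact e ▸ h1 y hy
  · have := h.length_eq
    simp only [List.length_map] at this
    omega

theorem TraceEq.perm_fst {v w : Word V} (h : TraceEq Γ v w) :
    (v.map Prod.fst).Perm (w.map Prod.fst) := h.perm.map _

theorem perm_fst_rot (x : V × Bool) (h : Word V) :
    ((x :: h).map Prod.fst).Perm ((h ++ [flipLetter s x]).map Prod.fst) := by
  simpa using (List.perm_append_singleton x.1 (h.map Prod.fst)).symm

theorem RotWord.perm_fst {v w : Word V} (h : RotWord Γ s v w) :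
    (v.map Prod.fst).Perm (w.map Prod.fst) := by
  obtain ⟨x, k, h1, h2⟩ := h
  exact (h1.perm_fst.trans (perm_fst_rot x k)).trans h2.symm.perm_fst

theorem map_flip_fst (w : Word V) : (w.map (flipLetter s)).map Prod.fst = w.map Prod.fst := by
  simp [Function.comp_def]

/-! ### Termination of the rotations that avoid `a`. -/

theorem path_word {C : Finset V} (w v : Word V) (hw : ∀ x ∈ w, x.1 ∈ C) :
    Popping.Path (rotPile Γ s) (OkPile C) w.length (mask C fun c => pile Γ c (w ++ v))
      (mask C fun c => pile Γ c (v ++ w.map (flipLetter s))) := by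
  induction w generalizing v with
  | nil => simpa using Popping.Path.refl _
  | cons x w ih =>
    refine .cons x.1 (okPile_cons (hw x (by simp)) _) ?_
    rw [← mask_rotPile, List.cons_append, rotPile_word]
    have := ih (v ++ [flipLetter s x]) fun y hy => hw y (by simp [hy])
    simpa using this

theorem npath_word {C : Finset V} {a : V} (w v : Word V) (hw : ∀ x ∈ w, x.1 ∈ C ∧ x.1 ≠ a) :
    NPath (rotPile Γ s) (OkPile C) a w.length (mask C fun c => pile Γ c (w ++ v))
      (mask C fun c => pile Γ c (v ++ w.map (flipLetter s))) := by
  induction w generalizing v with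
  | nil => simpa using NPath.refl _
  | cons x w ih =>
    refine .cons x.1 (hw x (by simp)).2 (okPile_cons (hw x (by simp)).1 _) ?_
    rw [← mask_rotPile, List.cons_append, rotPile_word]
    have := ih (v ++ [flipLetter s x]) fun y hy => hw y (by simp [hy])
    simpa using this

/-- An earlier letter that does not commute with a given one leaves a bead above it on its string.
-/
theorem Blocked.eq_of_headD {a b : V} {w : Word V} (hw : Blocked Γ a w)
    (h : (pile Γ b w).headD 0 ≠ 0) : b = a := by
  induction hw with
  | nil => simp at h
  | concat w y hw hy ih =>
    by_cases hn : pile Γ b w = []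
    · rw [pile_append, hn, List.nil_append] at h
      obtain ⟨x, k, h1, -, h2⟩ := exists_cons_of_headD h
      have hyx : y = x := by
        have h3 := h2.perm
        have h4 := h2.length_eq
        obtain rfl : k = [] := by simpa using h4.symm
        simpa using h3
      subst hyx
      rcases hy with hy | ⟨z, hz, hzy⟩
      · rw [← h1, hy]
      · rw [h1] at hzy
        exact absurd (pile_eq_nil_iff (Γ := Γ) |>.1 hn z hz) hzy
    · apply ih
      rw [pile_append] at h
      obtain ⟨d, l, hd⟩ := List.exists_cons_of_ne_nil hn
      rw [hd] at h ⊢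
      simpa using h

/-- The letters of `v` are sorted one after another. A letter that is not of `a` and is not blocked
commutes with everything that has stayed, and so can be moved in front of it. -/
theorem exists_blocked (a : V) {w : Word V} (hw : Blocked Γ a w) (v : Word V) :
    ∃ v₀ v₁, TraceEq Γ (w ++ v) (v₀ ++ (w ++ v₁)) ∧ Blocked Γ a (w ++ v₁) ∧
      ∀ x ∈ v₀, x ∈ v ∧ x.1 ≠ a ∧ ∀ z ∈ w, Γ.Adj z.1 x.1 := by
  induction v using List.reverseRecOn with
  | nil => exact ⟨[], [], TraceEq.refl _, by simpa using hw, by simp⟩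
  | append_singleton v y ih =>
    obtain ⟨v₀, v₁, h1, h2, h3⟩ := ih
    have h4 : TraceEq Γ (w ++ (v ++ [y])) (v₀ ++ (w ++ v₁) ++ [y]) := by
      rw [← List.append_assoc]
      exact h1.append (TraceEq.refl [y])
    by_cases hy : y.1 = a ∨ ∃ z ∈ w ++ v₁, ¬ Γ.Adj z.1 y.1
    · refine ⟨v₀, v₁ ++ [y], by simpa using h4, ?_, fun x hx => ?_⟩
      · rw [← List.append_assoc]
        exact .concat _ y h2 hy
      · obtain ⟨h5, h6⟩ := h3 x hx
        exact ⟨by simp [h5], h6⟩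
    · push Not at hy
      refine ⟨v₀ ++ [y], v₁, h4.trans ?_, h2, fun x hx => ?_⟩
      · simpa using (TraceEq.refl (Γ := Γ) v₀).append (traceEq_middle (x := y) hy.2 [])
      · rw [List.mem_append, List.mem_singleton] at hx
        rcases hx with hx | rfl
        · obtain ⟨h5, h6⟩ := h3 x hx
          exact ⟨by simp [h5], h6⟩
        · exact ⟨by simp, hy.1, fun z hz => hy.2 z (by simp [hz])⟩

theorem exists_boundary {C K : Finset V} {a : V} (hC : ConnectedFrom Γ C a) (ha : a ∈ K)
    (hK : ∃ c ∈ C, c ∉ K) : ∃ c ∈ C, c ∉ K ∧ ∃ b ∈ K, ¬ Γ.Adj b c := by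
  by_contra hn
  push Not at hn
  obtain ⟨c, hc, hcK⟩ := hK
  have : ∀ d, Relation.ReflTransGen (fun b c => c ∈ C ∧ ¬ Γ.Adj b c) a d → d ∈ K := by
    intro d hd
    induction hd with
    | refl => exact ha
    | tail _ h ih =>
      by_contra hd
      exact h.2 (hn _ h.1 hd _ ih)
  exact hcK (this c (hC.2 c hc))

/-- The rotations proceed in rounds, each moving the whole free part `w₀` to the end, at a cost of
at most `n`. `K` is a set of vertices that no longer occur in the free part; each round enlarges it
until it contains `C`. -/
theorem exists_npath_stuck {C : Finset V} {a : V} (hC : ConnectedFrom Γ C a) {n : ℕ} (k : ℕ)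
    (w₀ w₁ : Word V) (K : Finset V) (hw : FullWord C n (w₀ ++ w₁)) (hb : Blocked Γ a w₁)
    (ha : a ∈ K) (hk : (C \ K).card ≤ k) (hK : ∀ x ∈ w₀, x.1 ∉ K) :
    ∃ m ≤ k * n, ∃ t, NPath (rotPile Γ s) (OkPile C) a m
      (mask C fun c => pile Γ c (w₀ ++ w₁)) t ∧ Stuck (OkPile C) a t := by
  induction k generalizing w₀ w₁ K with
  | zero =>
    have h0 : w₀ = [] := by
      rw [List.eq_nil_iff_forall_not_mem]
      intro x hx
      have h1 : x.1 ∈ C \ K := Finset.mem_sdiff.2 ⟨hw.1 x (by simp [hx]), hK x hx⟩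
      rw [Finset.card_eq_zero.1 (Nat.le_zero.1 hk)] at h1
      simp at h1
    subst h0
    refine ⟨0, Nat.zero_le _, _, .refl _, fun b hba hb' => hba ?_⟩
    obtain ⟨hbC, hb'⟩ := hb'
    simp only [mask, hbC, if_true, List.nil_append] at hb'
    exact hb.eq_of_headD hb'
  | succ k ih =>
    have hw0 : ∀ x ∈ w₀, x.1 ∈ C ∧ x.1 ≠ a := fun x hx =>
      ⟨hw.1 x (by simp [hx]), fun e => hK x hx (e ▸ ha)⟩
    have hp := npath_word (Γ := Γ) (s := s) w₀ w₁ hw0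
    obtain ⟨v₀, v₁, h1, h2, h3⟩ := exists_blocked a hb (w₀.map (flipLetter s))
    have hfull : FullWord C n (v₀ ++ (w₁ ++ v₁)) := by
      refine (hw.of_perm (w := w₁ ++ w₀.map (flipLetter s)) ?_).of_perm h1.perm_fst
      rw [List.map_append, List.map_append, map_flip_fst]
      exact List.perm_append_comm
    have hfst : ∀ x ∈ v₀, x.1 ∈ C ∧ x.1 ∉ K := fun x hx => by
      have hx' := (h3 x hx).1
      rw [List.mem_map] at hx'
      obtain ⟨y, hy, rfl⟩ := hx'
      exact ⟨hw.1 y (by simp [hy]), hK y hy⟩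
    -- All letters of `K` stand in `w₁`, with which the new free part `v₀` commutes. So `v₀` also
    -- avoids the vertices that fail to commute with a vertex of `K ∩ C`.
    let K' := K ∪ C.filter fun c => ∃ b ∈ K ∩ C, ¬ Γ.Adj b c
    have hK' : ∀ x ∈ v₀, x.1 ∉ K' := fun x hx h4 => by
      rw [Finset.mem_union, Finset.mem_filter] at h4
      rcases h4 with h4 | ⟨-, b, hb1, hb2⟩
      · exact (hfst x hx).2 h4
      · rw [Finset.mem_inter] at hb1
        obtain ⟨z, hz, rfl⟩ := hw.2.1 b hb1.2
        rw [List.mem_append] at hz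
        rcases hz with hz | hz
        · exact hK z hz hb1.1
        · exact hb2 ((h3 x hx).2.2 z hz)
    -- As `C` is connected from `a`, the set grows as long as it does not contain `C`.
    have hcard : (C \ K').card ≤ k := by
      by_cases hCK : ∃ c ∈ C, c ∉ K
      · obtain ⟨c, hc, hcK, b, hbK, hbc⟩ := exists_boundary (K := K ∩ C) hC
          (Finset.mem_inter.2 ⟨ha, hC.1⟩)
          (by obtain ⟨c, hc, hcK⟩ := hCK; exact ⟨c, hc, by simp [hcK]⟩)
        have hlt : (C \ K').card < (C \ K).card := by
          apply Finset.card_lt_card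
          refine ⟨Finset.sdiff_subset_sdiff le_rfl Finset.subset_union_left, fun hsub => ?_⟩
          have hcK' : c ∈ C \ K := by
            refine Finset.mem_sdiff.2 ⟨hc, fun h => hcK (Finset.mem_inter.2 ⟨h, hc⟩)⟩
          have := (Finset.mem_sdiff.1 (hsub hcK')).2
          exact this (Finset.mem_union_right _ (Finset.mem_filter.2 ⟨hc, b, hbK, hbc⟩))
        omega
      · push Not at hCK
        rw [Finset.sdiff_eq_empty_iff_subset.2 fun c hc => Finset.mem_union_left _ (hCK c hc)]
        simp
    obtain ⟨m, hm, t, h5, h6⟩ := ih v₀ (w₁ ++ v₁) K' hfull h2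
      (Finset.mem_union_left _ ha) hcard hK'
    rw [← mask_traceEq h1] at h5
    refine ⟨w₀.length + m, ?_, t, hp.trans h5, h6⟩
    have : w₀.length ≤ n := by rw [← hw.2.2]; simp
    rw [Nat.succ_mul]
    omega

theorem system_rotPile {C : Finset V} {a : V} (hC : ConnectedFrom Γ C a) (n : ℕ) :
    System (rotPile Γ s) (OkPile C) (ValidPile Γ C n) a (C.card * n) where
  valid_pop := by
    rintro _ b ⟨w, hw, rfl⟩ hb
    obtain ⟨x, h, rfl, h1⟩ := hb.exists_cons
    refine ⟨h ++ [flipLetter s x], (hw.of_perm h1.perm_fst).of_perm (perm_fst_rot x h), ?_⟩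
    rw [mask_traceEq h1, ← mask_rotPile, rotPile_word]
  ok_pop := by
    rintro _ b c ⟨w, hw, rfl⟩ hb hc hbc
    obtain ⟨x, h, rfl, h1⟩ := hb.exists_cons
    refine ⟨hc.1, ?_⟩
    have h2 := hc.2
    rw [mask_traceEq h1] at h2 ⊢
    -- Two different vertices with letters on top commute, since otherwise the first letter would
    -- put a bead `0` on top of the other string.
    by_cases ha : Γ.Adj x.1 c
    · simpa only [rotPile, ha, if_true] using h2
    · simp only [mask, hc.1, if_true, pile_cons_of_ne hbc ha] at h2
      simp at h2
  comm P b c := rotPile_comm b c P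
  term := by
    rintro _ ⟨w, hw, rfl⟩
    obtain ⟨w₀, w₁, h1, h2, h3⟩ := exists_blocked (Γ := Γ) a .nil w
    rw [List.nil_append, List.nil_append] at *
    rw [mask_traceEq h1]
    exact exists_npath_stuck hC C.card w₀ w₁ {a} (hw.of_perm h1.perm_fst) h2 (by simp)
      (Finset.card_le_card Finset.sdiff_subset) fun x hx => by simpa using (h3 x hx).2.1

/-- Rotating the whole word once flips all its marked letters; rotating it a second time flips them
back. -/
theorem path_period {C : Finset V} {n : ℕ} {P : V → List ℤ} (hP : ValidPile Γ C n P) :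
    Popping.Path (rotPile Γ s) (OkPile C) (2 * n) P P := by
  obtain ⟨w, hw, rfl⟩ := hP
  have h1 := path_word (Γ := Γ) (s := s) w [] hw.1
  have h2 := path_word (Γ := Γ) (s := s) (w.map (flipLetter s)) [] (C := C) (by
    intro x hx
    rw [List.mem_map] at hx
    obtain ⟨y, hy, rfl⟩ := hx
    exact hw.1 y hy)
  simp only [List.append_nil, List.nil_append] at h1 h2
  have h3 := h1.trans h2
  rw [List.map_map, show flipLetter s ∘ flipLetter s = id from
    funext fun x => flipLetter_flipLetter s x, List.map_id, List.length_map, hw.2.2] at h3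
  rwa [two_mul]

/-! ### Components of the support, and schedulers. -/

theorem IsClosedIn.of_perm {C : Finset V} {v w : Word V} (hv : IsClosedIn Γ C v)
    (h : (v.map Prod.fst).Perm (w.map Prod.fst)) : IsClosedIn Γ C w :=
  ⟨fun b hb => hv.1 b (h.mem_iff.2 hb), fun c hc => h.mem_iff.1 (hv.2 c hc)⟩

/-- Letters outside `C` leave no bead on the strings of `C`, so deleting them does not change the
restricted piling. -/
theorem IsClosedIn.validPile {C : Finset V} {w : Word V} (hw : IsClosedIn Γ C w) :
    ValidPile Γ C ((w.map Prod.fst).countP (· ∈ C)) (mask C fun c => pile Γ c w) := by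
  refine ⟨w.filter (·.1 ∈ C), ⟨fun x hx => by simpa using (List.mem_filter.1 hx).2,
    fun c hc => ?_, ?_⟩, ?_⟩
  · obtain ⟨x, hx, rfl⟩ := List.mem_map.1 (hw.2 c hc)
    exact ⟨x, List.mem_filter.2 ⟨hx, by simpa using hc⟩, rfl⟩
  · rw [List.countP_map, List.countP_eq_length_filter]
    rfl
  · funext c
    unfold mask
    split_ifs with hc
    · have key : ∀ v : Word V, (∀ x ∈ v, x ∈ w) → pile Γ c v = pile Γ c (v.filter (·.1 ∈ C)) := by
        intro v hv
        induction v with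
        | nil => rfl
        | cons x v ih =>
          have ih := ih fun y hy => hv y (by simp [hy])
          by_cases hx : x.1 ∈ C
          · rw [List.filter_cons_of_pos (by simpa using hx), pile_cons, ih, ← pile_cons]
          · rw [List.filter_cons_of_neg (by simpa using hx), ← ih]
            have := (hw.1 x.1 (List.mem_map_of_mem (hv x (by simp)))).resolve_left hx
            exact pile_cons_of_adj (this c hc) v
      exact key w fun _ h => h
    · rfl

theorem scheduler_sched {C : Finset V} {a : V} {L : List V} (hL : ∀ b, b ∈ L ↔ b ∈ C ∧ b ≠ a) :
    Scheduler (rotPile Γ s) (OkPile C) a (sched Γ s (L ++ [a])) ∧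
      ∀ {P}, ¬ Stuck (OkPile C) a P →
        ∃ b, b ≠ a ∧ OkPile C b P ∧ sched Γ s L P = rotPile Γ s b P := by
  have key : ∀ {P}, ¬ Stuck (OkPile C) a P → ∃ b, b ≠ a ∧ OkPile C b P ∧
      L.find? (fun b => decide ((P b).headD 0 ≠ 0)) = some b := by
    intro P hP
    unfold Stuck at hP
    push Not at hP
    obtain ⟨b, hb, hok⟩ := hP
    obtain ⟨c, hc⟩ := Option.isSome_iff_exists.1 (List.find?_isSome
      (p := fun b => decide ((P b).headD 0 ≠ 0)) |>.2 ⟨b, (hL b).2 ⟨hok.1, hb⟩, by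
        simpa using hok.2⟩)
    have h1 := List.find?_some hc
    have h2 := (hL c).1 (List.mem_of_find?_eq_some hc)
    exact ⟨c, h2.2, ⟨h2.1, by simpa using h1⟩, hc⟩
  refine ⟨⟨fun {P} hP => ?_, fun {P} hP ha => ?_⟩, fun {P} hP => ?_⟩
  · obtain ⟨b, h1, h2, h3⟩ := key hP
    exact ⟨b, h1, h2, by rw [sched, List.find?_append, h3]; rfl⟩
  · have : L.find? (fun b => decide ((P b).headD 0 ≠ 0)) = none := by
      rw [List.find?_eq_none]
      intro b hb hbP
      exact hP b ((hL b).1 hb).2 ⟨((hL b).1 hb).1, by simpa using hbP⟩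
    rw [sched, List.find?_append, this, List.find?_singleton, if_pos (by simpa using ha.2)]
    rfl
  · obtain ⟨b, h1, h2, h3⟩ := key hP
    exact ⟨b, h1, h2, by rw [sched, h3]; rfl⟩

theorem sched_of_stuck {C : Finset V} {a : V} {L : List V} (hL : ∀ b, b ∈ L ↔ b ∈ C ∧ b ≠ a)
    {P : V → List ℤ} (hP : Stuck (OkPile C) a P) : sched Γ s L P = P := by
  have : L.find? (fun b => decide ((P b).headD 0 ≠ 0)) = none := by
    rw [List.find?_eq_none]
    intro b hb hbP
    exact hP b ((hL b).1 hb).2 ⟨((hL b).1 hb).1, by simpa using hbP⟩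
  rw [sched, this]
  rfl

/-- A rotation of a vertex in `C` is an admissible move, after which the orbits still merge; a
rotation of another vertex is invisible on the strings of `C`. -/
theorem merge_of_eqvGen {C : Finset V} {a : V} {f : (V → List ℤ) → V → List ℤ}
    (hC : ConnectedFrom Γ C a) (hf : Scheduler (rotPile Γ s) (OkPile C) a f) {u v : Word V}
    (h : Relation.EqvGen (fun u v => TraceEq Γ u v ∨ RotWord Γ s u v) u v) :
    (u.map Prod.fst).Perm (v.map Prod.fst) ∧ (IsClosedIn Γ C u →
      System.Merge f (mask C fun c => pile Γ c u) (mask C fun c => pile Γ c v)) := by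
  induction h with
  | rel u v h =>
    rcases h with h | h
    · exact ⟨h.perm_fst, fun _ => by rw [mask_traceEq h]; exact .refl _⟩
    · refine ⟨h.perm_fst, fun hu => ?_⟩
      have hval := hu.validPile
      obtain ⟨x, k, h1, h2⟩ := h
      rw [mask_traceEq h1] at hval ⊢
      rw [mask_traceEq h2]
      by_cases hx : x.1 ∈ C
      · rw [← rotPile_word, mask_rotPile]
        exact (system_rotPile hC _).merge_pop hf hval (okPile_cons hx k)
      · have hadj := (hu.1 x.1 (h1.perm_fst.mem_iff.2 (by simp))).resolve_left hx
        have : (mask C fun c => pile Γ c (x :: k)) =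
            mask C fun c => pile Γ c (k ++ [flipLetter s x]) := by
          funext c
          unfold mask
          split_ifs with hc
          · beta_reduce
            rw [pile_append, pile_cons_of_adj (hadj c hc),
              pile_cons_of_adj (x := flipLetter s x) (hadj c hc)]
            simp
          · rfl
        rw [this]
        exact .refl _
  | refl u => exact ⟨List.Perm.refl _, fun _ => .refl _⟩
  | symm u v _ ih => exact ⟨ih.1.symm, fun hv => (ih.2 (hv.of_perm ih.1.symm)).symm⟩
  | trans u v w _ _ ih₁ ih₂ =>
    exact ⟨ih₁.1.trans ih₂.1, fun hu => (ih₁.2 hu).trans (ih₂.2 (hu.of_perm ih₁.1))⟩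

/-- The final state of one word under rotations that avoid `a` is reached by the other word. -/
theorem exists_iterate_sched {C : Finset V} {a : V} {L : List V} (hC : ConnectedFrom Γ C a)
    (hL : ∀ b, b ∈ L ↔ b ∈ C ∧ b ≠ a) {u v : Word V}
    (h : Relation.EqvGen (fun u v => TraceEq Γ u v ∨ RotWord Γ s u v) u v)
    (hu : IsClosedIn Γ C u) {T : ℕ} (hT : C.card * List.length u ≤ T) :
    ∃ i ≤ T + 2 * List.length u, (sched Γ s (L ++ [a]))^[i] (mask C fun c => pile Γ c u) =
      (sched Γ s L)^[T] (mask C fun c => pile Γ c v) := by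
  obtain ⟨hf, hg⟩ := scheduler_sched (Γ := Γ) (s := s) hL
  obtain ⟨hperm, hm⟩ := merge_of_eqvGen hC hf h
  have hv := hu.of_perm hperm
  have hvu := hu.validPile
  have hvv := hv.validPile
  rw [← hperm.countP_eq] at hvv
  set n := (u.map Prod.fst).countP (· ∈ C) with hn
  have hnu : n ≤ List.length u := by
    rw [hn]
    refine List.countP_le_length.trans ?_
    simp
  have hn0 : 0 < n := by
    rw [hn, List.countP_pos_iff]
    exact ⟨a, hu.2 a hC.1, by simpa using hC.1⟩
  have H := system_rotPile (s := s) hC n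
  have hTn : C.card * n ≤ T := (Nat.mul_le_mul_left _ hnu).trans hT
  obtain ⟨m, hm1, t, h1, h2⟩ := H.term hvv
  -- Once stuck, the scheduler without `a` idles, so any sufficiently large number of iterations
  -- will do.
  have hgt : (sched Γ s L)^[T] (mask C fun c => pile Γ c v) = t := by
    obtain ⟨k, rfl⟩ := Nat.exists_eq_add_of_le' (hm1.trans hTn)
    rw [Function.iterate_add_apply, H.iterate_eq_of_step hg h1 h2 hvv]
    exact Function.iterate_fixed (sched_of_stuck hL h2) k
  obtain ⟨i, hi, h3⟩ := H.exists_iterate_eq hf (l := 2 * n) (by omega) path_period hvu hvv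
    (hm hu) h1 h2
  exact ⟨i, by omega, by rw [h3, hgt]⟩

end Pilings

end RAAG

/-! ### A while-language for random access machines -/

namespace RAM

/-- Arithmetical expressions over variables; `third e` is the floor of `e / 3`. -/
inductive Expr (ι : Type) : Type
  | var (v : ι)
  | lit (n : ℤ)
  | third (e : Expr ι)
  | add (e₁ e₂ : Expr ι)
  | sub (e₁ e₂ : Expr ι)
  | mul (e₁ e₂ : Expr ι)

/-- Structured programs. -/
inductive Cmd (ι : Type) : Type
  | skip
  | assign (v : ι) (e : Expr ι)
  | read (v : ι)
  | seq (c₁ c₂ : Cmd ι)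
  | ifz (e : Expr ι) (c₁ c₂ : Cmd ι)
  | ifpos (e : Expr ι) (c₁ c₂ : Cmd ι)
  | loop (e : Expr ι) (c : Cmd ι)

/-- The values of the variables, and the unread input. -/
structure State (ι : Type) : Type where
  val : ι → ℤ
  inp : List ℤ

section Compiler

variable {ι : Type}

/-- The value of an expression. -/
def Expr.eval (σ : ι → ℤ) : Expr ι → ℤ
  | var v => σ v
  | lit n => n
  | third e => Int.fdiv (e.eval σ) 3
  | add e₁ e₂ => e₁.eval σ + e₂.eval σ
  | sub e₁ e₂ => e₁.eval σ - e₂.eval σ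
  | mul e₁ e₂ => e₁.eval σ * e₂.eval σ

/-- The number of instructions of a compiled expression. -/
def Expr.size : Expr ι → ℕ
  | var _ => 1
  | lit _ => 1
  | third e => e.size + 1
  | add e₁ e₂ => e₂.size + 1 + (e₁.size + 1)
  | sub e₁ e₂ => e₂.size + 1 + (e₁.size + 1)
  | mul e₁ e₂ => e₂.size + 1 + (e₁.size + 1)

variable (idx : ι → ℕ)

/-- The code of an expression. Variables live in the odd registers, and intermediate results in the
even registers from `2 * d + 2` on. The value is left in the accumulator. -/
def Expr.compile : ℕ → Expr ι → Program
  | _, var v => [.load (.reg (2 * idx v + 1))]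
  | _, lit n => [.load (.lit n)]
  | d, third e => e.compile d ++ [.div (.lit 3)]
  | d, add e₁ e₂ => (e₂.compile d ++ [.store (.reg (2 * d + 2))]) ++
      (e₁.compile (d + 1) ++ [.add (.reg (2 * d + 2))])
  | d, sub e₁ e₂ => (e₂.compile d ++ [.store (.reg (2 * d + 2))]) ++
      (e₁.compile (d + 1) ++ [.sub (.reg (2 * d + 2))])
  | d, mul e₁ e₂ => (e₂.compile d ++ [.store (.reg (2 * d + 2))]) ++
      (e₁.compile (d + 1) ++ [.mult (.reg (2 * d + 2))])

/-- The code of a structured program that is placed at the position `p`. -/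
def Cmd.compile : ℕ → Cmd ι → Program
  | _, skip => []
  | _, assign v e => e.compile idx 0 ++ [.store (.reg (2 * idx v + 1))]
  | _, read v => [.read (.reg (2 * idx v + 1))]
  | p, seq c₁ c₂ => c₁.compile p ++ c₂.compile (p + (c₁.compile p).length)
  | p, ifz e c₁ c₂ =>
      let B₂ := c₂.compile (p + e.size + 1)
      let q := p + e.size + 1 + B₂.length + 1
      let B₁ := c₁.compile q
      e.compile idx 0 ++ ([.jzero q] ++ (B₂ ++ ([.jump (q + B₁.length)] ++ B₁)))
  | p, ifpos e c₁ c₂ =>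
      let B₂ := c₂.compile (p + e.size + 1)
      let q := p + e.size + 1 + B₂.length + 1
      let B₁ := c₁.compile q
      e.compile idx 0 ++ ([.jgtz q] ++ (B₂ ++ ([.jump (q + B₁.length)] ++ B₁)))
  | p, loop e c =>
      let B := c.compile (p + e.size + 1)
      e.compile idx 0 ++ ([.jzero (p + e.size + 1 + B.length + 1)] ++ (B ++ [.jump p]))

variable [DecidableEq ι]

/-- Update of a variable. -/
def State.set (s : State ι) (v : ι) (z : ℤ) : State ι := ⟨Function.update s.val v z, s.inp⟩

/-- `Exec c s t s'`: the program `c` leads from `s` to `s'` in `t` machine steps. -/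
inductive Exec : Cmd ι → State ι → ℕ → State ι → Prop
  | skip (s : State ι) : Exec .skip s 0 s
  | assign (v : ι) (e : Expr ι) (s : State ι) :
      Exec (.assign v e) s (e.size + 1) (s.set v (e.eval s.val))
  | read (v : ι) (s : State ι) :
      Exec (.read v) s 1 ⟨Function.update s.val v (s.inp.headD 0), s.inp.tail⟩
  | seq {c₁ c₂ : Cmd ι} {s s₁ s₂ : State ι} {t₁ t₂ : ℕ} (h₁ : Exec c₁ s t₁ s₁)
      (h₂ : Exec c₂ s₁ t₂ s₂) : Exec (.seq c₁ c₂) s (t₁ + t₂) s₂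
  | ifz_true {e : Expr ι} {c₁ c₂ : Cmd ι} {s s' : State ι} {t : ℕ} (he : e.eval s.val = 0)
      (h : Exec c₁ s t s') : Exec (.ifz e c₁ c₂) s (e.size + (1 + t)) s'
  | ifz_false {e : Expr ι} {c₁ c₂ : Cmd ι} {s s' : State ι} {t : ℕ} (he : e.eval s.val ≠ 0)
      (h : Exec c₂ s t s') : Exec (.ifz e c₁ c₂) s (e.size + (1 + (t + 1))) s'
  | ifpos_true {e : Expr ι} {c₁ c₂ : Cmd ι} {s s' : State ι} {t : ℕ} (he : 0 < e.eval s.val)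
      (h : Exec c₁ s t s') : Exec (.ifpos e c₁ c₂) s (e.size + (1 + t)) s'
  | ifpos_false {e : Expr ι} {c₁ c₂ : Cmd ι} {s s' : State ι} {t : ℕ} (he : ¬ 0 < e.eval s.val)
      (h : Exec c₂ s t s') : Exec (.ifpos e c₁ c₂) s (e.size + (1 + (t + 1))) s'
  | loop_done {e : Expr ι} {c : Cmd ι} {s : State ι} (he : e.eval s.val = 0) :
      Exec (.loop e c) s (e.size + 1) s
  | loop_step {e : Expr ι} {c : Cmd ι} {s s₁ s₂ : State ι} {t₁ t₂ : ℕ} (he : e.eval s.val ≠ 0)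
      (h₁ : Exec c s t₁ s₁) (h₂ : Exec (.loop e c) s₁ t₂ s₂) :
      Exec (.loop e c) s (e.size + (1 + (t₁ + (1 + t₂)))) s₂

/-! ### Correctness of the compiler. -/

/-- The program `P` contains the code `c` at the position `p`. -/
def CodeAt (P : Program) (p : ℕ) (B : Program) : Prop :=
  ∀ i < B.length, P[p + i]? = B[i]?

/-- The memory holds the variables. -/
def Rel (m : ℕ → ℤ) (σ : ι → ℤ) : Prop := ∀ v, m (2 * idx v + 1) = σ v

variable {idx}

theorem CodeAt.append {P : Program} {p : ℕ} {c₁ c₂ : Program} (h : CodeAt P p (c₁ ++ c₂)) :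
    CodeAt P p c₁ ∧ CodeAt P (p + c₁.length) c₂ := by
  constructor
  · intro i hi
    rw [h i (by simp; omega), List.getElem?_append_left hi]
  · intro i hi
    have := h (c₁.length + i) (by simp; omega)
    rw [← add_assoc] at this
    rw [this, List.getElem?_append_right (by omega)]
    simp

theorem CodeAt.head {P : Program} {p : ℕ} {a : Instr} {c : Program} (h : CodeAt P p (a :: c)) :
    P[p]? = some a := by
  simpa using h 0 (by simp)

theorem Steps.trans {P : Program} {t₁ t₂ : ℕ} {c d e : Config} (h₁ : Steps P t₁ c d)
    (h₂ : Steps P t₂ d e) : Steps P (t₁ + t₂) c e := by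
  induction h₁ with
  | refl => simpa using h₂
  | cons h _ ih => rw [Nat.succ_add]; exact .cons h (ih h₂)

theorem steps_one {P : Program} {c d : Config} {a : Instr} (h : P[c.pc]? = some a)
    (h' : exec c a = some d) : Steps P 1 c d :=
  .cons (by rw [step, h]; exact h') (.refl d)

theorem Expr.length_compile (d : ℕ) (e : Expr ι) : (e.compile idx d).length = e.size := by
  induction e generalizing d <;> simp [Expr.compile, Expr.size, *] <;> omega

theorem Rel.update_even {m : ℕ → ℤ} {σ : ι → ℤ} (h : Rel idx m σ) (k : ℕ) (z : ℤ) :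
    Rel idx (Function.update m (2 * k) z) σ := fun v => by
  rw [Function.update_of_ne (by omega)]
  exact h v

theorem Rel.update_var (hidx : Function.Injective idx) {m : ℕ → ℤ} {σ : ι → ℤ}
    (h : Rel idx m σ) (v : ι) (z : ℤ) :
    Rel idx (Function.update m (2 * idx v + 1) z) (Function.update σ v z) := fun w => by
  by_cases hw : w = v
  · subst hw; simp
  · rw [Function.update_of_ne, Function.update_of_ne hw]
    · exact h w
    · intro e
      exact hw (hidx (by omega))

/-- The code of a binary operation. -/
theorem steps_binary {P : Program} {σ : ι → ℤ} {e₁ e₂ : Expr ι} {d : ℕ} {a : Instr}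
    {op : ℤ → ℤ → ℤ}
    {inp out : List ℤ} (ih : ∀ e : Expr ι, (e = e₁ ∨ e = e₂) → ∀ (p d : ℕ) (m : ℕ → ℤ),
      CodeAt P p (e.compile idx d) → Rel idx m σ →
      ∃ m', Steps P e.size ⟨p, m, inp, out⟩ ⟨p + e.size, m', inp, out⟩ ∧ m' 0 = e.eval σ ∧
        Rel idx m' σ ∧ ∀ k < d, m' (2 * k + 2) = m (2 * k + 2))
    (ha : ∀ c : Config, exec c a = some (c.put 0 (op (c.mem 0) (c.mem (2 * d + 2)))))
    {p : ℕ} {m : ℕ → ℤ}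
    (hc : CodeAt P p ((e₂.compile idx d ++ [.store (.reg (2 * d + 2))]) ++
      (e₁.compile idx (d + 1) ++ [a]))) (hm : Rel idx m σ) :
    ∃ m', Steps P (e₂.size + 1 + (e₁.size + 1)) ⟨p, m, inp, out⟩
        ⟨p + (e₂.size + 1 + (e₁.size + 1)), m', inp, out⟩ ∧
      m' 0 = op (e₁.eval σ) (e₂.eval σ) ∧
        Rel idx m' σ ∧ ∀ k < d, m' (2 * k + 2) = m (2 * k + 2) := by
  obtain ⟨h1, h2⟩ := hc.append
  obtain ⟨h3, h4⟩ := h1.append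
  obtain ⟨h5, h6⟩ := h2.append
  simp only [List.length_append, Expr.length_compile, List.length_singleton] at h4 h5 h6
  obtain ⟨m₁, s1, v1, r1, k1⟩ := ih e₂ (Or.inr rfl) p d m h3 hm
  have s2 : Steps P 1 ⟨p + e₂.size, m₁, inp, out⟩
      ⟨p + (e₂.size + 1), Function.update m₁ (2 * d + 2) (m₁ 0), inp, out⟩ :=
    steps_one h4.head rfl
  have r2 : Rel idx (Function.update m₁ (2 * d + 2) (m₁ 0)) σ := r1.update_even (d + 1) _
  obtain ⟨m₃, s3, v3, r3, k3⟩ := ih e₁ (Or.inl rfl) _ (d + 1) _ h5 r2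
  have e3 : m₃ (2 * d + 2) = e₂.eval σ := by
    rw [k3 d (by omega), Function.update_self, v1]
  have s4 : Steps P 1 ⟨p + (e₂.size + 1) + e₁.size, m₃, inp, out⟩
      ⟨p + (e₂.size + 1 + (e₁.size + 1)), Function.update m₃ 0 (op (m₃ 0) (m₃ (2 * d + 2))),
        inp, out⟩ := by
    rw [show p + (e₂.size + 1 + (e₁.size + 1)) = p + (e₂.size + 1) + e₁.size + 1 by omega]
    exact steps_one h6.head (ha _)
  refine ⟨_, ((s1.trans s2).trans (s3.trans s4)), ?_, r3.update_even 0 _, fun k hk => ?_⟩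
  · rw [Function.update_self, v3, e3]
  · rw [Function.update_of_ne (by omega), k3 k (by omega), Function.update_of_ne (by omega),
      k1 k hk]

/-- The last clause, that intermediate results below depth `d` survive, carries the induction
through nested operations. -/
theorem Expr.steps_compile {P : Program} {σ : ι → ℤ} (e : Expr ι) (p d : ℕ) (m : ℕ → ℤ)
    (inp out : List ℤ) (hc : CodeAt P p (e.compile idx d)) (hm : Rel idx m σ) :
    ∃ m', Steps P e.size ⟨p, m, inp, out⟩ ⟨p + e.size, m', inp, out⟩ ∧ m' 0 = e.eval σ ∧
      Rel idx m' σ ∧ ∀ k < d, m' (2 * k + 2) = m (2 * k + 2) := by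
  induction e generalizing p d m with
  | var v =>
    refine ⟨Function.update m 0 (m (2 * idx v + 1)), steps_one hc.head rfl, ?_,
      hm.update_even 0 _, fun k _ => Function.update_of_ne (by omega) _ _⟩
    rw [Function.update_self]
    exact hm v
  | lit n =>
    exact ⟨Function.update m 0 n, steps_one hc.head rfl, Function.update_self _ _ _,
      hm.update_even 0 _, fun k _ => Function.update_of_ne (by omega) _ _⟩
  | third e ih =>
    obtain ⟨h1, h2⟩ := hc.append
    rw [Expr.length_compile] at h2
    obtain ⟨m₁, s1, v1, r1, k1⟩ := ih p d m h1 hm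
    refine ⟨Function.update m₁ 0 (Int.fdiv (m₁ 0) 3), s1.trans (steps_one h2.head rfl), ?_,
      r1.update_even 0 _, fun k hk => ?_⟩
    · rw [Function.update_self, v1]; rfl
    · rw [Function.update_of_ne (by omega), k1 k hk]
  | add e₁ e₂ ih₁ ih₂ =>
    refine steps_binary (op := (· + ·)) ?_ (fun c => rfl) hc hm
    rintro e (rfl | rfl) p d m h1 h2
    · exact ih₁ p d m h1 h2
    · exact ih₂ p d m h1 h2
  | sub e₁ e₂ ih₁ ih₂ =>
    refine steps_binary (op := (· - ·)) ?_ (fun c => rfl) hc hm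
    rintro e (rfl | rfl) p d m h1 h2
    · exact ih₁ p d m h1 h2
    · exact ih₂ p d m h1 h2
  | mul e₁ e₂ ih₁ ih₂ =>
    refine steps_binary (op := (· * ·)) ?_ (fun c => rfl) hc hm
    rintro e (rfl | rfl) p d m h1 h2
    · exact ih₁ p d m h1 h2
    · exact ih₂ p d m h1 h2

/-- The induction is on the execution and not on the program, so that a loop can be entered again at
the same position. -/
theorem Exec.steps_compile (hidx : Function.Injective idx) {P : Program} {c : Cmd ι}
    {s s' : State ι} {t : ℕ} (h : Exec c s t s') (p : ℕ) (m : ℕ → ℤ) (out : List ℤ)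
    (hc : CodeAt P p (c.compile idx p)) (hm : Rel idx m s.val) :
    ∃ m', Steps P t ⟨p, m, s.inp, out⟩ ⟨p + (c.compile idx p).length, m', s'.inp, out⟩ ∧
      Rel idx m' s'.val := by
  induction h generalizing p m with
  | skip s => exact ⟨m, .refl _, hm⟩
  | assign v e s =>
    obtain ⟨h1, h2⟩ := hc.append
    obtain ⟨m₁, s1, v1, r1, -⟩ := e.steps_compile p 0 m s.inp out h1 hm
    rw [Expr.length_compile] at h2
    refine ⟨Function.update m₁ (2 * idx v + 1) (m₁ 0), ?_, ?_⟩
    · simp only [Cmd.compile, List.length_append, Expr.length_compile, List.length_singleton]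
      exact s1.trans (steps_one h2.head rfl)
    · rw [v1]
      exact r1.update_var hidx v _
  | read v s =>
    exact ⟨_, steps_one hc.head rfl, hm.update_var hidx v _⟩
  | seq _ _ ih₁ ih₂ =>
    obtain ⟨h1, h2⟩ := hc.append
    obtain ⟨m₁, s1, r1⟩ := ih₁ p m h1 hm
    obtain ⟨m₂, s2, r2⟩ := ih₂ _ m₁ h2 r1
    refine ⟨m₂, ?_, r2⟩
    simp only [Cmd.compile, List.length_append, ← add_assoc]
    exact s1.trans s2
  | @ifz_true e c₁ c₂ s s' t he _ ih =>
    obtain ⟨h1, h2⟩ := hc.append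
    rw [Expr.length_compile] at h2
    obtain ⟨-, h3⟩ := (h2.append.2.append.2).append
    obtain ⟨m₁, s1, v1, r1, -⟩ := e.steps_compile p 0 m s.inp out h1 hm
    have s2 := steps_one (d := ⟨_, m₁, s.inp, out⟩) (c := ⟨p + e.size, m₁, s.inp, out⟩)
      h2.append.1.head (by simp [exec, Config.branch, v1, he]; rfl)
    obtain ⟨m₂, s3, r2⟩ := ih _ m₁ h3 r1
    refine ⟨m₂, ?_, r2⟩
    convert s1.trans (s2.trans s3) using 2
    simp [Cmd.compile, Expr.length_compile]
    omega
  | @ifz_false e c₁ c₂ s s' t he _ ih =>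
    obtain ⟨h1, h2⟩ := hc.append
    rw [Expr.length_compile] at h2
    obtain ⟨h3, h4⟩ := h2.append.2.append
    obtain ⟨m₁, s1, v1, r1, -⟩ := e.steps_compile p 0 m s.inp out h1 hm
    have s2 := steps_one (d := ⟨p + e.size + 1, m₁, s.inp, out⟩)
      (c := ⟨p + e.size, m₁, s.inp, out⟩)
      h2.append.1.head (by simp [exec, Config.branch, v1, he])
    obtain ⟨m₂, s3, r2⟩ := ih _ m₁ h3 r1
    have s4 := steps_one (d := ⟨_, m₂, s'.inp, out⟩) (c := ⟨_, m₂, s'.inp, out⟩)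
      h4.append.1.head rfl
    refine ⟨m₂, ?_, r2⟩
    convert s1.trans (s2.trans (s3.trans s4)) using 2
    simp [Cmd.compile, Expr.length_compile]
    omega
  | @ifpos_true e c₁ c₂ s s' t he _ ih =>
    obtain ⟨h1, h2⟩ := hc.append
    rw [Expr.length_compile] at h2
    obtain ⟨-, h3⟩ := (h2.append.2.append.2).append
    obtain ⟨m₁, s1, v1, r1, -⟩ := e.steps_compile p 0 m s.inp out h1 hm
    have s2 := steps_one (d := ⟨_, m₁, s.inp, out⟩) (c := ⟨p + e.size, m₁, s.inp, out⟩)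
      h2.append.1.head (by simp [exec, Config.branch, v1, he]; rfl)
    obtain ⟨m₂, s3, r2⟩ := ih _ m₁ h3 r1
    refine ⟨m₂, ?_, r2⟩
    convert s1.trans (s2.trans s3) using 2
    simp [Cmd.compile, Expr.length_compile]
    omega
  | @ifpos_false e c₁ c₂ s s' t he _ ih =>
    obtain ⟨h1, h2⟩ := hc.append
    rw [Expr.length_compile] at h2
    obtain ⟨h3, h4⟩ := h2.append.2.append
    obtain ⟨m₁, s1, v1, r1, -⟩ := e.steps_compile p 0 m s.inp out h1 hm
    have s2 := steps_one (d := ⟨p + e.size + 1, m₁, s.inp, out⟩)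
      (c := ⟨p + e.size, m₁, s.inp, out⟩)
      h2.append.1.head (by simp [exec, Config.branch, v1, he])
    obtain ⟨m₂, s3, r2⟩ := ih _ m₁ h3 r1
    have s4 := steps_one (d := ⟨_, m₂, s'.inp, out⟩) (c := ⟨_, m₂, s'.inp, out⟩)
      h4.append.1.head rfl
    refine ⟨m₂, ?_, r2⟩
    convert s1.trans (s2.trans (s3.trans s4)) using 2
    simp [Cmd.compile, Expr.length_compile]
    omega
  | @loop_done e c s he =>
    obtain ⟨h1, h2⟩ := hc.append
    rw [Expr.length_compile] at h2
    obtain ⟨m₁, s1, v1, r1, -⟩ := e.steps_compile p 0 m s.inp out h1 hm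
    have s2 := steps_one (d := ⟨_, m₁, s.inp, out⟩) (c := ⟨p + e.size, m₁, s.inp, out⟩)
      h2.append.1.head (by simp [exec, Config.branch, v1, he]; rfl)
    refine ⟨m₁, ?_, r1⟩
    convert s1.trans s2 using 2
    simp [Cmd.compile, Expr.length_compile]
    omega
  | @loop_step e c s s₁ s₂ t₁ t₂ he _ _ ih₁ ih₂ =>
    obtain ⟨h1, h2⟩ := hc.append
    rw [Expr.length_compile] at h2
    obtain ⟨h3, h4⟩ := h2.append.2.append
    obtain ⟨m₁, s1, v1, r1, -⟩ := e.steps_compile p 0 m s.inp out h1 hm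
    have s2 := steps_one (d := ⟨p + e.size + 1, m₁, s.inp, out⟩)
      (c := ⟨p + e.size, m₁, s.inp, out⟩)
      h2.append.1.head (by simp [exec, Config.branch, v1, he])
    obtain ⟨m₂, s3, r2⟩ := ih₁ _ m₁ h3 r1
    have s4 := steps_one (d := ⟨p, m₂, s₁.inp, out⟩) (c := ⟨_, m₂, s₁.inp, out⟩)
      h4.head rfl
    obtain ⟨m₃, s5, r3⟩ := ih₂ p m₂ hc r2
    exact ⟨m₃, s1.trans (s2.trans (s3.trans (s4.trans s5))), r3⟩

/-! ### Total correctness with a time bound -/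

/-- Started in `s`, the program `c` halts after at most `K` machine steps, in a state with the
property `Q`. -/
def Ends (c : Cmd ι) (s : State ι) (K : ℕ) (Q : State ι → Prop) : Prop :=
  ∃ t ≤ K, ∃ s', Exec c s t s' ∧ Q s'

theorem Ends.mono {c : Cmd ι} {s : State ι} {K K' : ℕ} {Q Q' : State ι → Prop}
    (h : Ends c s K Q) (hK : K ≤ K') (hQ : ∀ s, Q s → Q' s) : Ends c s K' Q' := by
  obtain ⟨t, ht, s', h1, h2⟩ := h
  exact ⟨t, ht.trans hK, s', h1, hQ _ h2⟩

theorem Ends.skip {s : State ι} {Q : State ι → Prop} (h : Q s) : Ends .skip s 0 Q :=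
  ⟨0, le_rfl, s, .skip s, h⟩

theorem Ends.assign {s : State ι} {v : ι} {e : Expr ι} {Q : State ι → Prop}
    (h : Q (s.set v (e.eval s.val))) : Ends (.assign v e) s (e.size + 1) Q :=
  ⟨_, le_rfl, _, .assign v e s, h⟩

theorem Ends.seq {c₁ c₂ : Cmd ι} {s : State ι} {K₁ K₂ : ℕ} {Q R : State ι → Prop}
    (h₁ : Ends c₁ s K₁ R) (h₂ : ∀ s', R s' → Ends c₂ s' K₂ Q) :
    Ends (.seq c₁ c₂) s (K₁ + K₂) Q := by
  obtain ⟨t, ht, s', h1, h2⟩ := h₁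
  obtain ⟨t', ht', s'', h3, h4⟩ := h₂ s' h2
  exact ⟨_, Nat.add_le_add ht ht', s'', .seq h1 h3, h4⟩

theorem Ends.ifz {e : Expr ι} {c₁ c₂ : Cmd ι} {s : State ι} {K : ℕ} {Q : State ι → Prop}
    (h₁ : e.eval s.val = 0 → Ends c₁ s K Q) (h₂ : e.eval s.val ≠ 0 → Ends c₂ s K Q) :
    Ends (.ifz e c₁ c₂) s (e.size + (K + 2)) Q := by
  by_cases he : e.eval s.val = 0
  · obtain ⟨t, ht, s', h1, h2⟩ := h₁ he
    exact ⟨_, by omega, s', .ifz_true he h1, h2⟩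
  · obtain ⟨t, ht, s', h1, h2⟩ := h₂ he
    exact ⟨_, by omega, s', .ifz_false he h1, h2⟩

theorem Ends.ifpos {e : Expr ι} {c₁ c₂ : Cmd ι} {s : State ι} {K : ℕ} {Q : State ι → Prop}
    (h₁ : 0 < e.eval s.val → Ends c₁ s K Q) (h₂ : ¬ 0 < e.eval s.val → Ends c₂ s K Q) :
    Ends (.ifpos e c₁ c₂) s (e.size + (K + 2)) Q := by
  by_cases he : 0 < e.eval s.val
  · obtain ⟨t, ht, s', h1, h2⟩ := h₁ he
    exact ⟨_, by omega, s', .ifpos_true he h1, h2⟩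
  · obtain ⟨t, ht, s', h1, h2⟩ := h₂ he
    exact ⟨_, by omega, s', .ifpos_false he h1, h2⟩

/-- A loop with the invariant `I` and the variant `n`. -/
theorem Ends.loop {e : Expr ι} {c : Cmd ι} {K : ℕ} {Q : State ι → Prop}
    (I : ℕ → State ι → Prop) (h₁ : ∀ n s, I n s → e.eval s.val = 0 → Q s)
    (h₂ : ∀ n s, I n s → e.eval s.val ≠ 0 → Ends c s K fun s' => ∃ k < n, I k s') (n : ℕ)
    (s : State ι) (h : I n s) : Ends (.loop e c) s ((n + 1) * (e.size + (K + 2))) Q := by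
  induction n using Nat.strong_induction_on generalizing s with
  | _ n ih =>
  by_cases he : e.eval s.val = 0
  · exact ⟨e.size + 1, by rw [Nat.succ_mul]; omega, s, .loop_done he, h₁ n s h he⟩
  · obtain ⟨t, ht, s', h3, k, hk, h4⟩ := h₂ n s h he
    obtain ⟨t', ht', s'', h5, h6⟩ := ih k hk s' h4
    refine ⟨_, ?_, s'', .loop_step he h3 h5, h6⟩
    have : (k + 1) * (e.size + (K + 2)) ≤ n * (e.size + (K + 2)) := Nat.mul_le_mul_right _ hk
    rw [Nat.succ_mul]
    omega

/-- The concatenation of a list of programs. -/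
def Cmd.seqs (l : List (Cmd ι)) : Cmd ι := l.foldr Cmd.seq Cmd.skip

/-- A sequence of programs, with an invariant that depends on the programs that remain. -/
theorem Ends.seqs {α : Type*} {f : α → Cmd ι} {K : α → ℕ} {I : List α → State ι → Prop}
    (l : List α) (h : ∀ a l' s, (a :: l') <:+ l → I (a :: l') s → Ends (f a) s (K a) (I l'))
    {s : State ι} (hs : I l s) : Ends (Cmd.seqs (l.map f)) s (l.map K).sum (I []) := by
  induction l generalizing s with
  | nil => exact (Ends.skip hs).mono (by simp) fun _ h => h
  | cons a l ih =>
    have h1 := h a l s List.suffix_rfl hs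
    refine (h1.seq fun s' hs' => ih (fun b l' s hb => h b l' s (hb.trans (List.suffix_cons a l)))
      hs').mono (by simp) fun _ h => h

/-! ### Programs without loops -/

/-- The effect of a program without loops. -/
def Cmd.run : Cmd ι → State ι → State ι
  | skip, s => s
  | assign v e, s => s.set v (e.eval s.val)
  | read v, s => ⟨Function.update s.val v (s.inp.headD 0), s.inp.tail⟩
  | seq c₁ c₂, s => c₂.run (c₁.run s)
  | ifz e c₁ c₂, s => if e.eval s.val = 0 then c₁.run s else c₂.run s
  | ifpos e c₁ c₂, s => if 0 < e.eval s.val then c₁.run s else c₂.run s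
  | loop _ _, s => s

/-- A bound for the running time of a program without loops. -/
def Cmd.cost : Cmd ι → ℕ
  | skip => 0
  | assign _ e => e.size + 1
  | read _ => 1
  | seq c₁ c₂ => c₁.cost + c₂.cost
  | ifz e c₁ c₂ => e.size + (max c₁.cost c₂.cost + 2)
  | ifpos e c₁ c₂ => e.size + (max c₁.cost c₂.cost + 2)
  | loop _ _ => 0

/-- The program has no loops. -/
def Cmd.LoopFree : Cmd ι → Prop
  | skip => True
  | assign _ _ => True
  | read _ => True
  | seq c₁ c₂ => c₁.LoopFree ∧ c₂.LoopFree
  | ifz _ c₁ c₂ => c₁.LoopFree ∧ c₂.LoopFree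
  | ifpos _ c₁ c₂ => c₁.LoopFree ∧ c₂.LoopFree
  | loop _ _ => False

theorem Ends.run {c : Cmd ι} (hc : c.LoopFree) (s : State ι) {Q : State ι → Prop}
    (h : Q (c.run s)) : Ends c s c.cost Q := by
  induction c generalizing s Q with
  | skip => exact .skip h
  | assign v e => exact .assign h
  | read v => exact ⟨1, le_rfl, _, .read v s, h⟩
  | seq c₁ c₂ ih₁ ih₂ =>
    refine (ih₁ hc.1 s (Q := fun s' => s' = c₁.run s) rfl).seq ?_
    rintro _ rfl
    exact ih₂ hc.2 _ h
  | ifz e c₁ c₂ ih₁ ih₂ =>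
    refine Ends.ifz (fun he => ?_) fun he => ?_
    · exact (ih₁ hc.1 s (by simpa [Cmd.run, he] using h)).mono (le_max_left _ _) fun _ h => h
    · exact (ih₂ hc.2 s (by simpa [Cmd.run, he] using h)).mono (le_max_right _ _) fun _ h => h
  | ifpos e c₁ c₂ ih₁ ih₂ =>
    refine Ends.ifpos (fun he => ?_) fun he => ?_
    · exact (ih₁ hc.1 s (by simpa [Cmd.run, he] using h)).mono (le_max_left _ _) fun _ h => h
    · exact (ih₂ hc.2 s (by simpa [Cmd.run, he] using h)).mono (le_max_right _ _) fun _ h => h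
  | loop => exact hc.elim

theorem Cmd.loopFree_seqs {l : List (Cmd ι)} (h : ∀ c ∈ l, c.LoopFree) :
    (Cmd.seqs l).LoopFree := by
  induction l with
  | nil => trivial
  | cons c l ih => exact ⟨h c (by simp), ih fun d hd => h d (by simp [hd])⟩

@[simp] theorem Cmd.run_seqs_nil (s : State ι) : (Cmd.seqs []).run s = s := rfl

@[simp] theorem Cmd.run_seqs_cons (c : Cmd ι) (l : List (Cmd ι)) (s : State ι) :
    (Cmd.seqs (c :: l)).run s = (Cmd.seqs l).run (c.run s) := rfl

/-- The complete program: run `c` from the initial configuration and write the variable `v`. -/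
def Cmd.program (idx : ι → ℕ) (c : Cmd ι) (v : ι) : Program :=
  c.compile idx 0 ++ [.write (.reg (2 * idx v + 1))]

theorem Ends.haltsWithin (hidx : Function.Injective idx) {c : Cmd ι} {v : ι} {inp : List ℤ}
    {K : ℕ} {z : ℤ} (h : Ends c ⟨fun _ => 0, inp⟩ K fun s => s.val v = z) :
    HaltsWithin (c.program idx v) inp (K + 1) [z] := by
  obtain ⟨t, ht, s', h1, h2⟩ := h
  have hc : CodeAt (c.program idx v) 0 (c.program idx v) := fun i _ => by rw [Nat.zero_add]
  obtain ⟨h3, h4⟩ := hc.append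
  obtain ⟨m, s1, r1⟩ := h1.steps_compile hidx 0 (fun _ => 0) [] h3 fun _ => rfl
  -- One more step writes the output; then the counter is past the end of the program and the
  -- machine halts.
  refine ⟨t + 1, by omega, ⟨(c.compile idx 0).length + 1, m, s'.inp, [z]⟩, ?_, ?_, rfl⟩
  · refine Steps.trans (s1 : Steps _ t (init inp) _) (steps_one h4.head ?_)
    simp only [exec, Operand.value, Option.map_some, List.nil_append, r1 v, h2, Nat.zero_add]
  · rw [step, List.getElem?_eq_none]
    · rfl
    · simp [Cmd.program]

end Compiler

end RAM

/-! ### Pilings as integers -/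

namespace RAAG

open RAM

/-- The number with the given balanced ternary digits, the first one being the lowest. -/
def code : List ℤ → ℤ
  | [] => 0
  | d :: l => d + 3 * code l

/-- Lists of balanced ternary digits. -/
def IsDigits (l : List ℤ) : Prop := ∀ d ∈ l, d = -1 ∨ d = 0 ∨ d = 1

theorem IsDigits.tail {d : ℤ} {l : List ℤ} (h : IsDigits (d :: l)) : IsDigits l :=
  fun e he => h e (by simp [he])

/-- Adding 1 moves the lowest digit into `{0, 1, 2}`, where the floor of the quotient removes it. -/
theorem fdiv_code {l : List ℤ} (h : IsDigits l) : Int.fdiv (code l + 1) 3 = code l.tail := by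
  rw [Int.fdiv_eq_ediv_of_nonneg _ (by norm_num)]
  cases l with
  | nil => rfl
  | cons d l =>
    have := h d (by simp)
    simp only [code, List.tail_cons]
    omega

theorem code_eq_headD {l : List ℤ} : code l - 3 * code l.tail = l.headD 0 := by
  cases l with
  | nil => rfl
  | cons d l => simp [code]

theorem fdiv_pow (n : ℕ) : Int.fdiv (3 ^ (n + 1)) 3 = 3 ^ n := by
  rw [Int.fdiv_eq_ediv_of_nonneg _ (by norm_num), pow_succ]
  simp

theorem code_append (l l' : List ℤ) : code (l ++ l') = code l + 3 ^ l.length * code l' := by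
  induction l with
  | nil => simp [code]
  | cons d l ih => simp only [List.cons_append, code, ih, List.length_cons, pow_succ]; ring

theorem code_bound {l : List ℤ} (h : IsDigits l) :
    2 * code l + 1 ≤ 3 ^ l.length ∧ -(3 ^ l.length) ≤ 2 * code l - 1 := by
  induction l with
  | nil => simp [code]
  | cons d l ih =>
    obtain ⟨h1, h2⟩ := ih h.tail
    have := h d (by simp)
    simp only [code, List.length_cons, pow_succ]
    constructor <;> omega

/-- The lengths have to be known, because zeros at the end of a list are invisible in its number. -/
theorem code_injective {l l' : List ℤ} (h : IsDigits l) (h' : IsDigits l')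
    (hl : l.length = l'.length) (hc : code l = code l') : l = l' := by
  induction l generalizing l' with
  | nil => exact (List.length_eq_zero_iff.1 hl.symm).symm
  | cons d l ih =>
    cases l' with
    | nil => simp at hl
    | cons d' l' =>
      have h1 := h d (by simp)
      have h2 := h' d' (by simp)
      simp only [code] at hc
      obtain rfl : d = d' := by omega
      rw [ih h.tail h'.tail (by simpa using hl) (by omega)]

/-- The digits before the last one contribute less than half of the last place value `q` in absolute
value. So the last digit is `e` exactly when `e` times the number exceeds `q / 2`, where `3 q` is
the power of 3 on the left. -/
theorem pos_iff_getLast {l : List ℤ} (h : IsDigits l) (hl : l ≠ []) {e : ℤ}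
    (he : e = 1 ∨ e = -1) :
    0 < 6 * (e * code l) - 3 ^ l.length ↔ l.getLast? = some e := by
  obtain ⟨m, d, rfl⟩ : ∃ m d, l = m ++ [d] :=
    ⟨l.dropLast, l.getLast hl, (List.dropLast_append_getLast hl).symm⟩
  obtain ⟨h1, h2⟩ := code_bound (l := m) fun x hx => h x (by simp [hx])
  have hd := h d (by simp)
  rw [code_append]
  simp only [code, List.length_append, List.length_singleton, pow_succ, List.getLast?_append,
    List.getLast?_singleton, Option.some_or, Option.some.injEq]
  have hp : (0 : ℤ) < 3 ^ m.length := by positivity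
  generalize (3 : ℤ) ^ m.length = q at *
  rcases he with rfl | rfl <;> rcases hd with rfl | rfl | rfl <;> simp <;> omega

theorem code_eq_zero_iff {l : List ℤ} (h : IsDigits l) : code l = 0 ↔ ∀ d ∈ l, d = 0 := by
  induction l with
  | nil => simp [code]
  | cons d l ih =>
    have h1 := h d (by simp)
    simp only [code, List.forall_mem_cons]
    rw [← ih h.tail]
    omega

/-- The registers: for `k = false` and `k = true` the pilings `S k` of two words, as numbers, with
the powers `Q k` of 3 that belong to the lengths of the strings; a letter `X` that has been read,
auxiliary registers `T` and `W`, the input length `N`, a counter `M`, and a flag `D`. -/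
inductive Reg (r : ℕ) : Type
  | S (k : Bool) (c : Fin r)
  | Q (k : Bool) (c : Fin r)
  | X
  | T
  | W
  | N
  | M
  | D
  deriving DecidableEq

/-- The addresses of the registers. -/
def Reg.idx {r : ℕ} : Reg r → ℕ
  | S k c => 6 + (4 * c + 2 * k.toNat)
  | Q k c => 6 + (4 * c + 2 * k.toNat + 1)
  | X => 0
  | T => 1
  | W => 2
  | N => 3
  | M => 4
  | D => 5

theorem Reg.idx_injective {r : ℕ} : Function.Injective (Reg.idx (r := r)) := by
  intro v w h
  rcases v with ⟨k, c⟩ | ⟨k, c⟩ | _ | _ | _ | _ | _ | _ <;>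
    rcases w with ⟨k', c'⟩ | ⟨k', c'⟩ | _ | _ | _ | _ | _ | _ <;>
    simp only [Reg.idx] at h <;> first | rfl | omega | skip
  all_goals
    cases k <;> cases k' <;> simp [Fin.ext_iff] at * <;> omega

/-- The registers that may be changed by an operation on the piling `k`. -/
def Reg.Touch {r : ℕ} (k : Bool) : Reg r → Prop
  | S k' _ => k' = k
  | Q k' _ => k' = k
  | T => True
  | W => True
  | D => True
  | _ => False

/-- Only registers that belong to the piling `k` have been changed. -/
def Frame {r : ℕ} (k : Bool) (s s' : State (Reg r)) : Prop :=
  s'.inp = s.inp ∧ ∀ v, ¬ Reg.Touch k v → s'.val v = s.val v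

theorem Frame.refl {r : ℕ} (k : Bool) (s : State (Reg r)) : Frame k s s := ⟨rfl, fun _ _ => rfl⟩

theorem Frame.trans {r : ℕ} {k : Bool} {s s' s'' : State (Reg r)} (h : Frame k s s')
    (h' : Frame k s' s'') : Frame k s s'' :=
  ⟨h'.1.trans h.1, fun v hv => (h'.2 v hv).trans (h.2 v hv)⟩

theorem Frame.set {r : ℕ} {k : Bool} (s : State (Reg r)) {v : Reg r} (hv : Reg.Touch k v)
    (z : ℤ) : Frame k s (s.set v z) :=
  ⟨rfl, fun w hw => Function.update_of_ne (by rintro rfl; exact hw hv) _ _⟩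

section Registers

variable {r : ℕ} (Γ : SimpleGraph (Fin r)) [DecidableRel Γ.Adj] (s : Fin r → Bool)

/-- The registers `S k` and `Q k` hold the piling of the word `w`. -/
def Holds (k : Bool) (w : Word (Fin r)) (σ : State (Reg r)) : Prop :=
  ∀ c, σ.val (.S k c) = code (pile Γ c w) ∧ σ.val (.Q k c) = 3 ^ (pile Γ c w).length

variable {Γ}

theorem isDigits_pile (c : Fin r) (w : Word (Fin r)) : IsDigits (pile Γ c w) := by
  intro d hd
  obtain ⟨x, -, hx⟩ := List.mem_filterMap.1 hd
  unfold bead at hx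
  split_ifs at hx
  · rcases sgn_eq x with h | h <;> simp [h] at hx <;> omega
  · simp at hx; omega

theorem Holds.frame {k k' : Bool} {w : Word (Fin r)} {σ σ' : State (Reg r)}
    (h : Holds Γ k w σ) (hf : Frame k' σ σ') (hk : k ≠ k') : Holds Γ k w σ' := fun c => by
  rw [hf.2 _ (by simpa [Reg.Touch] using hk), hf.2 _ (by simpa [Reg.Touch] using hk)]
  exact h c

theorem Holds.set {k : Bool} {w : Word (Fin r)} {σ : State (Reg r)}
    (h : Holds Γ k w σ) {v : Reg r} (hv : ∀ k c, v ≠ .S k c ∧ v ≠ .Q k c) (z : ℤ) :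
    Holds Γ k w (σ.set v z) := fun c => by
  simp only [State.set]
  rw [Function.update_of_ne (hv k c).1.symm, Function.update_of_ne (hv k c).2.symm]
  exact h c

theorem Holds.of_traceEq {k : Bool} {w w' : Word (Fin r)} {σ : State (Reg r)}
    (h : Holds Γ k w σ) (ht : TraceEq Γ w w') : Holds Γ k w' σ := fun c => by
  rw [← ht c]; exact h c

/-- Simultaneous assignment to all registers of the piling `k`. -/
def setAll (k : Bool) (eS eQ : Fin r → Expr (Reg r)) : Cmd (Reg r) :=
  Cmd.seqs ((List.finRange r).map fun c =>
    .seq (.assign (.S k c) (eS c)) (.assign (.Q k c) (eQ c)))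

theorem loopFree_setAll (k : Bool) (eS eQ : Fin r → Expr (Reg r)) :
    (setAll k eS eQ).LoopFree := by
  apply Cmd.loopFree_seqs
  simp only [List.mem_map]
  rintro _ ⟨c, -, rfl⟩
  exact ⟨trivial, trivial⟩

/-- The assignments are made one after another, but each reads only registers of its own vertex and
`T`, `W`. `S` is assigned before `Q`, so its expression may use `Q` but not conversely. -/
theorem run_setAll (k : Bool) {eS eQ : Fin r → Expr (Reg r)}
    (hS : ∀ c σ σ', σ (.S k c) = σ' (.S k c) → σ (.Q k c) = σ' (.Q k c) → σ .T = σ' .T →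
      σ .W = σ' .W → (eS c).eval σ = (eS c).eval σ')
    (hQ : ∀ c σ σ', σ (.Q k c) = σ' (.Q k c) → (eQ c).eval σ = (eQ c).eval σ')
    (s : State (Reg r)) :
    Frame k s ((setAll k eS eQ).run s) ∧ ∀ c,
      ((setAll k eS eQ).run s).val (.S k c) = (eS c).eval s.val ∧
      ((setAll k eS eQ).run s).val (.Q k c) = (eQ c).eval s.val := by
  have key : ∀ (l : List (Fin r)), l.Nodup → ∀ s : State (Reg r),
      Frame k s ((Cmd.seqs (l.map fun c =>
        .seq (.assign (.S k c) (eS c)) (.assign (.Q k c) (eQ c)))).run s) ∧ ∀ c,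
      ((Cmd.seqs (l.map fun c =>
        .seq (.assign (.S k c) (eS c)) (.assign (.Q k c) (eQ c)))).run s).val (.S k c) =
          (if c ∈ l then (eS c).eval s.val else s.val (.S k c)) ∧
      ((Cmd.seqs (l.map fun c =>
        .seq (.assign (.S k c) (eS c)) (.assign (.Q k c) (eQ c)))).run s).val (.Q k c) =
          (if c ∈ l then (eQ c).eval s.val else s.val (.Q k c)) := by
    intro l hl
    induction l with
    | nil => exact fun s => ⟨.refl k s, by simp⟩
    | cons a l ih =>
      intro s
      obtain ⟨ha, hl⟩ := List.nodup_cons.1 hl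
      rw [List.map_cons, Cmd.run_seqs_cons]
      set s₁ := Cmd.run (.seq (.assign (.S k a) (eS a)) (.assign (.Q k a) (eQ a))) s with hs₁
      have e1 : ∀ c, c ≠ a → s₁.val (.S k c) = s.val (.S k c) ∧
          s₁.val (.Q k c) = s.val (.Q k c) := fun c hc => by
        simp [hs₁, Cmd.run, State.set, hc]
      have e2 : s₁.val (.S k a) = (eS a).eval s.val := by
        simp [hs₁, Cmd.run, State.set]
      have e3 : s₁.val (.Q k a) = (eQ a).eval s.val := by
        simp only [hs₁, Cmd.run, State.set, Function.update_self]
        exact hQ a _ _ (by simp)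
      have e4 : s₁.val .T = s.val .T ∧ s₁.val .W = s.val .W := by
        simp [hs₁, Cmd.run, State.set]
      have e5 : Frame k s s₁ :=
        (Frame.set s (v := .S k a) rfl _).trans (Frame.set _ (v := .Q k a) rfl _)
      obtain ⟨h1, h2⟩ := ih hl s₁
      refine ⟨e5.trans h1, fun c => ?_⟩
      rw [(h2 c).1, (h2 c).2]
      by_cases hca : c = a
      · subst hca
        simp [ha, e2, e3]
      · by_cases hcl : c ∈ l
        · simp only [hcl, if_true, List.mem_cons, or_true]
          exact ⟨hS c _ _ (e1 c hca).1 (e1 c hca).2 e4.1 e4.2, hQ c _ _ (e1 c hca).2⟩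
        · simpa [hcl, hca] using e1 c hca
  obtain ⟨h1, h2⟩ := key _ (List.nodup_finRange r) s
  exact ⟨h1, fun c => by simpa [setAll] using h2 c⟩

/-- `T` becomes the top bead of the string of `b`. -/
def lowDigit (k : Bool) (b : Fin r) : Cmd (Reg r) :=
  .assign .T (.sub (.var (.S k b)) (.mul (.lit 3) (.third (.add (.var (.S k b)) (.lit 1)))))

theorem run_lowDigit {k : Bool} {b : Fin r} {w : Word (Fin r)} {σ : State (Reg r)}
    (h : Holds Γ k w σ) : (lowDigit k b).run σ = σ.set .T ((pile Γ b w).headD 0) := by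
  simp only [lowDigit, Cmd.run, Expr.eval, (h b).1, fdiv_code (isDigits_pile b w), code_eq_headD]

/-! ### Pushing a letter -/

variable (Γ)

/-- The top letter of `b` is removed. -/
def popTop (k : Bool) (b : Fin r) : Cmd (Reg r) :=
  setAll k
    (fun c => if Γ.Adj b c then .var (.S k c) else .third (.add (.var (.S k c)) (.lit 1)))
    (fun c => if Γ.Adj b c then .var (.Q k c) else .third (.var (.Q k c)))

/-- The letter `x` is put on top. -/
def pushTop (k : Bool) (x : Fin r × Bool) : Cmd (Reg r) :=
  setAll k
    (fun c => if Γ.Adj x.1 c then .var (.S k c)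
      else .add (.lit (if x.1 = c then sgn x else 0)) (.mul (.lit 3) (.var (.S k c))))
    (fun c => if Γ.Adj x.1 c then .var (.Q k c) else .mul (.var (.Q k c)) (.lit 3))

/-- The letter `x` is put on top, or is cancelled. -/
def pushLetter (k : Bool) (x : Fin r × Bool) : Cmd (Reg r) :=
  .seq (lowDigit k x.1) (.ifz (.add (.var .T) (.lit (sgn x))) (popTop Γ k x.1) (pushTop Γ k x))

theorem loopFree_pushLetter (k : Bool) (x : Fin r × Bool) : (pushLetter Γ k x).LoopFree :=
  ⟨trivial, loopFree_setAll _ _ _, loopFree_setAll _ _ _⟩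

variable {Γ}

theorem run_popTop {k : Bool} {x : Fin r × Bool} {w : Word (Fin r)} {σ : State (Reg r)}
    (h : Holds Γ k (x :: w) σ) :
    Frame k σ ((popTop Γ k x.1).run σ) ∧ Holds Γ k w ((popTop Γ k x.1).run σ) := by
  obtain ⟨h1, h2⟩ := run_setAll k (s := σ)
    (eS := fun c => if Γ.Adj x.1 c then .var (.S k c)
      else .third (.add (.var (.S k c)) (.lit 1)))
    (eQ := fun c => if Γ.Adj x.1 c then .var (.Q k c) else .third (.var (.Q k c)))
    (fun c σ σ' e1 e2 e3 e4 => by split_ifs <;> simp [Expr.eval, e1])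
    (fun c σ σ' e1 => by split_ifs <;> simp [Expr.eval, e1])
  refine ⟨h1, fun c => ?_⟩
  obtain ⟨h3, h4⟩ := h2 c
  rw [popTop, h3, h4]
  by_cases ha : Γ.Adj x.1 c
  · have := h c
    rw [pile_cons_of_adj ha] at this
    simpa [ha, Expr.eval] using this
  · obtain ⟨d, hd⟩ : ∃ d, pile Γ c (x :: w) = d :: pile Γ c w := by
      by_cases hc : x.1 = c
      · subst hc; exact ⟨_, pile_cons_self x w⟩
      · exact ⟨_, pile_cons_of_ne hc ha w⟩
    simp only [ha, if_false, Expr.eval, (h c).1, (h c).2, fdiv_code (isDigits_pile c _)]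
    rw [hd, List.tail_cons, List.length_cons, fdiv_pow]
    exact ⟨rfl, rfl⟩

theorem run_pushTop {k : Bool} {x : Fin r × Bool} {w : Word (Fin r)} {σ : State (Reg r)}
    (h : Holds Γ k w σ) :
    Frame k σ ((pushTop Γ k x).run σ) ∧ Holds Γ k (x :: w) ((pushTop Γ k x).run σ) := by
  obtain ⟨h1, h2⟩ := run_setAll k (s := σ)
    (eS := fun c => if Γ.Adj x.1 c then .var (.S k c)
      else .add (.lit (if x.1 = c then sgn x else 0)) (.mul (.lit 3) (.var (.S k c))))
    (eQ := fun c => if Γ.Adj x.1 c then .var (.Q k c) else .mul (.var (.Q k c)) (.lit 3))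
    (fun c σ σ' e1 e2 e3 e4 => by split_ifs <;> simp [Expr.eval, e1])
    (fun c σ σ' e1 => by split_ifs <;> simp [Expr.eval, e1])
  refine ⟨h1, fun c => ?_⟩
  obtain ⟨h3, h4⟩ := h2 c
  rw [pushTop, h3, h4]
  by_cases ha : Γ.Adj x.1 c
  · have := h c
    rw [pile_cons_of_adj ha]
    simpa [ha, Expr.eval] using this
  · by_cases hc : x.1 = c
    · subst hc
      rw [pile_cons_self]
      simp [Expr.eval, (h x.1).1, (h x.1).2, code, pow_succ]
    · rw [pile_cons_of_ne hc ha]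
      simp [Expr.eval, ha, hc, (h c).1, (h c).2, code, pow_succ]

/-- The counterpart of `pushPile_word` on the machine. -/
theorem run_pushLetter {k : Bool} {x : Fin r × Bool} {w : Word (Fin r)} {σ : State (Reg r)}
    (h : Holds Γ k w σ) (hw : Red Γ w) :
    Frame k σ ((pushLetter Γ k x).run σ) ∧ ∃ w', Holds Γ k w' ((pushLetter Γ k x).run σ) ∧
      Red Γ w' ∧ eval Γ w' = eval Γ [x] * eval Γ w ∧ List.length w' ≤ List.length w + 1 := by
  simp only [pushLetter, Cmd.run, run_lowDigit h, Expr.eval]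
  have h1 : Holds Γ k w (σ.set .T ((pile Γ x.1 w).headD 0)) := h.set (by simp) _
  have hf : Frame k σ (σ.set .T ((pile Γ x.1 w).headD 0)) := Frame.set σ (v := .T) trivial _
  have hT : (σ.set .T ((pile Γ x.1 w).headD 0)).val .T = (pile Γ x.1 w).headD 0 := by
    simp [State.set]
  rw [hT]
  have hx := sgn_ne_zero x
  split_ifs with hc
  · have h2 : (pile Γ x.1 w).head? = some (-sgn x) := by
      rw [head?_of_headD (by omega)]
      congr 1
      omega
    obtain ⟨w', h'⟩ := exists_traceEq_inv_cons h2
    obtain ⟨h3, h4⟩ := run_popTop (h1.of_traceEq h')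
    refine ⟨hf.trans h3, w', h4, (h'.symm.red hw).1, ?_, ?_⟩
    · rw [h'.eval_eq, eval_cons Γ (invLetter x), eval_invLetter, mul_inv_cancel_left]
    · have := h'.length_eq
      rw [List.length_cons] at this
      omega
  · obtain ⟨h3, h4⟩ := run_pushTop (x := x) h1
    refine ⟨hf.trans h3, x :: w, h4, ⟨hw, fun h2 => hc ?_⟩, eval_cons Γ x w, le_rfl⟩
    rw [List.headD_eq_head?_getD, h2]
    simp

end Registers

end RAAG

/-! ### Cyclic reduction on the machine -/

namespace RAAG

open RAM

theorem twistedConj_refl {G : Type*} [Group G] (φ : MulAut G) (u : G) : TwistedConj φ u u :=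
  ⟨1, by simp⟩

theorem _root_.TwistedConj.symm {G : Type*} [Group G] {φ : MulAut G} {u v : G}
    (h : TwistedConj φ u v) : TwistedConj φ v u := by
  obtain ⟨w, rfl⟩ := h
  exact ⟨w⁻¹, by rw [map_inv]; group⟩

theorem _root_.TwistedConj.trans {G : Type*} [Group G] {φ : MulAut G} {u v w : G}
    (h : TwistedConj φ u v) (h' : TwistedConj φ v w) : TwistedConj φ u w := by
  obtain ⟨g, rfl⟩ := h
  obtain ⟨g', rfl⟩ := h'
  exact ⟨g * g', by rw [map_mul]; group⟩

section Cyclic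

variable {r : ℕ} (Γ : SimpleGraph (Fin r)) [DecidableRel Γ.Adj] (s : Fin r → Bool)

/-- No cancellation of letters of `b` across the ends of the word. -/
def CycRedAt (u : Word (Fin r)) (b : Fin r) : Prop :=
  ∀ t, t ≠ 0 → (pile Γ b u).head? = some t →
    (pile Γ b u).getLast? = some (-(flipSign s b * t)) → (pile Γ b u).length = 1

/-- The first and the last letter of `b` are removed; `W` holds the sign of the last one. -/
def cycPop (k : Bool) (b : Fin r) : Cmd (Reg r) :=
  setAll k
    (fun c => if Γ.Adj b c then .var (.S k c)
      else .sub (.third (.add (.var (.S k c)) (.lit 1)))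
        (.mul (.mul (.lit (if b = c then 1 else 0)) (.var .W)) (.third (.third (.var (.Q k c))))))
    (fun c => if Γ.Adj b c then .var (.Q k c) else .third (.third (.var (.Q k c))))

/-- A cancellation of letters of `b` across the ends of the word, if there is one. -/
def cycStep (k : Bool) (b : Fin r) : Cmd (Reg r) :=
  .seq (lowDigit k b) <| .ifz (.var .T) .skip <|
    .seq (.assign .W (.mul (.lit (-flipSign s b)) (.var .T))) <|
    .ifpos (.sub (.mul (.lit 6) (.mul (.var .W) (.var (.S k b)))) (.var (.Q k b)))
      (.ifz (.sub (.var (.Q k b)) (.lit 3)) .skip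
        (.seq (cycPop Γ k b) (.assign .D (.lit 1))))
      .skip

/-- One cancellation attempt for every vertex. -/
def cycPass (k : Bool) : Cmd (Reg r) :=
  .seq (.assign .D (.lit 0)) (Cmd.seqs ((List.finRange r).map (cycStep Γ s k)))

theorem loopFree_cycPass (k : Bool) : (cycPass Γ s k).LoopFree := by
  refine ⟨trivial, Cmd.loopFree_seqs ?_⟩
  simp only [List.mem_map]
  rintro _ ⟨b, -, rfl⟩
  exact ⟨trivial, trivial, trivial, ⟨trivial, loopFree_setAll _ _ _, trivial⟩, trivial⟩

variable {Γ s}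

/-- On a string that does not commute with `y`, the division removes the first bead. `Q` then
exceeds the place value of the last bead by the factor 9; that bead is `W` on the string of `y` and
`0` on the others. -/
theorem run_cycPop {k : Bool} {y z : Fin r × Bool} (hyz : y.1 = z.1) {m : Word (Fin r)}
    {σ : State (Reg r)} (h : Holds Γ k (y :: (m ++ [z])) σ) (hW : σ.val .W = sgn z) :
    Frame k σ ((cycPop Γ k y.1).run σ) ∧ Holds Γ k m ((cycPop Γ k y.1).run σ) := by
  obtain ⟨h1, h2⟩ := run_setAll k (s := σ)
    (eS := fun c => if Γ.Adj y.1 c then .var (.S k c)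
      else .sub (.third (.add (.var (.S k c)) (.lit 1)))
        (.mul (.mul (.lit (if y.1 = c then 1 else 0)) (.var .W))
          (.third (.third (.var (.Q k c))))))
    (eQ := fun c => if Γ.Adj y.1 c then .var (.Q k c) else .third (.third (.var (.Q k c))))
    (fun c σ σ' e1 e2 e3 e4 => by split_ifs <;> simp [Expr.eval, e1, e2, e4])
    (fun c σ σ' e1 => by split_ifs <;> simp [Expr.eval, e1])
  refine ⟨h1, fun c => ?_⟩
  obtain ⟨h3, h4⟩ := h2 c
  rw [cycPop, h3, h4]
  by_cases ha : Γ.Adj y.1 c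
  · have := h c
    rw [pile_cons_of_adj ha, pile_append, pile_cons_of_adj (hyz ▸ ha)] at this
    simpa [ha, Expr.eval] using this
  · have e : ∃ d, pile Γ c (y :: (m ++ [z])) =
        d :: (pile Γ c m ++ [if y.1 = c then sgn z else 0]) := by
      by_cases hc : y.1 = c
      · have hc' := hyz.symm.trans hc
        subst hc
        refine ⟨sgn y, ?_⟩
        rw [pile_cons_self, pile_append]
        simp only [if_true]
        rw [hyz, pile_cons_self]
        rfl
      · refine ⟨0, ?_⟩
        rw [pile_cons_of_ne hc ha, pile_append,
          pile_cons_of_ne (hyz ▸ hc) (hyz ▸ ha)]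
        simp [hc]
    obtain ⟨d, hd⟩ := e
    simp only [ha, if_false, Expr.eval, (h c).1, (h c).2, fdiv_code (isDigits_pile c _), hW]
    rw [hd, List.tail_cons, List.length_cons, fdiv_pow, List.length_append,
      List.length_singleton, fdiv_pow, code_append]
    refine ⟨?_, rfl⟩
    simp only [code]
    split_ifs <;> ring

theorem exists_concat_of_getLast {b : Fin r} {w : Word (Fin r)} {e : ℤ} (he : e ≠ 0)
    (h : (pile Γ b w).getLast? = some e) :
    ∃ m z, z.1 = b ∧ sgn z = e ∧ TraceEq Γ w (m ++ [z]) := by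
  have h1 : (pile Γ b w.reverse).headD 0 = e := by
    rw [pile_reverse, List.headD_eq_head?_getD, List.head?_reverse, h]
    rfl
  obtain ⟨z, m, h2, h3, h4⟩ := exists_cons_of_headD (b := b) (w := w.reverse) (by rwa [h1])
  refine ⟨m.reverse, z, h2, h3.trans h1, ?_⟩
  simpa using h4.reverse

theorem Red.inner {y z : Fin r × Bool} {m : Word (Fin r)} (h : Red Γ (y :: (m ++ [z]))) :
    Red Γ m := by
  have h1 := h.1.length_eq
  have h2 := length_mul_le (eval Γ m) (eval Γ [z])
  have h3 := length_le (Γ := Γ) m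
  rw [red_iff_length]
  rw [length_letter, ← eval_append, h1] at h2
  simp at h2
  omega

/-- The condition says that `z` is the inverse of `φ(y)`, so conjugation by `φ(y)` removes both `y`,
as `φ` is an involution, and `z`. -/
theorem twistedConj_inner {φ : MulAut (RAAG Γ)}
    (hs : ∀ x, φ (eval Γ [x]) = eval Γ [flipLetter s x]) {y z : Fin r × Bool} (hyz : y.1 = z.1)
    (h : sgn z = -(flipSign s y.1 * sgn y)) (m : Word (Fin r)) :
    TwistedConj φ (eval Γ (y :: (m ++ [z]))) (eval Γ m) := by
  obtain rfl : z = invLetter (flipLetter s y) := letter_ext hyz.symm (by simp [h])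
  refine ⟨eval Γ [flipLetter s y], ?_⟩
  rw [hs, flipLetter_flipLetter, eval_cons Γ y (m ++ _), eval_append, eval_invLetter]
  group

theorem run_cycStep {φ : MulAut (RAAG Γ)}
    (hs : ∀ x, φ (eval Γ [x]) = eval Γ [flipLetter s x]) {k : Bool} (b : Fin r)
    {w : Word (Fin r)} {σ : State (Reg r)} (h : Holds Γ k w σ) (hw : Red Γ w) :
    Frame k σ ((cycStep Γ s k b).run σ) ∧ ∃ w', Holds Γ k w' ((cycStep Γ s k b).run σ) ∧
      Red Γ w' ∧ TwistedConj φ (eval Γ w) (eval Γ w') ∧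
      ((((cycStep Γ s k b).run σ).val .D = σ.val .D ∧ w' = w ∧ CycRedAt Γ s w b) ∨
        (((cycStep Γ s k b).run σ).val .D = 1 ∧ List.length w' < List.length w)) := by
  set t := (pile Γ b w).headD 0 with ht
  set σ₁ := σ.set .T t with hσ₁
  set σ₂ := σ₁.set .W (-flipSign s b * t) with hσ₂
  have f1 : Frame k σ σ₁ := Frame.set σ (v := .T) trivial _
  have f2 : Frame k σ σ₂ := f1.trans (Frame.set σ₁ (v := .W) trivial _)
  have h1 : Holds Γ k w σ₁ := h.set (by simp) _
  have h2 : Holds Γ k w σ₂ := h1.set (by simp) _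
  have d1 : σ₁.val .D = σ.val .D := by simp [hσ₁, State.set]
  have d2 : σ₂.val .D = σ.val .D := by simp [hσ₂, hσ₁, State.set]
  have hT : σ₁.val .T = t := by simp [hσ₁, State.set]
  have hW : σ₂.val .W = -flipSign s b * t := by simp [hσ₂, State.set]
  have hσ : (Cmd.assign Reg.W (.mul (.lit (-flipSign s b)) (.var .T))).run σ₁ = σ₂ := by
    simp only [Cmd.run, Expr.eval, hT, hσ₂]
  simp only [cycStep]
  rw [Cmd.run, run_lowDigit h, ← ht, ← hσ₁, Cmd.run]
  simp only [Expr.eval, hT]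
  split_ifs with h0
  · refine ⟨f1, w, h1, hw, twistedConj_refl _ _, Or.inl ⟨d1, rfl, fun t' ht' h3 => ?_⟩⟩
    rw [ht, List.headD_eq_head?_getD, h3] at h0
    exact absurd h0 ht'
  have hhead : (pile Γ b w).head? = some t := head?_of_headD h0
  obtain ⟨y, m, hyb, hyt, hym⟩ := exists_cons_of_headD (Γ := Γ) (b := b) (w := w) h0
  rw [← ht] at hyt
  have hne : pile Γ b w ≠ [] := by
    intro hn; simp [hn] at hhead
  have hσb : flipSign s b = 1 ∨ flipSign s b = -1 := by
    unfold flipSign; split_ifs <;> simp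
  have hy1 := sgn_eq y
  have he : -flipSign s b * t = 1 ∨ -flipSign s b * t = -1 := by
    rw [← hyt]
    rcases hσb with h3 | h3 <;> rcases hy1 with h4 | h4 <;> simp [h3, h4]
  -- `W` holds the only sign of the last bead that would cancel against the top one; its presence is
  -- tested by comparing sizes.
  have hpos := pos_iff_getLast (isDigits_pile b w) hne he
  rw [Cmd.run, hσ, Cmd.run]
  simp only [Expr.eval, hW, (h2 b).1, (h2 b).2, hpos]
  split_ifs with h3
  · rw [Cmd.run]
    simp only [Expr.eval, (h2 b).2]
    -- `Q = 3` means that there is one bead only, which must not cancel against itself.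
    split_ifs with h4
    · refine ⟨f2, w, h2, hw, twistedConj_refl _ _, Or.inl ⟨d2, rfl, fun _ _ _ _ => ?_⟩⟩
      have : (3 : ℤ) ^ (pile Γ b w).length = 3 ^ 1 := by omega
      exact Int.pow_right_injective (by norm_num) this
    · have e1 : pile Γ b w = t :: pile Γ b m := by
        rw [hym b, ← hyb, pile_cons_self, hyt]
      have hm : pile Γ b m ≠ [] := by
        intro hm
        rw [e1, hm] at h4
        simp at h4
      have e2 : (pile Γ b m).getLast? = some (-flipSign s b * t) := by
        rw [← h3, e1, List.getLast?_cons, List.getLast?_eq_some_getLast hm]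
        rfl
      obtain ⟨m', z, hz1, hz2, hz3⟩ := exists_concat_of_getLast (by
        rcases he with h | h <;> simp [h]) e2
      have hyz : y.1 = z.1 := hyb.trans hz1.symm
      have e3 : TraceEq Γ w (y :: (m' ++ [z])) := hym.trans (hz3.cons y)
      obtain ⟨f3, h5⟩ := run_cycPop hyz (h2.of_traceEq e3) (hW.trans hz2.symm)
      rw [hyb] at f3 h5
      rw [Cmd.run, Cmd.run]
      refine ⟨(f2.trans f3).trans (Frame.set _ (v := .D) trivial _), m', h5.set (by simp) _,
        (e3.red_iff.1 hw).inner, ?_, Or.inr ⟨by simp [State.set, Expr.eval], ?_⟩⟩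
      · rw [e3.eval_eq]
        exact twistedConj_inner hs hyz (by rw [hz2, hyb, hyt]; ring) m'
      · rw [e3.length_eq]
        simp
  · exact ⟨f2, w, h2, hw, twistedConj_refl _ _, Or.inl ⟨d2, rfl, fun t' _ h5 h6 => by
      rw [hhead, Option.some.injEq] at h5
      rw [← h5] at h6
      exact absurd (h6.trans (by simp)) h3⟩⟩

/-- If the flag is still 0 at the end, the word has not changed during the pass, so the negative
tests for all vertices refer to the same word. -/
theorem run_cycPass {φ : MulAut (RAAG Γ)}
    (hs : ∀ x, φ (eval Γ [x]) = eval Γ [flipLetter s x]) {k : Bool}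
    {w : Word (Fin r)} {σ : State (Reg r)} (h : Holds Γ k w σ) (hw : Red Γ w) :
    Frame k σ ((cycPass Γ s k).run σ) ∧ ∃ w', Holds Γ k w' ((cycPass Γ s k).run σ) ∧
      Red Γ w' ∧ TwistedConj φ (eval Γ w) (eval Γ w') ∧
      ((((cycPass Γ s k).run σ).val .D = 0 ∧ w' = w ∧ CycRed Γ s w) ∨
        (((cycPass Γ s k).run σ).val .D = 1 ∧ List.length w' < List.length w)) := by
  have key : ∀ (l : List (Fin r)) (w : Word (Fin r)) (σ : State (Reg r)), Holds Γ k w σ →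
      Red Γ w → Frame k σ ((Cmd.seqs (l.map (cycStep Γ s k))).run σ) ∧
      ∃ w', Holds Γ k w' ((Cmd.seqs (l.map (cycStep Γ s k))).run σ) ∧
      Red Γ w' ∧ TwistedConj φ (eval Γ w) (eval Γ w') ∧
      ((((Cmd.seqs (l.map (cycStep Γ s k))).run σ).val .D = σ.val .D ∧ w' = w ∧
          ∀ b ∈ l, CycRedAt Γ s w b) ∨
        (((Cmd.seqs (l.map (cycStep Γ s k))).run σ).val .D = 1 ∧
          List.length w' < List.length w)) := by
    intro l
    induction l with
    | nil =>
      exact fun w σ h hw => ⟨.refl k σ, w, h, hw, twistedConj_refl _ _, Or.inl ⟨rfl, rfl, by simp⟩⟩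
    | cons a l ih =>
      intro w σ h hw
      obtain ⟨f1, w₁, h1, r1, t1, c1⟩ := run_cycStep hs a h hw
      obtain ⟨f2, w₂, h2, r2, t2, c2⟩ := ih w₁ _ h1 r1
      rw [List.map_cons, Cmd.run_seqs_cons]
      refine ⟨f1.trans f2, w₂, h2, r2, t1.trans t2, ?_⟩
      rcases c1 with ⟨d1, rfl, g1⟩ | ⟨d1, l1⟩
      · rcases c2 with ⟨d2, rfl, g2⟩ | ⟨d2, l2⟩
        · exact Or.inl ⟨d2.trans d1, rfl, by simpa using ⟨g1, g2⟩⟩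
        · exact Or.inr ⟨d2, l2⟩
      · rcases c2 with ⟨d2, rfl, g2⟩ | ⟨d2, l2⟩
        · exact Or.inr ⟨d2.trans d1, l1⟩
        · exact Or.inr ⟨d2, l2.trans l1⟩
  obtain ⟨f1, w', h1, r1, t1, c1⟩ := key (List.finRange r) w (σ.set .D 0) (h.set (by simp) _) hw
  refine ⟨(Frame.set σ (v := .D) trivial 0).trans f1, w', h1, r1, t1, ?_⟩
  rcases c1 with ⟨d1, e1, g1⟩ | c1
  · exact Or.inl ⟨d1.trans (by simp [State.set]), e1, hw, fun b => g1 b (by simp)⟩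
  · exact Or.inr c1

variable (Γ s) in
/-- Cyclic reduction. -/
def cycReduce (k : Bool) : Cmd (Reg r) :=
  .seq (.assign .D (.lit 1)) (.loop (.var .D) (cycPass Γ s k))

theorem exists_ends_cycReduce {φ : MulAut (RAAG Γ)}
    (hs : ∀ x, φ (eval Γ [x]) = eval Γ [flipLetter s x]) (k : Bool) :
    ∃ K, ∀ (w : Word (Fin r)) (σ : State (Reg r)) (n : ℕ), Holds Γ k w σ → Red Γ w →
      List.length w ≤ n → Ends (cycReduce Γ s k) σ (K * (n + 1)) fun σ' =>
        Frame k σ σ' ∧ ∃ w', Holds Γ k w' σ' ∧ CycRed Γ s w' ∧ List.length w' ≤ n ∧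
          TwistedConj φ (eval Γ w) (eval Γ w') := by
  -- The loop bound has the factor `|w| + 2`, which is at most `2 (n + 1)`.
  refine ⟨2 * ((cycPass Γ s k).cost + 10), fun w σ n h hw hn => ?_⟩
  have h1 : Ends (.loop (.var .D) (cycPass Γ s k)) (σ.set .D 1)
      ((List.length w + 1 + 1) * ((Expr.var (Reg.D : Reg r)).size + ((cycPass Γ s k).cost + 2)))
      (fun σ' => Frame k σ σ' ∧ ∃ w', Holds Γ k w' σ' ∧ CycRed Γ s w' ∧ List.length w' ≤ n ∧
          TwistedConj φ (eval Γ w) (eval Γ w')) := by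
    -- The variant is the length of the word plus the flag: a pass shortens the word or clears the
    -- flag.
    refine Ends.loop (fun m σ' => Frame k σ σ' ∧ ∃ w', Holds Γ k w' σ' ∧ Red Γ w' ∧
      List.length w' ≤ n ∧ TwistedConj φ (eval Γ w) (eval Γ w') ∧
      ((σ'.val .D = 0 ∧ CycRed Γ s w' ∧ List.length w' ≤ m) ∨
        (σ'.val .D = 1 ∧ List.length w' + 1 ≤ m))) ?_ ?_ _ _ ?_
    · rintro m σ' ⟨f, w', h1, h2, h3, h4, h5⟩ h0
      rcases h5 with ⟨-, h5, -⟩ | ⟨h5, -⟩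
      · exact ⟨f, w', h1, h5, h3, h4⟩
      · simp [Expr.eval, h5] at h0
    · rintro m σ' ⟨f, w', h1, h2, h3, h4, h5⟩ h0
      have h6 : List.length w' + 1 ≤ m := by
        rcases h5 with ⟨h5, -⟩ | ⟨-, h5⟩
        · exact absurd h5 h0
        · exact h5
      refine Ends.run (loopFree_cycPass Γ s k) _ ?_
      obtain ⟨f1, w'', g1, g2, g3, g4⟩ := run_cycPass hs h1 h2
      rcases g4 with ⟨g4, rfl, g5⟩ | ⟨g4, g5⟩
      · exact ⟨List.length w'', by omega, f.trans f1, w'', g1, g2, h3, h4.trans g3,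
          Or.inl ⟨g4, g5, le_rfl⟩⟩
      · exact ⟨List.length w'' + 1, by omega, f.trans f1, w'', g1, g2, by omega, h4.trans g3,
          Or.inr ⟨g4, le_rfl⟩⟩
    · exact ⟨Frame.set σ (v := .D) trivial 1, w, h.set (by simp) _, hw, hn,
        twistedConj_refl _ _, Or.inr ⟨by simp [State.set], le_rfl⟩⟩
  refine (Ends.seq (Ends.assign (Q := fun σ' => σ' = σ.set .D 1) rfl)
    (by rintro _ rfl; exact h1)).mono ?_ fun _ h => h
  simp only [Expr.size]
  nlinarith [Nat.zero_le ((cycPass Γ s k).cost)]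

end Cyclic

end RAAG

/-! ### Rotations, tests and input on the machine -/

namespace RAAG

open RAM

/-- Equality of words up to commutations and rotations. -/
abbrev RotEquiv {V : Type*} (Γ : SimpleGraph V) [DecidableEq V] [DecidableRel Γ.Adj]
    (s : V → Bool) : Word V → Word V → Prop :=
  Relation.EqvGen fun u v => TraceEq Γ u v ∨ RotWord Γ s u v

section RotEquiv

variable {V : Type*} {Γ : SimpleGraph V} [DecidableEq V] [DecidableRel Γ.Adj] {s : V → Bool}

theorem RotEquiv.perm_fst {u v : Word V} (h : RotEquiv Γ s u v) :
    (u.map Prod.fst).Perm (v.map Prod.fst) := by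
  induction h with
  | rel u v h => exact h.elim TraceEq.perm_fst RotWord.perm_fst
  | refl u => exact List.Perm.refl _
  | symm u v _ ih => exact ih.symm
  | trans u v w _ _ ih₁ ih₂ => exact ih₁.trans ih₂

theorem RotEquiv.length_eq {u v : Word V} (h : RotEquiv Γ s u v) : List.length u = List.length v := by
  simpa using h.perm_fst.length_eq

theorem RotEquiv.twistedConj {φ : MulAut (RAAG Γ)}
    (hs : ∀ x, φ (eval Γ [x]) = eval Γ [flipLetter s x]) {u v : Word V}
    (h : RotEquiv Γ s u v) : TwistedConj φ (eval Γ u) (eval Γ v) := by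
  induction h with
  | rel u v h =>
    rcases h with h | h
    · rw [h.eval_eq]; exact twistedConj_refl _ _
    · exact h.twistedConj hs
  | refl u => exact twistedConj_refl _ _
  | symm u v _ ih => exact ih.symm
  | trans u v w _ _ ih₁ ih₂ => exact ih₁.trans ih₂

/-- The string of `c` has one bead for each letter that is not adjacent to `c`, whatever the order
and the signs. -/
theorem length_pile_of_perm {u v : Word V} (h : (u.map Prod.fst).Perm (v.map Prod.fst)) (c : V) :
    (pile Γ c u).length = (pile Γ c v).length := by
  have key : ∀ w : Word V, (pile Γ c w).length =
      (w.map Prod.fst).countP fun b => decide (¬ Γ.Adj b c) := by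
    intro w
    induction w with
    | nil => rfl
    | cons x w ih =>
      rw [pile_cons, List.length_append, ih, List.map_cons, List.countP_cons]
      rcases hb : bead Γ c x with _ | d
      · simp [pile, hb, bead_eq_none.1 hb]
      · have h : ¬ Γ.Adj x.1 c := fun h => by simp [bead_of_adj h] at hb
        simp [pile, hb, h, add_comm]
  rw [key, key, h.countP_eq]

end RotEquiv

section Rotations

variable {r : ℕ} (Γ : SimpleGraph (Fin r)) [DecidableRel Γ.Adj] (s : Fin r → Bool)

/-- The top letter of `b`, whose sign is held by `T`, is moved to the end and flipped. -/
def rotTop (k : Bool) (b : Fin r) : Cmd (Reg r) :=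
  setAll k
    (fun c => if Γ.Adj b c then .var (.S k c)
      else .add (.third (.add (.var (.S k c)) (.lit 1)))
        (.mul (.mul (.lit (if b = c then flipSign s b else 0)) (.var .T))
          (.third (.var (.Q k c)))))
    (fun c => .var (.Q k c))

/-- A rotation of `b`, if there is a letter on top. The flag `D` is set in that case. -/
def tryRot (k : Bool) (b : Fin r) : Cmd (Reg r) :=
  .seq (lowDigit k b) (.ifz (.var .T) .skip (.seq (rotTop Γ s k b) (.assign .D (.lit 1))))

/-- Rotations of the vertices of a list, until the flag `D` is set. -/
def tryList (k : Bool) (L : List (Fin r)) : Cmd (Reg r) :=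
  Cmd.seqs (L.map fun b => .ifz (.var .D) (tryRot Γ s k b) .skip)

theorem loopFree_tryList (k : Bool) (L : List (Fin r)) : (tryList Γ s k L).LoopFree := by
  refine Cmd.loopFree_seqs ?_
  simp only [List.mem_map]
  rintro _ ⟨b, -, rfl⟩
  exact ⟨⟨trivial, trivial, loopFree_setAll _ _ _, trivial⟩, trivial⟩

variable {Γ s}

/-- A rotation keeps the lengths of strings, hence `Q`; one third of `Q` is the place value at the
end, where the flipped bead is added. -/
theorem run_rotTop {k : Bool} {x : Fin r × Bool} {w : Word (Fin r)} {σ : State (Reg r)}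
    (h : Holds Γ k (x :: w) σ) (hT : σ.val .T = sgn x) :
    Frame k σ ((rotTop Γ s k x.1).run σ) ∧
      Holds Γ k (w ++ [flipLetter s x]) ((rotTop Γ s k x.1).run σ) := by
  obtain ⟨h1, h2⟩ := run_setAll k (s := σ)
    (eS := fun c => if Γ.Adj x.1 c then .var (.S k c)
      else .add (.third (.add (.var (.S k c)) (.lit 1)))
        (.mul (.mul (.lit (if x.1 = c then flipSign s x.1 else 0)) (.var .T))
          (.third (.var (.Q k c)))))
    (eQ := fun c => .var (.Q k c))
    (fun c σ σ' e1 e2 e3 e4 => by split_ifs <;> simp [Expr.eval, e1, e2, e3])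
    (fun c σ σ' e1 => by simp [Expr.eval, e1])
  refine ⟨h1, fun c => ?_⟩
  obtain ⟨h3, h4⟩ := h2 c
  rw [rotTop, h3, h4, ← congrFun (rotPile_word x w) c, rotPile]
  by_cases ha : Γ.Adj x.1 c
  · simpa [ha, Expr.eval] using h c
  · obtain ⟨d, e1, e2⟩ : ∃ d, pile Γ c (x :: w) = d :: pile Γ c w ∧
        (if x.1 = c then flipSign s x.1 else 0) * sgn x = flipSign s c * d := by
      by_cases hc : x.1 = c
      · subst hc
        exact ⟨_, pile_cons_self x w, by simp⟩
      · exact ⟨_, pile_cons_of_ne hc ha w, by simp [hc]⟩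
    simp only [ha, if_false, Expr.eval, (h c).1, (h c).2, fdiv_code (isDigits_pile c _), hT, e2]
    rw [e1, List.length_cons, fdiv_pow]
    simp only [rotList, List.tail_cons, code_append, code, List.length_append,
      List.length_singleton]
    exact ⟨by ring, trivial⟩

theorem run_tryRot {k : Bool} {b : Fin r} {w : Word (Fin r)} {σ : State (Reg r)}
    (h : Holds Γ k w σ) (hD : σ.val .D = 0) :
    Frame k σ ((tryRot Γ s k b).run σ) ∧ ∃ w', Holds Γ k w' ((tryRot Γ s k b).run σ) ∧
      RotEquiv Γ s w w' ∧
      (if (pile Γ b w).headD 0 = 0 then ((tryRot Γ s k b).run σ).val .D = 0 ∧ w' = w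
        else ((tryRot Γ s k b).run σ).val .D ≠ 0 ∧
          (fun c => pile Γ c w') = rotPile Γ s b fun c => pile Γ c w) := by
  set t := (pile Γ b w).headD 0 with ht
  set σ₁ := σ.set .T t with hσ₁
  have f1 : Frame k σ σ₁ := Frame.set σ (v := .T) trivial _
  have h1 : Holds Γ k w σ₁ := h.set (by simp) _
  have hT : σ₁.val .T = t := by simp [hσ₁, State.set]
  simp only [tryRot]
  rw [Cmd.run, run_lowDigit h, ← ht, ← hσ₁, Cmd.run]
  simp only [Expr.eval, hT]
  split_ifs with h0
  · exact ⟨f1, w, h1, .refl _, by simp [Cmd.run, hσ₁, State.set, hD], rfl⟩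
  · obtain ⟨x, m, rfl, hx, hm⟩ := exists_cons_of_headD (Γ := Γ) (b := b) (w := w) h0
    obtain ⟨f2, h2⟩ := run_rotTop (s := s) (h1.of_traceEq hm) (hT.trans hx.symm)
    refine ⟨(f1.trans f2).trans (Frame.set _ (v := .D) trivial _), _, h2.set (by simp) _,
      .rel _ _ (Or.inr ⟨x, m, hm, .refl _⟩), ?_, ?_⟩
    · simp [Cmd.run, State.set, Expr.eval]
    · rw [← rotPile_word, show (fun c => pile Γ c w) = _ from funext hm]

theorem run_tryList_of_ne {k : Bool} {L : List (Fin r)} {σ : State (Reg r)}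
    (hD : σ.val .D ≠ 0) : (tryList Γ s k L).run σ = σ := by
  induction L with
  | nil => rfl
  | cons b L ih =>
    rw [tryList, List.map_cons, Cmd.run_seqs_cons, Cmd.run]
    simp only [Expr.eval, hD, if_false, Cmd.run]
    exact ih

/-- The first successful rotation sets the flag and thereby disables the rest of the list, so
exactly one step of the scheduler is made. -/
theorem run_tryList {k : Bool} {L : List (Fin r)} {w : Word (Fin r)} {σ : State (Reg r)}
    (h : Holds Γ k w σ) (hD : σ.val .D = 0) :
    Frame k σ ((tryList Γ s k L).run σ) ∧ ∃ w', Holds Γ k w' ((tryList Γ s k L).run σ) ∧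
      RotEquiv Γ s w w' ∧ (fun c => pile Γ c w') = sched Γ s L fun c => pile Γ c w := by
  induction L generalizing σ with
  | nil => exact ⟨.refl k σ, w, h, .refl _, rfl⟩
  | cons b L ih =>
    obtain ⟨f1, w₁, h1, e1, g1⟩ := run_tryRot (s := s) (b := b) h hD
    rw [tryList, List.map_cons, Cmd.run_seqs_cons, Cmd.run]
    simp only [Expr.eval, hD, if_true]
    by_cases h0 : (pile Γ b w).headD 0 = 0
    · rw [if_pos h0] at g1
      obtain ⟨d1, rfl⟩ := g1
      obtain ⟨f2, w₂, h2, e2, g2⟩ := ih h1 d1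
      refine ⟨f1.trans f2, w₂, h2, e2, ?_⟩
      rw [g2, sched, sched, List.find?_cons_of_neg (by simpa using h0)]
    · rw [if_neg h0] at g1
      rw [← tryList, run_tryList_of_ne g1.1]
      refine ⟨f1, w₁, h1, e1, ?_⟩
      rw [g1.2, sched, List.find?_cons_of_pos (by simpa using h0)]
      rfl

/-! ### Tests -/

/-- The flag `D` becomes 1 if all expressions in `Z` are zero and all in `NZ` are nonzero, and 0
otherwise. -/
def check (Z NZ : List (Expr (Reg r))) : Cmd (Reg r) :=
  .seq (.assign .D (.lit 1)) <| .seq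
    (Cmd.seqs (Z.map fun e => .ifz e .skip (.assign .D (.lit 0))))
    (Cmd.seqs (NZ.map fun e => .ifz e (.assign .D (.lit 0)) .skip))

theorem loopFree_check (Z NZ : List (Expr (Reg r))) : (check Z NZ).LoopFree := by
  refine ⟨trivial, Cmd.loopFree_seqs ?_, Cmd.loopFree_seqs ?_⟩ <;>
  · simp only [List.mem_map]
    rintro _ ⟨b, -, rfl⟩
    exact ⟨trivial, trivial⟩

theorem set_set (σ : State (Reg r)) (v : Reg r) (y z : ℤ) : (σ.set v y).set v z = σ.set v z := by
  simp [State.set]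

open Classical in
theorem run_check {Z NZ : List (Expr (Reg r))} {σ : State (Reg r)}
    (hZ : ∀ e ∈ Z, ∀ z, e.eval (σ.set .D z).val = e.eval σ.val)
    (hNZ : ∀ e ∈ NZ, ∀ z, e.eval (σ.set .D z).val = e.eval σ.val) :
    (check Z NZ).run σ = σ.set .D
      (if (∀ e ∈ Z, e.eval σ.val = 0) ∧ ∀ e ∈ NZ, e.eval σ.val ≠ 0 then 1 else 0) := by
  have key1 : ∀ (l : List (Expr (Reg r))), (∀ e ∈ l, ∀ z, e.eval (σ.set .D z).val = e.eval σ.val) →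
      ∀ z, (Cmd.seqs (l.map fun e => .ifz e .skip (.assign .D (.lit 0)))).run (σ.set .D z) =
        σ.set .D (if ∀ e ∈ l, e.eval σ.val = 0 then z else 0) := by
    intro l hl
    induction l with
    | nil => simp
    | cons e l ih =>
      intro z
      rw [List.map_cons, Cmd.run_seqs_cons, Cmd.run, hl e (by simp)]
      have ih := ih fun e' he' => hl e' (by simp [he'])
      by_cases h0 : e.eval σ.val = 0
      · simp only [h0, if_true, Cmd.run, List.forall_mem_cons, true_and]
        exact ih z
      · simp only [h0, if_false, Cmd.run, List.forall_mem_cons, false_and, set_set, Expr.eval]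
        rw [ih 0]
        simp
  have key2 : ∀ (l : List (Expr (Reg r))), (∀ e ∈ l, ∀ z, e.eval (σ.set .D z).val = e.eval σ.val) →
      ∀ z, (Cmd.seqs (l.map fun e => .ifz e (.assign .D (.lit 0)) .skip)).run (σ.set .D z) =
        σ.set .D (if ∀ e ∈ l, e.eval σ.val ≠ 0 then z else 0) := by
    intro l hl
    induction l with
    | nil => simp
    | cons e l ih =>
      intro z
      rw [List.map_cons, Cmd.run_seqs_cons, Cmd.run, hl e (by simp)]
      have ih := ih fun e' he' => hl e' (by simp [he'])
      by_cases h0 : e.eval σ.val = 0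
      · simp only [h0, if_true, Cmd.run, List.forall_mem_cons, ne_eq, not_true_eq_false,
          false_and, if_false, set_set, Expr.eval]
        exact (ih 0).trans (by simp)
      · simp only [h0, if_false, Cmd.run, List.forall_mem_cons, ne_eq, not_false_eq_true,
          true_and]
        exact ih z
  rw [check, Cmd.run, Cmd.run, Cmd.run, key1 Z hZ, key2 NZ hNZ]
  simp only [Expr.eval]
  congr 1
  split_ifs <;> simp_all

/-! ### Input -/

variable (Γ)

/-- The inverse of the letter held by `X` is put on top. -/
noncomputable def pushInput (k : Bool) : Cmd (Reg r) :=
  Cmd.seqs ((Finset.univ : Finset (Fin r × Bool)).toList.map fun x =>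
    .ifz (.sub (.var .X) (.lit (encodeLetter x))) (pushLetter Γ k (invLetter x)) .skip)

/-- A word is read up to the end mark, and the piling of its inverse is built. -/
noncomputable def readWord (k : Bool) : Cmd (Reg r) :=
  .seq (Cmd.seqs ((List.finRange r).map fun c => .assign (.Q k c) (.lit 1))) <|
  .seq (.read .X) <| .loop (.var .X) <|
    .seq (pushInput Γ k) (.seq (.assign .N (.add (.var .N) (.lit 1))) (.read .X))

theorem loopFree_pushInput (k : Bool) : (pushInput Γ k).LoopFree := by
  refine Cmd.loopFree_seqs ?_
  simp only [List.mem_map]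
  rintro _ ⟨b, -, rfl⟩
  exact ⟨loopFree_pushLetter _ _ _, trivial⟩

variable {Γ}

theorem encodeLetter_injective : Function.Injective (encodeLetter (r := r)) := by
  rintro ⟨a, _ | _⟩ ⟨b, _ | _⟩ h <;> simp [encodeLetter, Fin.ext_iff] at h ⊢ <;> omega

theorem encodeLetter_ne_zero (x : Fin r × Bool) : encodeLetter x ≠ 0 := by
  rcases x with ⟨a, _ | _⟩ <;> simp [encodeLetter] <;> omega

/-- Codes of letters are distinct and pushing does not touch `X`, so only the branch of `x` is
taken. -/
theorem run_pushInput {k : Bool} {x : Fin r × Bool} {w : Word (Fin r)} {σ : State (Reg r)}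
    (h : Holds Γ k w σ) (hw : Red Γ w) (hX : σ.val .X = encodeLetter x) :
    Frame k σ ((pushInput Γ k).run σ) ∧ ∃ w', Holds Γ k w' ((pushInput Γ k).run σ) ∧
      Red Γ w' ∧ eval Γ w' = eval Γ [invLetter x] * eval Γ w ∧
      List.length w' ≤ List.length w + 1 := by
  have key : ∀ l : List (Fin r × Bool), x ∉ l → ∀ σ : State (Reg r),
      σ.val .X = encodeLetter x → (Cmd.seqs (l.map fun x =>
        .ifz (.sub (.var .X) (.lit (encodeLetter x))) (pushLetter Γ k (invLetter x))
          .skip)).run σ = σ := by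
    intro l hl
    induction l with
    | nil => simp
    | cons y l ih =>
      intro σ hσ
      rw [List.map_cons, Cmd.run_seqs_cons, Cmd.run]
      have : encodeLetter x - encodeLetter y ≠ 0 := fun e =>
        hl (by rw [encodeLetter_injective (sub_eq_zero.1 e)]; simp)
      simp only [Expr.eval, hσ, this, if_false, Cmd.run]
      exact ih (fun h => hl (by simp [h])) σ hσ
  obtain ⟨p, q, hpq⟩ := List.append_of_mem (Finset.mem_toList.2 (Finset.mem_univ x))
  have hnd := Finset.nodup_toList (Finset.univ : Finset (Fin r × Bool))
  rw [hpq, List.nodup_append] at hnd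
  obtain ⟨f1, w', h1, h2⟩ := run_pushLetter (x := invLetter x) h hw
  have hrun : (pushInput Γ k).run σ = (pushLetter Γ k (invLetter x)).run σ := by
    have happ : ∀ l l' : List (Cmd (Reg r)), ∀ σ,
        (Cmd.seqs (l ++ l')).run σ = (Cmd.seqs l').run ((Cmd.seqs l).run σ) := by
      intro l l'
      induction l with
      | nil => exact fun _ => rfl
      | cons c l ih => exact fun σ => ih _
    rw [pushInput, hpq, List.map_append, happ, key p _ σ hX, List.map_cons, Cmd.run_seqs_cons,
      Cmd.run]
    · simp only [Expr.eval, hX, sub_self, if_true]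
      refine key q (List.nodup_cons.1 hnd.2.1).1 _ ?_
      rw [f1.2 _ (by simp [Reg.Touch]), hX]
    · exact fun hx => hnd.2.2 x hx x (by simp) rfl
  rw [hrun]
  exact ⟨f1, w', h1, h2⟩

theorem run_initQ {k : Bool} {σ : State (Reg r)}
    (hS : ∀ c, σ.val (.S k c) = 0) :
    Frame k σ ((Cmd.seqs ((List.finRange r).map fun c => .assign (.Q k c) (.lit 1))).run σ) ∧
    Holds Γ k []
      ((Cmd.seqs ((List.finRange r).map fun c => .assign (.Q k c) (.lit 1))).run σ) := by
  have key : ∀ (l : List (Fin r)) (σ : State (Reg r)), (∀ c, σ.val (.S k c) = 0) →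
      Frame k σ ((Cmd.seqs (l.map fun c => .assign (.Q k c) (.lit 1))).run σ) ∧
      (∀ c, ((Cmd.seqs (l.map fun c => .assign (.Q k c) (.lit 1))).run σ).val (.S k c) = 0) ∧
      ∀ c, (c ∈ l ∨ σ.val (.Q k c) = 1) →
        ((Cmd.seqs (l.map fun c => .assign (.Q k c) (.lit 1))).run σ).val (.Q k c) = 1 := by
    intro l
    induction l with
    | nil => exact fun σ h => ⟨.refl k σ, h, by simp⟩
    | cons a l ih =>
      intro σ h
      obtain ⟨h1, h2, h3⟩ := ih (σ.set (.Q k a) 1) (by simpa [State.set] using h)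
      refine ⟨(Frame.set σ (v := .Q k a) rfl 1).trans h1, h2, fun c hc => h3 c ?_⟩
      by_cases hca : c = a
      · exact Or.inr (by simp [State.set, hca])
      · simpa [State.set, hca] using hc
  obtain ⟨h1, h2, h3⟩ := key (List.finRange r) σ hS
  exact ⟨h1, fun c => ⟨by simpa [code] using h2 c, by simpa using h3 c (by simp)⟩⟩

theorem exists_ends_readWord (k : Bool) :
    ∃ K, ∀ (u : Word (Fin r)) (rest : List ℤ) (σ : State (Reg r)),
      σ.inp = u.map encodeLetter ++ 0 :: rest → (∀ c, σ.val (.S k c) = 0) →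
      Ends (readWord Γ k) σ (K * (List.length u + 1)) fun σ' =>
        σ'.inp = rest ∧ σ'.val .N = σ.val .N + List.length u ∧
        (∀ c, σ'.val (.S (!k) c) = σ.val (.S (!k) c) ∧ σ'.val (.Q (!k) c) = σ.val (.Q (!k) c)) ∧
        ∃ w, Holds Γ k w σ' ∧ Red Γ w ∧ eval Γ w = (eval Γ u)⁻¹ ∧
          List.length w ≤ List.length u := by
  let c₀ : Cmd (Reg r) := Cmd.seqs ((List.finRange r).map fun c => .assign (.Q k c) (.lit 1))
  have hc₀ : c₀.LoopFree := by
    refine Cmd.loopFree_seqs ?_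
    simp only [List.mem_map]
    rintro _ ⟨b, -, rfl⟩
    trivial
  let body : Cmd (Reg r) :=
    .seq (pushInput Γ k) (.seq (.assign .N (.add (.var .N) (.lit 1))) (.read .X))
  have hbody : body.LoopFree := ⟨loopFree_pushInput Γ k, trivial, trivial⟩
  refine ⟨c₀.cost + body.cost + 10, fun u rest σ hin hS => ?_⟩
  obtain ⟨f0, g0⟩ := run_initQ (Γ := Γ) hS
  let Q : State (Reg r) → Prop := fun σ' =>
    σ'.inp = rest ∧ σ'.val .N = σ.val .N + List.length u ∧
        (∀ c, σ'.val (.S (!k) c) = σ.val (.S (!k) c) ∧ σ'.val (.Q (!k) c) = σ.val (.Q (!k) c)) ∧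
        ∃ w, Holds Γ k w σ' ∧ Red Γ w ∧ eval Γ w = (eval Γ u)⁻¹ ∧
          List.length w ≤ List.length u
  -- `p` has been processed and `q` lies ahead; the next letter, or the end mark, is already in `X`.
  let I : ℕ → State (Reg r) → Prop := fun n σ' => ∃ p q, u = p ++ q ∧ n = List.length q ∧
    σ'.val .X :: σ'.inp = q.map encodeLetter ++ 0 :: rest ∧
    σ'.val .N = σ.val .N + List.length p ∧
    (∀ c, σ'.val (.S (!k) c) = σ.val (.S (!k) c) ∧ σ'.val (.Q (!k) c) = σ.val (.Q (!k) c)) ∧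
    ∃ w, Holds Γ k w σ' ∧ Red Γ w ∧ eval Γ w = (eval Γ p)⁻¹ ∧ List.length w ≤ List.length p
  have hloop : ∀ n σ', I n σ' →
      Ends (.loop (.var .X) body) σ' ((n + 1) * ((Expr.var (Reg.X : Reg r)).size +
        (body.cost + 2))) Q := by
    refine fun n σ' => Ends.loop I ?_ ?_ n σ'
    · rintro n σ' ⟨p, q, rfl, -, h1, h2, h3, h4⟩ h0
      simp only [Expr.eval] at h0
      cases q with
      | nil =>
        simp only [List.map_nil, List.nil_append, List.cons.injEq] at h1
        rw [List.append_nil] at *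
        refine ⟨h1.2, ?_, h3, ?_⟩
        · simpa using h2
        · simpa using h4
      | cons x q =>
        simp only [List.map_cons, List.cons_append, List.cons.injEq] at h1
        exact absurd (h1.1.symm.trans h0) (encodeLetter_ne_zero x)
    · rintro n σ' ⟨p, q, rfl, rfl, h1, h2, h3, w, h4, h5, h6, h7⟩ h0
      simp only [Expr.eval] at h0
      cases q with
      | nil =>
        simp only [List.map_nil, List.nil_append, List.cons.injEq] at h1
        exact absurd h1.1 h0
      | cons x q =>
        simp only [List.map_cons, List.cons_append, List.cons.injEq] at h1
        refine Ends.run hbody _ ⟨List.length q, by simp, p ++ [x], q, by simp, rfl, ?_⟩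
        obtain ⟨f1, w', g1, g2, g3, g4⟩ := run_pushInput h4 h5 h1.1
        set τ := (pushInput Γ k).run σ' with hτ
        have hrun : body.run σ' = ⟨Function.update (τ.set .N (τ.val .N + 1)).val .X
            (τ.inp.headD 0), τ.inp.tail⟩ := rfl
        have hne : τ.inp = q.map encodeLetter ++ 0 :: rest := f1.1.trans h1.2
        have hcons : τ.inp.headD 0 :: τ.inp.tail = τ.inp := by
          rw [hne]; cases q <;> rfl
        rw [hrun]
        refine ⟨?_, ?_, fun c => ?_, w', fun c => ?_, g2, ?_, ?_⟩
        · simp only [Function.update_self]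
          rw [hcons, hne]
        · simp [State.set, f1.2 .N (by simp [Reg.Touch]), h2, add_assoc]
        · simp only [State.set]
          simp only [ne_eq, reduceCtorEq, not_false_eq_true, Function.update_of_ne]
          rw [f1.2 _ (by simp [Reg.Touch]), f1.2 _ (by simp [Reg.Touch])]
          exact h3 c
        · simpa [State.set] using g1 c
        · rw [g3, h6, eval_append, mul_inv_rev, eval_invLetter]
        · simp; omega
  have h1 : Ends (.seq (.read .X) (.loop (.var .X) body)) (c₀.run σ)
      (1 + (List.length u + 1) * ((Expr.var (Reg.X : Reg r)).size + (body.cost + 2))) Q := by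
    refine Ends.seq (R := I (List.length u)) ⟨1, le_rfl, _, .read _ _, ?_⟩ (hloop _)
    refine ⟨[], u, rfl, rfl, ?_, ?_, fun c => ?_, [], fun c => ?_, trivial, by simp, le_rfl⟩
    · have : (c₀.run σ).inp = u.map encodeLetter ++ 0 :: rest := f0.1.trans hin
      simp only [Function.update_self]
      rw [this]
      cases u <;> rfl
    · simpa using f0.2 .N (by simp [Reg.Touch])
    · simp only [ne_eq, reduceCtorEq, not_false_eq_true, Function.update_of_ne]
      exact ⟨f0.2 _ (by simp [Reg.Touch]), f0.2 _ (by simp [Reg.Touch])⟩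
    · simpa using g0 c
  refine (Ends.seq (Ends.run hc₀ σ (Q := fun σ' => σ' = c₀.run σ) rfl)
    (by rintro _ rfl; exact h1)).mono ?_ fun _ h => h
  simp only [Expr.size]
  nlinarith [Nat.zero_le c₀.cost, Nat.zero_le body.cost, Nat.zero_le (List.length u),
    Nat.zero_le (List.length u * c₀.cost)]

end Rotations

end RAAG

/-! ### Comparison of two words up to rotations -/

namespace RAAG

open RAM

section Compare

variable {r : ℕ} (Γ : SimpleGraph (Fin r)) [DecidableRel Γ.Adj] (s : Fin r → Bool)

/-- The first word is held by the registers `false` and the second one by the registers `true`, up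
to rotations that have led to the words `w` and `w'`. -/
structure Both (n : ℕ) (u v w w' : Word (Fin r)) (σ : State (Reg r)) : Prop where
  bound : σ.val .N = n
  left : Holds Γ false w σ
  right : Holds Γ true w' σ
  equiv_left : RotEquiv Γ s u w
  equiv_right : RotEquiv Γ s v w'

variable {Γ s}

/-- The choice of the vertex to be rotated depends only on strings of `C`. -/
theorem mask_sched {C : Finset (Fin r)} {L : List (Fin r)} (hL : ∀ b ∈ L, b ∈ C)
    (P : Fin r → List ℤ) : mask C (sched Γ s L P) = sched Γ s L (mask C P) := by
  induction L with
  | nil => rfl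
  | cons b L ih =>
    have hb : mask C P b = P b := by simp [mask, hL b (by simp)]
    have ih := ih fun b hb => hL b (by simp [hb])
    unfold sched at ih ⊢
    by_cases h0 : (P b).headD 0 = 0
    · rw [List.find?_cons_of_neg (by simpa using h0),
        List.find?_cons_of_neg (by rw [hb]; simpa using h0), ih]
    · rw [List.find?_cons_of_pos (by simpa using h0),
        List.find?_cons_of_pos (by rw [hb]; simpa using h0)]
      exact mask_rotPile C b P

theorem sched_of_adj {c : Fin r} {L : List (Fin r)} (hL : ∀ b ∈ L, Γ.Adj b c)
    (P : Fin r → List ℤ) : sched Γ s L P c = P c := by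
  unfold sched
  cases h : L.find? fun b => decide ((P b).headD 0 ≠ 0) with
  | none => rfl
  | some b => simp [rotPile, hL b (List.mem_of_find?_eq_some h)]

theorem pile_zero_iff {c : Fin r} {w : Word (Fin r)} :
    (∀ d ∈ pile Γ c w, d = 0) ↔ c ∉ w.map Prod.fst := by
  induction w with
  | nil => simp
  | cons x w ih =>
    rw [pile_cons, List.forall_mem_append, ih, List.map_cons, List.mem_cons, not_or]
    refine and_congr_left fun _ => ?_
    by_cases hc : x.1 = c
    · subst hc
      simp [pile_cons_self, sgn_ne_zero]
    · by_cases ha : Γ.Adj x.1 c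
      · simp [pile_cons_of_adj ha, Ne.symm hc]
      · simp [pile_cons_of_ne hc ha, Ne.symm hc]

theorem Holds.eq_zero_iff {k : Bool} {w : Word (Fin r)} {σ : State (Reg r)}
    (h : Holds Γ k w σ) (c : Fin r) : σ.val (.S k c) = 0 ↔ c ∉ w.map Prod.fst := by
  rw [(h c).1, code_eq_zero_iff (isDigits_pile c w), pile_zero_iff]

/-- Rotations preserve the vertices of a word, so corresponding strings have equal lengths and are
determined by their numbers. -/
theorem Both.eq_iff {n : ℕ} {u v w w' : Word (Fin r)} {σ : State (Reg r)}
    (h : Both Γ s n u v w w' σ) (huv : RotEquiv Γ s u v) (c : Fin r) :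
    σ.val (.S false c) = σ.val (.S true c) ↔ pile Γ c w = pile Γ c w' := by
  rw [(h.left c).1, (h.right c).1]
  refine ⟨code_injective (isDigits_pile c w) (isDigits_pile c w') ?_, fun e => by rw [e]⟩
  exact length_pile_of_perm ((h.equiv_left.perm_fst.symm.trans huv.perm_fst).trans
    h.equiv_right.perm_fst) c

theorem Both.set {n : ℕ} {u v w w' : Word (Fin r)} {σ : State (Reg r)}
    (h : Both Γ s n u v w w' σ) {x : Reg r} (hx : x = .M ∨ x = .D) (z : ℤ) :
    Both Γ s n u v w w' (σ.set x z) := by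
  refine ⟨?_, h.left.set ?_ _, h.right.set ?_ _, h.equiv_left, h.equiv_right⟩
  · have := h.bound
    rcases hx with rfl | rfl <;> simpa [State.set] using this
  · rcases hx with rfl | rfl <;> simp
  · rcases hx with rfl | rfl <;> simp

variable (Γ s)

/-- The test whether `C` lies in the support of the first word and commutes with the rest. -/
noncomputable def checkClosed (C : Finset (Fin r)) : Cmd (Reg r) :=
  check (((Finset.univ : Finset (Fin r)).toList.filter fun e =>
      decide (¬ (e ∈ C ∨ ∀ c ∈ C, Γ.Adj e c))).map fun e => .var (.S false e))
    (C.toList.map fun c => .var (.S false c))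

/-- The test whether both words have the same pilings on `C`. -/
noncomputable def checkEqual (C : Finset (Fin r)) : Cmd (Reg r) :=
  check (C.toList.map fun c => .sub (.var (.S false c)) (.var (.S true c))) []

/-- One rotation of the second word. -/
noncomputable def stepRight (L : List (Fin r)) : Cmd (Reg r) :=
  .seq (.assign .M (.sub (.var .M) (.lit 1)))
    (.seq (.assign .D (.lit 0)) (tryList Γ s true L))

/-- One rotation of the first word, unless the words agree on `C`. -/
noncomputable def stepLeft (C : Finset (Fin r)) (L : List (Fin r)) : Cmd (Reg r) :=
  .seq (.assign .M (.sub (.var .M) (.lit 1))) (.seq (checkEqual C) (tryList Γ s false L))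

/-- The second word is rotated until `a` blocks all other vertices of `C`; then the first word is
rotated until it agrees with the second one on `C`. -/
noncomputable def matchOn (C : Finset (Fin r)) (a : Fin r) : Cmd (Reg r) :=
  .seq (checkClosed Γ C) <| .ifz (.var .D) .skip <|
    .seq (.assign .M (.mul (.lit C.card) (.var .N))) <|
    .seq (.loop (.var .M) (stepRight Γ s (C.erase a).toList)) <|
    .seq (.assign .M (.mul (.lit (C.card + 2)) (.var .N))) <|
    .loop (.var .M) (stepLeft Γ s C ((C.erase a).toList ++ [a]))

variable {Γ s}

-- A string has the number 0 exactly when its vertex does not occur. Rotations preserve the support,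
-- so the test on the current word `w` answers the question for `u`.
open Classical in
theorem Both.run_checkClosed {n : ℕ} {u v w w' : Word (Fin r)} {σ : State (Reg r)}
    (h : Both Γ s n u v w w' σ) (C : Finset (Fin r)) :
    (checkClosed Γ C).run σ = σ.set .D (if IsClosedIn Γ C u then 1 else 0) := by
  rw [checkClosed, run_check]
  · have hmem : ∀ c, c ∈ w.map Prod.fst ↔ c ∈ u.map Prod.fst :=
      fun c => h.equiv_left.perm_fst.symm.mem_iff
    congr 1
    refine if_congr ?_ rfl rfl
    simp only [List.forall_mem_map, List.mem_filter, Finset.mem_toList, Finset.mem_univ,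
      true_and, decide_eq_true_eq, Expr.eval, h.left.eq_zero_iff, hmem, ne_eq, not_not,
      IsClosedIn]
    refine and_congr_left fun _ => ⟨fun h x hx => ?_, fun h b hb hm => ?_⟩
    · by_contra hn
      exact h _ hn (List.mem_map_of_mem hx)
    · obtain ⟨x, hx, rfl⟩ := List.mem_map.1 hm
      exact hb (h x hx)
  · simp only [List.forall_mem_map]
    intro e _ z
    simp [Expr.eval, State.set]
  · simp only [List.forall_mem_map]
    intro e _ z
    simp [Expr.eval, State.set]

open Classical in
theorem Both.run_checkEqual {n : ℕ} {u v w w' : Word (Fin r)} {σ : State (Reg r)}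
    (h : Both Γ s n u v w w' σ) (huv : RotEquiv Γ s u v) (C : Finset (Fin r)) :
    (checkEqual C).run σ =
      σ.set .D (if ∀ c ∈ C, pile Γ c w = pile Γ c w' then 1 else 0) := by
  rw [checkEqual, run_check]
  · congr 1
    refine if_congr ?_ rfl rfl
    simp [Expr.eval, sub_eq_zero, h.eq_iff huv]
  · simp only [List.forall_mem_map]
    intro e _ z
    simp [Expr.eval, State.set]
  · simp

theorem exists_run_checkEqual (C : Finset (Fin r)) (σ : State (Reg r)) :
    ∃ z, (checkEqual C).run σ = σ.set .D z := by
  classical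
  rw [checkEqual, run_check]
  · exact ⟨_, rfl⟩
  · simp only [List.forall_mem_map]
    intro e _ z
    simp [Expr.eval, State.set]
  · simp

theorem loopFree_stepRight (L : List (Fin r)) : (stepRight Γ s L).LoopFree :=
  ⟨trivial, trivial, loopFree_tryList Γ s _ _⟩

theorem loopFree_stepLeft (C : Finset (Fin r)) (L : List (Fin r)) :
    (stepLeft Γ s C L).LoopFree :=
  ⟨trivial, loopFree_check _ _, loopFree_tryList Γ s _ _⟩

theorem Both.run_stepRight {n : ℕ} {u v w w' : Word (Fin r)} {σ : State (Reg r)}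
    (h : Both Γ s n u v w w' σ) (L : List (Fin r)) :
    ((stepRight Γ s L).run σ).val .M = σ.val .M - 1 ∧
    ∃ w₁, Both Γ s n u v w w₁ ((stepRight Γ s L).run σ) ∧
      (fun c => pile Γ c w₁) = sched Γ s L fun c => pile Γ c w' := by
  have h1 := (h.set (Or.inl rfl) (σ.val .M - 1)).set (Or.inr rfl) 0
  obtain ⟨f, w₁, g1, g2, g3⟩ := run_tryList (s := s) (L := L) h1.right (by simp [State.set])
  exact ⟨(f.2 .M (by simp [Reg.Touch])).trans (by simp [State.set]), w₁,
    ⟨(f.2 .N (by simp [Reg.Touch])).trans h1.bound, h1.left.frame f (by simp), g1, h1.equiv_left,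
      h1.equiv_right.trans _ _ _ g2⟩, g3⟩

/-- The result of the equality test is the flag that disables rotations. The first word therefore
stops moving as soon as it agrees with the second one on `C`. -/
theorem Both.run_stepLeft {n : ℕ} {u v w w' : Word (Fin r)} {σ : State (Reg r)}
    (h : Both Γ s n u v w w' σ) (C : Finset (Fin r)) (L : List (Fin r)) :
    ((stepLeft Γ s C L).run σ).val .M = σ.val .M - 1 ∧
    ∃ w₁, Both Γ s n u v w₁ w' ((stepLeft Γ s C L).run σ) ∧
      ((fun c => pile Γ c w₁) = (fun c => pile Γ c w) ∨
        (fun c => pile Γ c w₁) = sched Γ s L fun c => pile Γ c w) ∧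
      (RotEquiv Γ s u v → (∀ c ∈ C, pile Γ c w₁ = pile Γ c w') ∨
        (fun c => pile Γ c w₁) = sched Γ s L (fun c => pile Γ c w) ∧
          ¬ ∀ c ∈ C, pile Γ c w = pile Γ c w') := by
  have h1 := h.set (Or.inl rfl) (σ.val .M - 1)
  obtain ⟨z, hz⟩ := exists_run_checkEqual C (σ.set .M (σ.val .M - 1))
  have h2 := h1.set (Or.inr rfl) z
  have hrun : (stepLeft Γ s C L).run σ =
    (tryList Γ s false L).run ((σ.set .M (σ.val .M - 1)).set .D z) := by rw [← hz]; rfl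
  have hDz : ((σ.set .M (σ.val .M - 1)).set .D z).val .D = z := by simp [State.set]
  have hval : RotEquiv Γ s u v → (z = 0 ↔ ¬ ∀ c ∈ C, pile Γ c w = pile Γ c w') := by
    classical
    intro huv
    have h3 := congrArg (fun τ => State.val τ .D) (hz.symm.trans (h1.run_checkEqual huv C))
    simp only [State.set, Function.update_self] at h3
    rw [h3]
    by_cases h4 : ∀ c ∈ C, pile Γ c w = pile Γ c w'
    · rw [if_pos h4]
      exact iff_of_false one_ne_zero (not_not.2 h4)
    · rw [if_neg h4]
      exact iff_of_true rfl h4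
  rw [hrun]
  by_cases h0 : z = 0
  · obtain ⟨f, w₁, g1, g2, g3⟩ := run_tryList (s := s) (L := L) h2.left (hDz.trans h0)
    exact ⟨(f.2 .M (by simp [Reg.Touch])).trans (by simp [State.set]), w₁,
      ⟨(f.2 .N (by simp [Reg.Touch])).trans h2.bound, g1, h2.right.frame f (by simp),
        h2.equiv_left.trans _ _ _ g2, h2.equiv_right⟩, Or.inr g3,
      fun huv => Or.inr ⟨g3, (hval huv).1 h0⟩⟩
  · rw [run_tryList_of_ne (by rwa [hDz])]
    exact ⟨by simp [State.set], w, h2, Or.inl rfl,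
      fun huv => Or.inl (by have := (hval huv).not.1 h0; rwa [not_not] at this)⟩

theorem Both.ends_loopRight {n : ℕ} {u v w w' : Word (Fin r)} {L : List (Fin r)} {m : ℕ}
    {σ : State (Reg r)} (h : Both Γ s n u v w w' σ) (hM : σ.val .M = m) :
    Ends (.loop (.var .M) (stepRight Γ s L)) σ
      ((m + 1) * (1 + ((stepRight Γ s L).cost + 2))) fun σ' =>
        ∃ w₁, Both Γ s n u v w w₁ σ' ∧
          (fun c => pile Γ c w₁) = (sched Γ s L)^[m] fun c => pile Γ c w' := by
  refine Ends.loop (e := .var .M) (fun m' σ' => σ'.val .M = m' ∧ ∃ w₁, Both Γ s n u v w w₁ σ' ∧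
      (sched Γ s L)^[m'] (fun c => pile Γ c w₁) = (sched Γ s L)^[m] fun c => pile Γ c w')
    ?_ ?_ m σ ⟨hM, w', h, rfl⟩
  · rintro m' σ' ⟨h1, w₁, h2, h3⟩ h0
    simp only [Expr.eval, h1] at h0
    obtain rfl : m' = 0 := by exact_mod_cast h0
    exact ⟨w₁, h2, h3⟩
  · rintro m' σ' ⟨h1, w₁, h2, h3⟩ h0
    simp only [Expr.eval, h1] at h0
    obtain ⟨m', rfl⟩ : ∃ k, m' = k + 1 := Nat.exists_eq_succ_of_ne_zero (by exact_mod_cast h0)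
    refine Ends.run (loopFree_stepRight L) _ ⟨m', by omega, ?_⟩
    obtain ⟨g1, w₂, g2, g3⟩ := h2.run_stepRight L
    refine ⟨by rw [g1, h1]; simp, w₂, g2, ?_⟩
    rw [g3, ← h3, Function.iterate_succ_apply]

theorem mask_congr {C : Finset (Fin r)} {P P' : Fin r → List ℤ} (h : ∀ c ∈ C, P c = P' c) :
    mask C P = mask C P' := by
  funext c
  unfold mask
  split_ifs with hc
  · exact h c hc
  · rfl

theorem eq_of_mask_eq {C : Finset (Fin r)} {P P' : Fin r → List ℤ} (h : mask C P = mask C P')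
    {c : Fin r} (hc : c ∈ C) : P c = P' c := by
  simpa [mask, hc] using congrFun h c

theorem Both.ends_loopLeft {n : ℕ} {u v w w' : Word (Fin r)} {C : Finset (Fin r)}
    {L : List (Fin r)} (hL : ∀ b ∈ L, b ∈ C) {m : ℕ}
    {σ : State (Reg r)} (h : Both Γ s n u v w w' σ) (hM : σ.val .M = m) :
    Ends (.loop (.var .M) (stepLeft Γ s C L)) σ
      ((m + 1) * (1 + ((stepLeft Γ s C L).cost + 2))) fun σ' =>
        ∃ w₁, Both Γ s n u v w₁ w' σ' ∧
          (∀ c, (∀ b ∈ C, Γ.Adj b c) → pile Γ c w₁ = pile Γ c w) ∧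
          (RotEquiv Γ s u v → (∃ i ≤ m, (sched Γ s L)^[i] (mask C fun c => pile Γ c w) =
            mask C fun c => pile Γ c w') → ∀ c ∈ C, pile Γ c w₁ = pile Γ c w') := by
  -- The counter never falls below the number of scheduler steps that are still needed to reach
  -- agreement.
  refine Ends.loop (e := .var .M) (fun m' σ' => σ'.val .M = m' ∧ ∃ w₁, Both Γ s n u v w₁ w' σ' ∧
      (∀ c, (∀ b ∈ C, Γ.Adj b c) → pile Γ c w₁ = pile Γ c w) ∧
      (RotEquiv Γ s u v → (∃ i ≤ m, (sched Γ s L)^[i] (mask C fun c => pile Γ c w) =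
            mask C fun c => pile Γ c w') →
        ∃ i ≤ m', (sched Γ s L)^[i] (mask C fun c => pile Γ c w₁) = mask C fun c => pile Γ c w'))
    ?_ ?_ m σ ⟨hM, w, h, fun _ _ => rfl, fun _ h => h⟩
  · rintro m' σ' ⟨h1, w₁, h2, h3, h4⟩ h0
    simp only [Expr.eval, h1] at h0
    obtain rfl : m' = 0 := by exact_mod_cast h0
    refine ⟨w₁, h2, h3, fun huv hi c hc => ?_⟩
    obtain ⟨i, hi, h5⟩ := h4 huv hi
    obtain rfl : i = 0 := by omega
    exact eq_of_mask_eq h5 hc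
  · rintro m' σ' ⟨h1, w₁, h2, h3, h4⟩ h0
    simp only [Expr.eval, h1] at h0
    obtain ⟨m', rfl⟩ : ∃ k, m' = k + 1 := Nat.exists_eq_succ_of_ne_zero (by exact_mod_cast h0)
    refine Ends.run (loopFree_stepLeft C L) _ ⟨m', by omega, ?_⟩
    obtain ⟨g1, w₂, g2, g3, g4⟩ := h2.run_stepLeft C L
    refine ⟨by rw [g1, h1]; simp, w₂, g2, fun c hc => ?_, fun huv hi => ?_⟩
    · rw [← h3 c hc]
      rcases g3 with g3 | g3
      · exact congrFun g3 c
      · rw [← sched_of_adj (s := s) (L := L) (fun b hb => hc b (hL b hb)) fun c => pile Γ c w₁]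
        exact congrFun g3 c
    · rcases g4 huv with g4 | ⟨g4, g5⟩
      · exact ⟨0, Nat.zero_le _, mask_congr g4⟩
      · obtain ⟨i, hi, h5⟩ := h4 huv hi
        rcases i with _ | i
        · exact absurd (fun c hc => eq_of_mask_eq h5 hc) g5
        · refine ⟨i, by omega, ?_⟩
          rw [g4, mask_sched hL, ← h5, Function.iterate_succ_apply]

theorem mask_iterate_sched {C : Finset (Fin r)} {L : List (Fin r)} (hL : ∀ b ∈ L, b ∈ C) (m : ℕ)
    (P : Fin r → List ℤ) : mask C ((sched Γ s L)^[m] P) = (sched Γ s L)^[m] (mask C P) := by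
  induction m generalizing P with
  | zero => rfl
  | succ m ih => rw [Function.iterate_succ_apply, ih, mask_sched hL, Function.iterate_succ_apply]

theorem iterate_sched_of_adj {c : Fin r} {L : List (Fin r)} (hL : ∀ b ∈ L, Γ.Adj b c) (m : ℕ)
    (P : Fin r → List ℤ) : (sched Γ s L)^[m] P c = P c := by
  induction m generalizing P with
  | zero => rfl
  | succ m ih => rw [Function.iterate_succ_apply, ih, sched_of_adj hL]

theorem exists_ends_matchOn (C : Finset (Fin r)) (a : Fin r) (hC : ConnectedFrom Γ C a) :
    ∃ K, ∀ (n : ℕ) (u v w w' : Word (Fin r)) (σ : State (Reg r)), Both Γ s n u v w w' σ →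
      List.length u ≤ n →
      Ends (matchOn Γ s C a) σ (K * (n + 1)) fun σ' => ∃ w₁ w₁', Both Γ s n u v w₁ w₁' σ' ∧
        (RotEquiv Γ s u v → (IsClosedIn Γ C u → ∀ c ∈ C, pile Γ c w₁ = pile Γ c w₁') ∧
          ∀ c ∈ u.map Prod.fst, (IsClosedIn Γ C u → c ∉ C) →
            pile Γ c w₁ = pile Γ c w ∧ pile Γ c w₁' = pile Γ c w') := by
  classical
  set L := (C.erase a).toList with hLdef
  have hL : ∀ b, b ∈ L ↔ b ∈ C ∧ b ≠ a := fun b => by simp [hLdef, and_comm]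
  have hL' : ∀ b ∈ L ++ [a], b ∈ C := by
    intro b hb
    rw [List.mem_append, List.mem_singleton] at hb
    rcases hb with hb | rfl
    · exact ((hL b).1 hb).1
    · exact hC.1
  set K₁ := 1 + ((stepRight Γ s L).cost + 2) with hK₁
  set K₂ := 1 + ((stepLeft Γ s C (L ++ [a])).cost + 2) with hK₂
  -- The two loops make `|C| n` and `(|C| + 2) n` iterations.
  refine ⟨(checkClosed Γ C).cost + 20 + (C.card + 1) * K₁ + (C.card + 3) * K₂,
    fun n u v w w' σ h hu => ?_⟩
  set Q : State (Reg r) → Prop := fun σ' => ∃ w₁ w₁', Both Γ s n u v w₁ w₁' σ' ∧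
        (RotEquiv Γ s u v → (IsClosedIn Γ C u → ∀ c ∈ C, pile Γ c w₁ = pile Γ c w₁') ∧
          ∀ c ∈ u.map Prod.fst, (IsClosedIn Γ C u → c ∉ C) →
            pile Γ c w₁ = pile Γ c w ∧ pile Γ c w₁' = pile Γ c w') with hQ
  have hmain : IsClosedIn Γ C u → ∀ σ, Both Γ s n u v w w' σ → Ends
      (.seq (.assign .M (.mul (.lit C.card) (.var .N))) <|
        .seq (.loop (.var .M) (stepRight Γ s L)) <|
        .seq (.assign .M (.mul (.lit (C.card + 2)) (.var .N))) <|
        .loop (.var .M) (stepLeft Γ s C (L ++ [a]))) σ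
      ((Expr.mul (.lit C.card) (.var (Reg.N : Reg r))).size + 1 +
        ((C.card * n + 1) * K₁ +
        ((Expr.mul (.lit (C.card + 2)) (.var (Reg.N : Reg r))).size + 1 +
          ((C.card + 2) * n + 1) * K₂))) Q := by
    intro hclosed σ h
    refine Ends.seq (R := fun σ' => Both Γ s n u v w w' σ' ∧ σ'.val .M = (C.card * n : ℕ))
      (Ends.assign ⟨h.set (Or.inl rfl) _, ?_⟩) ?_
    · simp [State.set, Expr.eval, h.bound]
    rintro σ₁ ⟨h1, hM1⟩
    refine Ends.seq (h1.ends_loopRight hM1) ?_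
    rintro σ₂ ⟨w₁', h2, e2⟩
    refine Ends.seq (R := fun σ' => Both Γ s n u v w w₁' σ' ∧
      σ'.val .M = ((C.card + 2) * n : ℕ)) (Ends.assign ⟨h2.set (Or.inl rfl) _, ?_⟩) ?_
    · simp [State.set, Expr.eval, h2.bound]
    rintro σ₃ ⟨h3, hM3⟩
    refine (h3.ends_loopLeft hL' hM3).mono le_rfl ?_
    rintro σ₄ ⟨w₁, h4, g1, g2⟩
    refine ⟨w₁, w₁', h4, fun huv => ⟨fun _ => g2 huv ?_, fun c hc hcC => ?_⟩⟩
    · have hww : RotEquiv Γ s w w' :=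
        (h.equiv_left.symm.trans _ _ _ huv).trans _ _ _ h.equiv_right
      have hwn : List.length w ≤ n := by rw [← h.equiv_left.length_eq]; exact hu
      -- After `|C| n` rotations the second word is stuck; the first one reaches the same state
      -- within `2 n` more steps than that.
      obtain ⟨i, hi, h5⟩ := exists_iterate_sched (T := C.card * n) hC hL hww
        (hclosed.of_perm h.equiv_left.perm_fst) (Nat.mul_le_mul_left _ hwn)
      refine ⟨i, ?_, ?_⟩
      · rw [Nat.add_mul]; omega
      · rw [h5, e2, mask_iterate_sched fun b hb => ((hL b).1 hb).1]
    -- The other vertices of the support commute with `C`, so rotations in `C` do not move their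
    -- strings.
    · have hadj : ∀ b ∈ C, Γ.Adj b c := fun b hb =>
        (((hclosed.1 c hc).resolve_left (hcC hclosed)) b hb).symm
      refine ⟨g1 c hadj, ?_⟩
      rw [show pile Γ c w₁' = _ from congrFun e2 c,
        iterate_sched_of_adj fun b hb => hadj b ((hL b).1 hb).1]
  have hguard := h.run_checkClosed C
  refine (Ends.seq (Ends.run (loopFree_check _ _) σ
    (Q := fun σ' => σ' = σ.set .D (if IsClosedIn Γ C u then 1 else 0)) hguard)
    (K₂ := (Expr.var (Reg.D : Reg r)).size +
      (((Expr.mul (.lit C.card) (.var (Reg.N : Reg r))).size + 1 +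
        ((C.card * n + 1) * K₁ +
        ((Expr.mul (.lit (C.card + 2)) (.var (Reg.N : Reg r))).size + 1 +
          ((C.card + 2) * n + 1) * K₂))) + 2)) (Q := Q) ?_).mono ?_ fun _ h => h
  · rintro _ rfl
    refine Ends.ifz (fun h0 => ?_) fun h0 => ?_
    · have hn : ¬ IsClosedIn Γ C u := fun hc => by simp [State.set, Expr.eval, hc] at h0
      refine (Ends.skip (Q := Q) ⟨w, w', h.set (Or.inr rfl) _, fun _ =>
        ⟨fun hc => absurd hc hn, fun _ _ _ => ⟨rfl, rfl⟩⟩⟩).mono (Nat.zero_le _) fun _ h => h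
    · have hc : IsClosedIn Γ C u := by
        by_contra hc
        simp [State.set, Expr.eval, hc] at h0
      exact hmain hc _ (h.set (Or.inr rfl) _)
  · simp only [Expr.size]
    change (checkClosed Γ C).cost + _ ≤ _
    nlinarith [Nat.zero_le (n * (checkClosed Γ C).cost), Nat.zero_le (n * K₁),
      Nat.zero_le (n * K₂), Nat.zero_le (C.card * K₁), Nat.zero_le (C.card * K₂),
      Nat.zero_le K₁, Nat.zero_le K₂, Nat.zero_le n]

end Compare

end RAAG

/-! ### The decision procedure in linear time -/

namespace RAAG

open RAM

section Decide

variable {r : ℕ} (Γ : SimpleGraph (Fin r)) [DecidableRel Γ.Adj] (s : Fin r → Bool)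

open Classical in
/-- The connected sets of vertices of the complement graph, with base points. -/
noncomputable def pairs : List (Finset (Fin r) × Fin r) :=
  (Finset.univ : Finset (Finset (Fin r) × Fin r)).toList.filter fun p =>
    decide (ConnectedFrom Γ p.1 p.2)

variable {Γ s}

theorem mem_pairs {p : Finset (Fin r) × Fin r} : p ∈ pairs Γ ↔ ConnectedFrom Γ p.1 p.2 := by
  simp [pairs]

/-- `C` is the component of `c` in the non-commutation graph on the support of `u`. -/
theorem exists_component {u : Word (Fin r)} {c : Fin r} (hc : c ∈ u.map Prod.fst) :
    ∃ C, c ∈ C ∧ ConnectedFrom Γ C c ∧ IsClosedIn Γ C u := by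
  classical
  let R : Fin r → Fin r → Prop := fun b d => d ∈ u.map Prod.fst ∧ ¬ Γ.Adj b d
  let C : Finset (Fin r) := Finset.univ.filter fun d => Relation.ReflTransGen R c d
  have hmem : ∀ d, d ∈ C ↔ Relation.ReflTransGen R c d := fun d => by simp [C]
  have hcC : c ∈ C := (hmem c).2 .refl
  refine ⟨C, hcC, ⟨hcC, fun d hd => ?_⟩, fun b hb => ?_, fun d hd => ?_⟩
  · have h := (hmem d).1 hd
    clear hd
    induction h with
    | refl => exact .refl
    | tail h h' ih => exact ih.tail ⟨(hmem _).2 (h.tail h'), h'.2⟩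
  · by_contra hn
    push Not at hn
    obtain ⟨hbC, d, hd, hbd⟩ := hn
    exact hbC ((hmem b).2 (((hmem d).1 hd).tail ⟨hb, fun h => hbd h.symm⟩))
  · rcases Relation.ReflTransGen.cases_tail ((hmem d).1 hd) with rfl | ⟨e, -, h⟩
    · exact hc
    · exact h.1

/-- The string of a vertex outside the support consists of zeros, so only its length matters. -/
theorem pile_eq_of_notMem {u v : Word (Fin r)} (h : (u.map Prod.fst).Perm (v.map Prod.fst))
    {c : Fin r} (hc : c ∉ u.map Prod.fst) : pile Γ c u = pile Γ c v := by
  have hv : c ∉ v.map Prod.fst := fun h' => hc (h.mem_iff.2 h')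
  rw [List.eq_replicate_of_mem (pile_zero_iff.2 hc), List.eq_replicate_of_mem (pile_zero_iff.2 hv),
    length_pile_of_perm h]

variable (Γ s)

/-- The test whether both words have the same pilings. -/
noncomputable def checkAll : Cmd (Reg r) :=
  check ((List.finRange r).map (fun c => .sub (.var (.S false c)) (.var (.S true c))) ++
    (List.finRange r).map fun c => .sub (.var (.Q false c)) (.var (.Q true c))) []

/-- The test whether two words are equal up to rotations. -/
noncomputable def compareWords : Cmd (Reg r) :=
  .seq (Cmd.seqs ((pairs Γ).map fun p => matchOn Γ s p.1 p.2)) checkAll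

/-- The decision procedure for twisted conjugacy. -/
noncomputable def decideConj : Cmd (Reg r) :=
  .seq (readWord Γ false) <| .seq (readWord Γ true) <|
    .seq (cycReduce Γ s false) <| .seq (cycReduce Γ s true) (compareWords Γ s)

variable {Γ s}

open Classical in
theorem Both.run_checkAll {n : ℕ} {u v w w' : Word (Fin r)} {σ : State (Reg r)}
    (h : Both Γ s n u v w w' σ) :
    checkAll.run σ = σ.set .D (if TraceEq Γ w w' then 1 else 0) := by
  rw [checkAll, run_check]
  · congr 1
    refine if_congr ?_ rfl rfl
    simp only [List.forall_mem_append, List.forall_mem_map, List.mem_finRange, true_imp_iff,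
      Expr.eval, sub_eq_zero, List.not_mem_nil, false_imp_iff, implies_true, and_true,
      (h.left _).1, (h.left _).2, (h.right _).1, (h.right _).2]
    refine ⟨fun h c => ?_, fun h => ⟨fun c => by rw [h c], fun c => by rw [h c]⟩⟩
    exact code_injective (isDigits_pile c w) (isDigits_pile c w')
      (Int.pow_right_injective (by norm_num) (h.2 c)) (h.1 c)
  · simp only [List.forall_mem_append, List.forall_mem_map]
    constructor <;>
    · intro e _ z
      simp [Expr.eval, State.set]
  · simp

-- The words only move within their rotation classes, so final agreement proves equivalence.
-- Conversely, equivalent words are made to agree on each component of the support and agree outside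
-- the support anyway. The number of pairs depends only on the graph.
open Classical in
theorem exists_ends_compareWords : ∃ K, ∀ (n : ℕ) (u v : Word (Fin r)) (σ : State (Reg r)),
    Both Γ s n u v u v σ → List.length u ≤ n →
    Ends (compareWords Γ s) σ (K * (n + 1)) fun σ' =>
      σ'.val .D = if RotEquiv Γ s u v then 1 else 0 := by
  have hK : ∀ p : Finset (Fin r) × Fin r, ∃ K, ConnectedFrom Γ p.1 p.2 →
      ∀ (n : ℕ) (u v w w' : Word (Fin r)) (σ : State (Reg r)), Both Γ s n u v w w' σ →
      List.length u ≤ n →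
      Ends (matchOn Γ s p.1 p.2) σ (K * (n + 1)) fun σ' => ∃ w₁ w₁', Both Γ s n u v w₁ w₁' σ' ∧
        (RotEquiv Γ s u v → (IsClosedIn Γ p.1 u → ∀ c ∈ p.1, pile Γ c w₁ = pile Γ c w₁') ∧
          ∀ c ∈ u.map Prod.fst, (IsClosedIn Γ p.1 u → c ∉ p.1) →
            pile Γ c w₁ = pile Γ c w ∧ pile Γ c w₁' = pile Γ c w') := by
    intro p
    by_cases hp : ConnectedFrom Γ p.1 p.2
    · obtain ⟨K, hK⟩ := exists_ends_matchOn (s := s) p.1 p.2 hp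
      exact ⟨K, fun _ => hK⟩
    · exact ⟨0, fun h => absurd h hp⟩
  choose K hK using hK
  refine ⟨((pairs Γ).map K).sum + (checkAll (r := r)).cost, fun n u v σ h hu => ?_⟩
  have h1 := Ends.seqs (f := fun p => matchOn Γ s p.1 p.2) (K := fun p => K p * (n + 1))
    (I := fun l σ => ∃ w w', Both Γ s n u v w w' σ ∧ (RotEquiv Γ s u v → ∀ q ∈ pairs Γ, q ∉ l →
      IsClosedIn Γ q.1 u → ∀ c ∈ q.1, pile Γ c w = pile Γ c w')) (pairs Γ) (s := σ) (by
        rintro p l σ hl ⟨w, w', h1, h2⟩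
        have hp : ConnectedFrom Γ p.1 p.2 := mem_pairs.1 (hl.subset (by simp))
        refine (hK p hp n u v w w' σ h1 hu).mono le_rfl ?_
        rintro σ' ⟨w₁, w₁', g1, g2⟩
        refine ⟨w₁, w₁', g1, fun huv q hq hql hqu c hc => ?_⟩
        obtain ⟨g3, g4⟩ := g2 huv
        -- Agreement reached earlier persists: the current pair either establishes it again at `c`
        -- or leaves both strings of `c` alone.
        by_cases hcp : IsClosedIn Γ p.1 u ∧ c ∈ p.1
        · exact g3 hcp.1 c hcp.2
        · have hqp : q ≠ p := by
            rintro rfl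
            exact hcp ⟨hqu, hc⟩
          obtain ⟨g5, g6⟩ := g4 c (hqu.2 c hc) fun h1 h2 => hcp ⟨h1, h2⟩
          rw [g5, g6]
          exact h2 huv q hq (by simp [hqp, hql]) hqu c hc)
    ⟨u, v, h, fun _ q hq hq' => absurd hq hq'⟩
  refine (h1.seq (K₂ := (checkAll (r := r)).cost) ?_).mono ?_ fun _ h => h
  · rintro σ' ⟨w, w', g1, g2⟩
    refine Ends.run (loopFree_check _ _) _ ?_
    change (checkAll.run σ').val .D = _
    rw [g1.run_checkAll]
    simp only [State.set, Function.update_self]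
    refine if_congr ⟨fun ht => ?_, fun huv c => ?_⟩ rfl rfl
    · exact (g1.equiv_left.trans _ _ _ (.rel _ _ (Or.inl ht))).trans _ _ _ g1.equiv_right.symm
    · by_cases hc : c ∈ u.map Prod.fst
      · obtain ⟨C, h3, h4, h5⟩ := exists_component (Γ := Γ) hc
        exact g2 huv (C, c) (mem_pairs.2 h4) (by simp) h5 c h3
      · have h3 := g1.equiv_left.perm_fst
        exact pile_eq_of_notMem ((h3.symm.trans huv.perm_fst).trans g1.equiv_right.perm_fst)
          fun h => hc (h3.mem_iff.2 h)
  · rw [List.sum_map_mul_right, Nat.add_mul]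
    exact Nat.add_le_add_left (Nat.le_mul_of_pos_right _ (Nat.succ_pos _)) _

theorem Holds.of_forall_eq {k : Bool} {w : Word (Fin r)} {σ σ' : State (Reg r)}
    (hf : ∀ c, σ'.val (.S (!k) c) = σ.val (.S (!k) c) ∧ σ'.val (.Q (!k) c) = σ.val (.Q (!k) c))
    (h : Holds Γ (!k) w σ) : Holds Γ (!k) w σ' := fun c => by
  rw [(hf c).1, (hf c).2]
  exact h c

open Classical in
theorem exists_ends_decideConj {φ : MulAut (RAAG Γ)}
    (hs : ∀ x, φ (eval Γ [x]) = eval Γ [flipLetter s x]) :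
    ∃ K, ∀ p : Word (Fin r) × Word (Fin r),
      Ends (decideConj Γ s) ⟨fun _ => 0, encodePair p⟩
        (K * (List.length p.1 + List.length p.2 + 1)) fun σ =>
          σ.val .D = if TCP φ p then 1 else 0 := by
  obtain ⟨K₁, h1⟩ := exists_ends_readWord (Γ := Γ) false
  obtain ⟨K₂, h2⟩ := exists_ends_readWord (Γ := Γ) true
  obtain ⟨K₃, h3⟩ := exists_ends_cycReduce hs false
  obtain ⟨K₄, h4⟩ := exists_ends_cycReduce hs true
  obtain ⟨K₅, h5⟩ := exists_ends_compareWords (Γ := Γ) (s := s)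
  refine ⟨K₁ + (K₂ + (K₃ + (K₄ + K₅))), fun p => ?_⟩
  set n := List.length p.1 + List.length p.2 with hn
  have hseq := (h1 p.1 (p.2.map encodeLetter ++ [0]) ⟨fun _ => 0, encodePair p⟩
    (by simp [encodePair]) fun _ => rfl).seq (c₂ := .seq (readWord Γ true) <|
    .seq (cycReduce Γ s false) <| .seq (cycReduce Γ s true) (compareWords Γ s))
    (K₂ := K₂ * (n + 1) + (K₃ * (n + 1) + (K₄ * (n + 1) + K₅ * (n + 1))))
    (Q := fun σ => σ.val .D = if TCP φ p then 1 else 0) ?_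
  · refine hseq.mono ?_ fun _ h => h
    have : K₁ * (List.length p.1 + 1) ≤ K₁ * (n + 1) := Nat.mul_le_mul_left _ (by omega)
    simp only [Nat.add_mul] at *
    omega
  rintro σ₁ ⟨i1, n1, f1, u, a1, a2, a3, a4⟩
  refine Ends.seq ((h2 p.2 [] σ₁ (by simp [i1]) fun c => (f1 c).1).mono
    (Nat.mul_le_mul_left _ (by omega)) fun _ h => h) ?_
  rintro σ₂ ⟨-, n2, f2, v, b1, b2, b3, b4⟩
  have hN : σ₂.val .N = n := by rw [n2, n1, hn]; simp
  have a5 : Holds Γ false u σ₂ := Holds.of_forall_eq (k := true) f2 a1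
  refine Ends.seq (h3 u σ₂ n a5 a2 (by omega)) ?_
  rintro σ₃ ⟨f3, u', a6, a7, a8, a9⟩
  refine Ends.seq (h4 v σ₃ n (b1.frame f3 (by simp)) b2 (by omega)) ?_
  rintro σ₄ ⟨f4, v', b6, b7, b8, b9⟩
  refine (h5 n u' v' σ₄ ⟨?_, a6.frame f4 (by simp), b6, .refl _, .refl _⟩ a8).mono le_rfl ?_
  · rw [f4.2 .N (by simp [Reg.Touch]), f3.2 .N (by simp [Reg.Touch]), hN]
  intro σ₅ hσ
  rw [hσ]
  -- The words held by the machine represent the inverses of the inputs up to twisted conjugacy, so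
  -- `twistedConj_inv_iff` intervenes in both directions.
  refine if_congr ⟨fun h => ?_, fun h => ?_⟩ rfl rfl
  · have := (a9.trans (h.twistedConj hs)).trans b9.symm
    rw [a3, b3, twistedConj_inv_iff hs] at this
    exact this
  · refine eqvGen_rotWord hs a7 b7 ?_
    have := (twistedConj_inv_iff hs _ _).2 h
    rw [← a3, ← b3] at this
    exact (a9.symm.trans this).trans b9

theorem decidableInLinearTimeRAM_TCP {φ : MulAut (RAAG Γ)}
    (hs : ∀ x, φ (eval Γ [x]) = eval Γ [flipLetter s x]) : DecidableInLinearTimeRAM (TCP φ) := by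
  classical
  obtain ⟨K, hK⟩ := exists_ends_decideConj hs
  refine ⟨(decideConj Γ s).program Reg.idx .D, K + 1, fun p => ?_⟩
  have key : ∀ z, (if TCP φ p then 1 else 0 : ℤ) = z →
      HaltsWithin ((decideConj Γ s).program Reg.idx .D) (encodePair p)
        ((K + 1) * (List.length p.1 + List.length p.2 + 1)) [z] := by
    rintro z rfl
    obtain ⟨t, ht, h⟩ := (hK p).haltsWithin Reg.idx_injective
    exact ⟨t, ht.trans (by rw [Nat.add_mul]; omega), h⟩
  exact ⟨fun h => key 1 (if_pos h), fun h => key 0 (if_neg h)⟩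

end Decide

end RAAG

theorem mainTheorem6 (r : ℕ) (Γ : SimpleGraph (Fin r)) (φ : MulAut (RAAG Γ)) :
    (IsLengthPreserving φ → ComputablePred (TCP φ)) ∧
    (IsCompositionOfInversions φ → DecidableInLinearTimeRAM (TCP φ)) := by
  classical
  refine ⟨fun h => RAAG.computablePred_TCP fun g => ?_, fun h => ?_⟩
  · obtain ⟨w, rfl⟩ := RAAG.exists_eval_eq Γ g
    exact (h w).symm
  · obtain ⟨s, hs⟩ := RAAG.exists_flipLetter h
    exact RAAG.decidableInLinearTimeRAM_TCP hs
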